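/- Let $M$ be a smooth manifold (finite-dimensional, Hausdorff, second countable) and let $A\to M$ be a Lie algebroid with anchor $\rho$ and de Rham complex $(\Omega(A),d_A)$, $\Omega^k(A)=\Gamma(\Lambda^kA^*)$. A representation up to homotopy of $A$ is a graded vector bundle $E=\bigoplus_{n\in\mathbb Z}E^n$ over $M$ with an operator $D$ on $\Omega(A;E)=\bigoplus_{i,j}\Omega^i(A;E^j)$, $\Omega^i(A;E^j)=\Gamma(\Lambda^iA^*\otimes E^j)$, which raises the total degree $i+j$ by one and satisfies $D^2=0$ and $D(\omega\eta)=d_A(\omega)\eta+(-1)^k\omega D(\eta)$ for $\omega\in\Omega^k(A)$, $\eta\in\Omega(A;E)$. Its cohomology is denoted $H^\bullet(A;E)$. The components $\Gamma(E^n)\to\Gamma(E^{n+1})$ and $\Gamma(E^n)\to\Omega^1(A;E^n)$ of $D$ are the differential $\partial$ of the underlying complex $(E,\partial)$ and an $A$-connection $\nabla$. A morphism $E\to F$ is an $\Omega(A)$-linear map $\Phi:\Omega(A;E)\to\Omega(A;F)$ of degree zero that commutes with the structure operators; it is a quasi-isomorphism if its component $\Phi_0:(E,\partial)\to(F,\partial)$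 induces isomorphisms of the pointwise cohomologies. Let $(E,D)$ be a representation up to homotopy of $A$ that is regular, i.e. every $\partial:E^n\to E^{n+1}$ has constant rank. Then the cohomology bundles $\mathcal H^n(E)=\operatorname{Ker}\partial/\operatorname{Im}\partial$ exist as smooth vector bundles over $M$, every section of $\mathcal H^n(E)$ is the class $[S]$ of a section $S\in\Gamma(E^n)$ with $\partial S=0$, and the following hold. 1. The equation $\overline\nabla_\alpha[S]=[\nabla_\alpha S]$ ($\alpha\in\Gamma(A)$, $S\in\Gamma(E^n)$, $\partial S=0$, in which case $\partial\nabla_\alpha S=0$) defines a flat $A$-connection $\overline\nabla$ on each $\mathcal H^n(E)$; that is, it makes $\mathcal H^\bullet(E)$ a representation of $A$. 2. The complex $(\mathcal H^\bullet(E),0)$ with the connection $\overline\nabla$ can be given the structure of a representation up to homotopy of $A$ (one whose components $\partial$ and $\nabla$ are $0$ and $\overline\nabla$) for which there is a quasi-isomorphism $E\to\mathcal H^\bullet(E)$. 3. There is a spectral sequence $$\mathcal E_2^{pq}=H^p(A;\mathcal H^q(E))\Rightarrow H^{p+q}(A;E),$$ where $H^\bullet(A;\mathcal H^q(E))$ is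 the cohomology of the representation $(\mathcal H^q(E),\overline\nabla)$. That is, $\mathcal E_2^{pq}\cong H^p(A;\mathcal H^q(E))$ for $p\ge 0$ and $\mathcal E_2^{pq}=0$ for $p<0$; the filtration of $H^n(A;E)$ by the form degree ($F^pH^n$ consists of the classes with a representative in $\bigoplus_{i\ge p}\Omega^i(A;E^{n-i})$) is decreasing and finite; and for all $p,q$ and all large $r$, the differentials into and out of $\mathcal E_r^{pq}$ vanish and $\mathcal E_r^{pq}\cong F^pH^{p+q}(A;E)/F^{p+1}H^{p+q}(A;E)$. -/

import Mathlib

open Bundle Manifold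
open scoped ContDiff TensorProduct

universe u v w


theorem isAddTorsionFree_of_real (N : Type*) [AddCommGroup N] [Module ℝ N] :
    IsAddTorsionFree N := by
  refine ⟨fun n hn x y h => ?_⟩
  have h' : (n : ℝ) • x = (n : ℝ) • y := by simpa [Nat.cast_smul_eq_nsmul] using h
  exact smul_right_injective N (Nat.cast_ne_zero.mpr hn : (n : ℝ) ≠ 0) h'

section Koszul

variable {K L N : Type*} [CommRing K] [AddCommGroup L] [Module K L] [AddCommGroup N] [Module K N]

/-- The sum `∑ (-1)^i ∇_{v i} ψ(v 0, …, v̂ i, …, v p)` of the Koszul formula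
(arguments are numbered from `0`). -/
def koszulFst (nab : L → N → N) {p : ℕ} (ψ : L [⋀^Fin p]→ₗ[K] N) (v : Fin (p + 1) → L) : N :=
  ∑ i : Fin (p + 1), (-1 : ℤ) ^ (i : ℕ) • nab (v i) (ψ (i.removeNth v))

/-- The sum `∑_{a < b} (-1)^(a+b) ψ([v a, v b], …, v̂ a, …, v̂ b, …)` of the Koszul formula. The pair
`a < b` is written as `a = i.castSucc`, `b = j.succ` with `i ≤ j`; after the removal of the argument
number `a`, the argument number `b` is the one with number `j`. -/
def koszulSnd (br : L → L → L) : {p : ℕ} → (L [⋀^Fin p]→ₗ[K] N) → (Fin (p + 1) → L) → N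
  | 0, _, _ => 0
  | p + 1, ψ, v => ∑ i : Fin (p + 1), ∑ j ∈ Finset.Ici i,
      (-1 : ℤ) ^ ((i.castSucc : ℕ) + (j.succ : ℕ)) •
        ψ (Fin.cons (br (v i.castSucc) (v j.succ)) (j.removeNth (i.castSucc.removeNth v)))

variable (K L N) in
/-- The algebraic input of the Koszul formula: a bracket `br`, an action `anc` on the ring `K` (the
anchor) and a connection `nab` that satisfy the Leibniz rules. Only `LieAlgebroid.trivialData` and
`AConnection.data` are used below. -/
structure KoszulData where
  br : L → L → L
  anc : L → K → K
  nab : L → N → N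
  br_add_left : ∀ x y z, br (x + y) z = br x z + br y z
  br_self : ∀ x, br x x = 0
  br_smul : ∀ (x : L) (f : K) (y : L), br x (f • y) = f • br x y + anc x f • y
  br_add_right : ∀ x y z, br x (y + z) = br x y + br x z
  nab_add_left : ∀ x y s, nab (x + y) s = nab x s + nab y s
  nab_add_right : ∀ x s t, nab x (s + t) = nab x s + nab x t
  nab_smul_left : ∀ (f : K) x s, nab (f • x) s = f • nab x s
  nab_smul_right : ∀ x (f : K) s, nab x (f • s) = f • nab x s + anc x f • s

theorem form_cons_add {q : ℕ} (η : L [⋀^Fin (q + 1)]→ₗ[K] N) (y z : L) (u : Fin q → L) :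
    η (Fin.cons (y + z) u) = η (Fin.cons y u) + η (Fin.cons z u) :=
  congrArg (fun F : L [⋀^Fin q]→ₗ[K] N => F u) (η.curryLeft.map_add y z)

theorem form_cons_smul {q : ℕ} (η : L [⋀^Fin (q + 1)]→ₗ[K] N) (g : K) (y : L) (u : Fin q → L) :
    η (Fin.cons (g • y) u) = g • η (Fin.cons y u) :=
  congrArg (fun F : L [⋀^Fin q]→ₗ[K] N => F u) (η.curryLeft.map_smul g y)

theorem form_cons_neg {q : ℕ} (η : L [⋀^Fin (q + 1)]→ₗ[K] N) (y : L) (u : Fin q → L) :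
    η (Fin.cons (-y) u) = - η (Fin.cons y u) :=
  congrArg (fun F : L [⋀^Fin q]→ₗ[K] N => F u) (η.curryLeft.map_neg y)

/-- An alternating `K`-multilinear map seen as an alternating `ℤ`-multilinear map. -/
def AlternatingMap.toInt {p : ℕ} (ψ : L [⋀^Fin p]→ₗ[K] N) : L [⋀^Fin p]→ₗ[ℤ] N where
  toFun := ψ
  map_update_add' := by intro _ v i x y; exact ψ.map_update_add' v i x y
  map_update_smul' := by
    intro inst v i c x
    obtain rfl : inst = instDecidableEqFin p := Subsingleton.elim _ _
    exact (ψ.toMultilinearMap.toLinearMap v i).map_smul_of_tower c x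
  map_eq_zero_of_eq' := ψ.map_eq_zero_of_eq'

namespace KoszulData

variable (k : KoszulData K L N)

theorem br_skew (x y : L) : k.br x y = - k.br y x := by
  have h := k.br_self (x + y)
  rw [k.br_add_left, k.br_add_right, k.br_add_right, k.br_self, k.br_self] at h
  rw [eq_neg_iff_add_eq_zero]; simpa using h

/-- The first sum is alternating. -/
def fstAlt {p : ℕ} (ψ : L [⋀^Fin p]→ₗ[K] N) : L [⋀^Fin (p + 1)]→ₗ[ℤ] N :=
  AlternatingMap.alternatizeUncurryFin
    (AddMonoidHom.toIntLinearMap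
      { toFun := fun x => (AddMonoidHom.toIntLinearMap
          { toFun := k.nab x
            map_zero' := by simpa using k.nab_add_right x 0 0
            map_add' := k.nab_add_right x }).compAlternatingMap ψ.toInt
        map_zero' := by
          ext v
          exact (by simpa using k.nab_add_left 0 0 (ψ v) : k.nab 0 (ψ v) = 0)
        map_add' := fun x y => by
          ext v; exact k.nab_add_left x y (ψ v) })

theorem fstAlt_apply {p : ℕ} (ψ : L [⋀^Fin p]→ₗ[K] N) (v : Fin (p + 1) → L) :
    k.fstAlt ψ v = koszulFst k.nab ψ v := by
  rw [fstAlt, AlternatingMap.alternatizeUncurryFin_apply]; rfl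

theorem snd_alt : ∀ {p : ℕ} (ψ : L [⋀^Fin p]→ₗ[K] N),
    ∃ G : L [⋀^Fin (p + 1)]→ₗ[ℤ] N, ∀ v, 2 • koszulSnd k.br ψ v = G v
  | 0, ψ => ⟨0, fun v => by simp [koszulSnd]⟩
  | p + 1, ψ => by
    let brh : L →ₗ[ℤ] L →ₗ[ℤ] L := AddMonoidHom.toIntLinearMap
      { toFun := fun x => AddMonoidHom.toIntLinearMap
          { toFun := k.br x
            map_zero' := by simpa using k.br_add_right x 0 0
            map_add' := k.br_add_right x }
        map_zero' := by ext y; simpa using k.br_add_left 0 0 y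
        map_add' := fun x y => by ext z; exact k.br_add_left x y z }
    let f : L →ₗ[ℤ] L →ₗ[ℤ] L [⋀^Fin p]→ₗ[ℤ] N :=
      LinearMap.compr₂ brh (AlternatingMap.toInt ψ).curryLeft
    have h1 : ∀ (x y : L) (w : Fin p → L), f x y w = ψ (Fin.cons (k.br x y) w) := fun x y w => by
      simp only [f, LinearMap.compr₂_apply]; rfl
    refine ⟨-AlternatingMap.alternatizeUncurryFin (AlternatingMap.alternatizeUncurryFinLM ∘ₗ f),
      fun v => ?_⟩
    rw [AlternatingMap.neg_apply,
      AlternatingMap.alternatizeUncurryFin_alternatizeUncurryFinLM_comp_apply]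
    simp only [koszulSnd, Finset.smul_sum, ← Finset.sum_neg_distrib]
    refine Finset.sum_congr rfl fun i _ => Finset.sum_congr rfl fun j _ => ?_
    rw [h1, h1, k.br_skew (v j.succ), form_cons_neg]
    simp only [Fin.val_castSucc, Fin.val_succ, ← add_assoc, pow_succ]
    module

/-- The Koszul formula. -/
def koszulFun {p : ℕ} (ψ : L [⋀^Fin p]→ₗ[K] N) (v : Fin (p + 1) → L) : N :=
  koszulFst k.nab ψ v + koszulSnd k.br ψ v

theorem koszulFun_alt {p : ℕ} (ψ : L [⋀^Fin p]→ₗ[K] N) :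
    ∃ G : L [⋀^Fin (p + 1)]→ₗ[ℤ] N, ∀ v, 2 • k.koszulFun ψ v = G v := by
  obtain ⟨G, hG⟩ := k.snd_alt ψ
  refine ⟨(2 : ℤ) • k.fstAlt ψ + G, fun v => ?_⟩
  rw [koszulFun, smul_add, hG, ← fstAlt_apply, AlternatingMap.add_apply, AlternatingMap.smul_apply,
    two_smul, two_smul]

theorem koszulFun_cons_smul {p : ℕ} (ψ : L [⋀^Fin p]→ₗ[K] N) (f : K) (x : L) (w : Fin p → L) :
    k.koszulFun ψ (Fin.cons (f • x) w) = f • k.koszulFun ψ (Fin.cons x w) := by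
  cases p with
  | zero => simp [koszulFun, koszulFst, koszulSnd, k.nab_smul_left]
  | succ p =>
    have hbr : ∀ z, k.br (f • x) z = f • k.br x z - k.anc z f • x := fun z => by
      rw [k.br_skew, k.br_smul, k.br_skew z x]; module
    have hrem : ∀ (y : L) (j : Fin (p + 1)),
        Fin.removeNth j.succ (Fin.cons y w : Fin (p + 2) → L) = Fin.cons y (j.removeNth w) := by
      intro y j
      ext l
      refine Fin.cases ?_ (fun l => ?_) l <;> simp [Fin.removeNth]
    have hF : ∀ y, koszulFst k.nab ψ (Fin.cons y w) = k.nab y (ψ w) +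
        ∑ j : Fin (p + 1), (-1 : ℤ) ^ (j + 1 : ℕ) • k.nab (w j) (ψ (Fin.cons y (j.removeNth w))) := by
      intro y
      rw [koszulFst, Fin.sum_univ_succ]
      simp only [hrem, Fin.cons_zero, Fin.cons_succ, Fin.val_succ, Fin.removeNth_zero, Fin.tail_cons]
      simp
    have hS : ∀ y, koszulSnd k.br ψ (Fin.cons y w) =
        (∑ j : Fin (p + 1), (-1 : ℤ) ^ (j + 1 : ℕ) • ψ (Fin.cons (k.br y (w j)) (j.removeNth w))) +
        ∑ i : Fin p, ∑ j ∈ Finset.Ici i.succ,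
          (-1 : ℤ) ^ ((i.succ.castSucc : ℕ) + (j.succ : ℕ)) •
            ψ (Fin.cons (k.br ((Fin.cons y w : Fin (p + 2) → L) i.succ.castSucc) (w j))
              (j.removeNth (i.succ.castSucc.removeNth (Fin.cons y w : Fin (p + 2) → L)))) := by
      intro y
      rw [koszulSnd, Fin.sum_univ_succ]
      have h0 : Finset.Ici (0 : Fin (p + 1)) = Finset.univ := by ext; simp
      simp only [h0, Fin.castSucc_zero, Fin.cons_zero, Fin.cons_succ, Fin.val_succ,
        Fin.removeNth_zero, Fin.tail_cons]
      simp
    rw [koszulFun, koszulFun, hF, hF, hS, hS]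
    have hT : ∀ i : Fin p, ∀ j ∈ Finset.Ici i.succ,
        ψ (Fin.cons (k.br ((Fin.cons (f • x) w : Fin (p + 2) → L) i.succ.castSucc) (w j))
          (j.removeNth (i.succ.castSucc.removeNth (Fin.cons (f • x) w : Fin (p + 2) → L)))) =
        f • ψ (Fin.cons (k.br ((Fin.cons x w : Fin (p + 2) → L) i.succ.castSucc) (w j))
          (j.removeNth (i.succ.castSucc.removeNth (Fin.cons x w : Fin (p + 2) → L)))) := by
      intro i j hj
      cases p with
      | zero => exact i.elim0
      | succ p =>
        have hj0 : j ≠ 0 := by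
          rintro rfl
          rw [Finset.mem_Ici] at hj
          exact absurd hj (by simp)
        obtain ⟨j, rfl⟩ := Fin.exists_succ_eq.mpr hj0
        have hr2 : ∀ y : L, (j.succ.removeNth (i.succ.castSucc.removeNth
            (Fin.cons y w : Fin (p + 3) → L))) =
            Fin.cons y (j.removeNth (i.castSucc.removeNth w)) := by
          intro y
          rw [← Fin.succ_castSucc, hrem]
          ext l
          refine Fin.cases ?_ (fun l => ?_) l <;> simp [Fin.removeNth]
        rw [hr2, hr2]
        simp only [← Fin.succ_castSucc, Fin.cons_succ]
        exact congrArg (fun F : L [⋀^Fin p]→ₗ[K] N => F (j.removeNth (i.castSucc.removeNth w)))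
          ((ψ.curryLeft (k.br (w i.castSucc) (w j.succ))).curryLeft.map_smul f x)
    have hT' := Finset.sum_congr (rfl : (Finset.univ : Finset (Fin p)) = _) fun i _ =>
      Finset.sum_congr (rfl : Finset.Ici i.succ = _) fun j hj =>
        congrArg (fun n : N => (-1 : ℤ) ^ ((i.succ.castSucc : ℕ) + (j.succ : ℕ)) • n) (hT i j hj)
    rw [hT']
    simp only [smul_add, Finset.smul_sum, k.nab_smul_left, hbr, form_cons_smul, k.nab_smul_right,
      sub_eq_add_neg, form_cons_add, form_cons_neg, Finset.sum_add_distrib, smul_neg,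
      Finset.sum_neg_distrib, smul_comm f ((-1 : ℤ) ^ _)]
    abel

theorem koszulFun_insertNth [IsAddTorsionFree N] {p : ℕ} (ψ : L [⋀^Fin p]→ₗ[K] N)
    (i : Fin (p + 1)) (x : L) (w : Fin p → L) :
    k.koszulFun ψ (i.insertNth x w) = (-1 : ℤ) ^ (i : ℕ) • k.koszulFun ψ (Fin.cons x w) := by
  obtain ⟨G, hG⟩ := k.koszulFun_alt ψ
  have h : 2 • k.koszulFun ψ (i.insertNth x w) =
      2 • ((-1 : ℤ) ^ (i : ℕ) • k.koszulFun ψ (Fin.cons x w)) := by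
    rw [hG, AlternatingMap.map_insertNth, smul_comm, hG]; rfl
  exact nsmul_right_injective two_ne_zero h

/-- The Koszul formula as an alternating `K`-multilinear map. -/
def koszul [IsAddTorsionFree N] {p : ℕ} (ψ : L [⋀^Fin p]→ₗ[K] N) : L [⋀^Fin (p + 1)]→ₗ[K] N where
  toFun := k.koszulFun ψ
  map_update_add' := by
    intro inst v i x y
    obtain rfl : inst = instDecidableEqFin (p + 1) := Subsingleton.elim _ _
    obtain ⟨G, hG⟩ := k.koszulFun_alt ψ
    refine nsmul_right_injective (M := N) two_ne_zero ?_
    simp only [smul_add, hG]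
    exact G.map_update_add v i x y
  map_update_smul' := by
    intro inst v i c x
    obtain rfl : inst = instDecidableEqFin (p + 1) := Subsingleton.elim _ _
    have hu : ∀ y, Function.update v i y = i.insertNth y (i.removeNth v) := fun y => by
      rw [Fin.insertNth_removeNth]
    rw [hu, hu, koszulFun_insertNth, koszulFun_insertNth, koszulFun_cons_smul, smul_comm]
  map_eq_zero_of_eq' := by
    intro v i j hv hij
    obtain ⟨G, hG⟩ := k.koszulFun_alt ψ
    refine nsmul_right_injective (M := N) two_ne_zero ?_
    simp only [hG, smul_zero]
    exact G.map_eq_zero_of_eq v hv hij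

end KoszulData
end Koszul

section Bundles

variable (E₀ : Type*) [NormedAddCommGroup E₀] [NormedSpace ℝ E₀]
  (M : Type*) [TopologicalSpace M] [ChartedSpace E₀ M]

/-- A smooth real vector bundle of finite rank over `M`. -/
structure VBundle where
  /-- the model fibre -/
  F : Type v
  /-- the fibres -/
  Fib : M → Type v
  [normedF : NormedAddCommGroup F]
  [spaceF : NormedSpace ℝ F]
  [finF : FiniteDimensional ℝ F]
  [addFib : ∀ x, AddCommGroup (Fib x)]
  [modFib : ∀ x, Module ℝ (Fib x)]
  [topFib : ∀ x, TopologicalSpace (Fib x)]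
  [topTotal : TopologicalSpace (TotalSpace F Fib)]
  [fiberBundle : FiberBundle F Fib]
  [vectorBundle : VectorBundle ℝ F Fib]
  [smoothBundle : ContMDiffVectorBundle ∞ F Fib 𝓘(ℝ, E₀)]

attribute [instance] VBundle.normedF VBundle.spaceF VBundle.finF VBundle.addFib VBundle.modFib
  VBundle.topFib VBundle.topTotal VBundle.fiberBundle VBundle.vectorBundle VBundle.smoothBundle

/-- The ring `C^∞(M)`. -/
abbrev SmoothFun : Type _ := C^∞⟮𝓘(ℝ, E₀), M; 𝓘(ℝ, ℝ), ℝ⟯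

variable {E₀ M}

/-- The smooth sections `Γ(V)`. -/
abbrev VBundle.Sec (V : VBundle.{v} E₀ M) : Type _ := Cₛ^∞⟮𝓘(ℝ, E₀); V.F, V.Fib⟯

namespace VBundle

variable (V : VBundle.{v} E₀ M)

noncomputable instance secSMul : SMul (SmoothFun E₀ M) V.Sec where
  smul f s := ⟨fun x => f x • s x, f.contMDiff.smul_section s.contMDiff⟩

@[simp] theorem smul_apply (f : SmoothFun E₀ M) (s : V.Sec) (x : M) : (f • s) x = f x • s x := rfl

noncomputable instance secModule : Module (SmoothFun E₀ M) V.Sec where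
  one_smul s := by ext x; exact one_smul ℝ (s x)
  mul_smul f g s := by ext x; exact mul_smul (f x) (g x) (s x)
  smul_zero f := by ext x; exact smul_zero (f x)
  smul_add f s t := by ext x; exact smul_add (f x) (s x) (t x)
  add_smul f g s := by ext x; exact add_smul (f x) (g x) (s x)
  zero_smul s := by ext x; exact zero_smul ℝ (s x)

noncomputable instance secSMulComm : SMulCommClass (SmoothFun E₀ M) ℝ V.Sec where
  smul_comm f c s := by ext x; exact smul_comm (f x) c (s x)

instance secTower : IsScalarTower ℝ (SmoothFun E₀ M) V.Sec where
  smul_assoc c f s := by ext x; exact smul_assoc c (f x) (s x)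

/-- Evaluation of sections at a point. -/
noncomputable def evalAt (x : M) : V.Sec →ₗ[ℝ] V.Fib x where
  toFun s := s x
  map_add' _ _ := rfl
  map_smul' _ _ := rfl

end VBundle

variable (E₀ M) [IsManifold 𝓘(ℝ, E₀) ∞ M]
/-- A Lie algebroid over `M`: a smooth vector bundle `A` with an anchor `A → TM`, which is a smooth
vector bundle map, and a Lie bracket on `Γ(A)` with the Leibniz rule
`[α, fβ] = f[α, β] + ρ(α)(f)β`. -/
structure LieAlgebroid where
  A : VBundle.{v} E₀ M
  anchor : ∀ x, A.Fib x →ₗ[ℝ] TangentSpace 𝓘(ℝ, E₀) x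
  contMDiff_anchor : ContMDiff (𝓘(ℝ, E₀).prod 𝓘(ℝ, A.F)) 𝓘(ℝ, E₀).tangent ∞
    (fun a : TotalSpace A.F A.Fib => (⟨a.proj, anchor a.proj a.2⟩ : TangentBundle 𝓘(ℝ, E₀) M))
  bracket : A.Sec →ₗ[ℝ] A.Sec →ₗ[ℝ] A.Sec
  bracket_self : ∀ α, bracket α α = 0
  jacobi : ∀ α β γ,
    bracket α (bracket β γ) + bracket β (bracket γ α) + bracket γ (bracket α β) = 0
  leibniz : ∀ (α β : A.Sec) (f : SmoothFun E₀ M) (x : M),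
    bracket α (f • β) x = f x • bracket α β x +
      (mvfderiv 𝓘(ℝ, E₀) f x (anchor x (α x))) • β x

variable {E₀ M}
namespace LieAlgebroid
variable (𝔄 : LieAlgebroid.{v} E₀ M)

theorem contMDiff_lieDeriv (α : 𝔄.A.Sec) (f : SmoothFun E₀ M) :
    ContMDiff 𝓘(ℝ, E₀) 𝓘(ℝ, ℝ) ∞
      (fun x => mvfderiv 𝓘(ℝ, E₀) f x (𝔄.anchor x (α x))) := by
  have h1 := 𝔄.contMDiff_anchor.comp α.contMDiff
  have h2 : ContMDiff 𝓘(ℝ, E₀).tangent 𝓘(ℝ, ℝ).tangent ∞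
      (tangentMap 𝓘(ℝ, E₀) 𝓘(ℝ, ℝ) f) := f.contMDiff.contMDiff_tangentMap le_rfl
  have h3 := (contMDiff_snd_tangentBundle_modelSpace ℝ 𝓘(ℝ, ℝ) (n := ∞)).comp (h2.comp h1)
  exact h3

/-- `L_{ρ(α)} f` -/
noncomputable def lieDeriv (α : 𝔄.A.Sec) (f : SmoothFun E₀ M) : SmoothFun E₀ M :=
  ⟨fun x => mvfderiv 𝓘(ℝ, E₀) f x (𝔄.anchor x (α x)), 𝔄.contMDiff_lieDeriv α f⟩


@[simp] theorem lieDeriv_apply (α : 𝔄.A.Sec) (f : SmoothFun E₀ M) (x : M) :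
    𝔄.lieDeriv α f x = mvfderiv 𝓘(ℝ, E₀) f x (𝔄.anchor x (α x)) := rfl

theorem lieDeriv_add_left (α β : 𝔄.A.Sec) (f : SmoothFun E₀ M) :
    𝔄.lieDeriv (α + β) f = 𝔄.lieDeriv α f + 𝔄.lieDeriv β f := by
  ext x
  have h : (α + β) x = α x + β x := rfl
  simp [h]

theorem lieDeriv_smul_left (g : SmoothFun E₀ M) (α : 𝔄.A.Sec) (f : SmoothFun E₀ M) :
    𝔄.lieDeriv (g • α) f = g • 𝔄.lieDeriv α f := by
  ext x
  simp

theorem lieDeriv_add (α : 𝔄.A.Sec) (f g : SmoothFun E₀ M) :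
    𝔄.lieDeriv α (f + g) = 𝔄.lieDeriv α f + 𝔄.lieDeriv α g := by
  ext x
  have hf : MDifferentiableAt 𝓘(ℝ, E₀) 𝓘(ℝ, ℝ) f x := f.contMDiff.mdifferentiable (by simp) x
  have hg : MDifferentiableAt 𝓘(ℝ, E₀) 𝓘(ℝ, ℝ) g x := g.contMDiff.mdifferentiable (by simp) x
  simp [mvfderiv_add hf hg]

theorem lieDeriv_mul (α : 𝔄.A.Sec) (f g : SmoothFun E₀ M) :
    𝔄.lieDeriv α (f * g) = f * 𝔄.lieDeriv α g + 𝔄.lieDeriv α f * g := by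
  ext x
  have hf : MDifferentiableAt 𝓘(ℝ, E₀) 𝓘(ℝ, ℝ) f x := f.contMDiff.mdifferentiable (by simp) x
  have hg : MDifferentiableAt 𝓘(ℝ, E₀) 𝓘(ℝ, ℝ) g x := g.contMDiff.mdifferentiable (by simp) x
  simp [mvfderiv_mul hf hg, mul_comm]

theorem bracket_smul (α : 𝔄.A.Sec) (f : SmoothFun E₀ M) (β : 𝔄.A.Sec) :
    𝔄.bracket α (f • β) = f • 𝔄.bracket α β + 𝔄.lieDeriv α f • β := by
  ext x
  exact 𝔄.leibniz α β f x

/-- The data for the Koszul formula on `Ω(A)`: the trivial line bundle with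
`∇_α f = L_{ρ(α)} f`. -/
noncomputable def trivialData : KoszulData (SmoothFun E₀ M) 𝔄.A.Sec (SmoothFun E₀ M) where
  br α β := 𝔄.bracket α β
  anc := 𝔄.lieDeriv
  nab := 𝔄.lieDeriv
  br_add_left α β γ := by simp
  br_self := 𝔄.bracket_self
  br_smul := 𝔄.bracket_smul
  br_add_right α β γ := by simp
  nab_add_left := 𝔄.lieDeriv_add_left
  nab_add_right := 𝔄.lieDeriv_add
  nab_smul_left := 𝔄.lieDeriv_smul_left
  nab_smul_right := 𝔄.lieDeriv_mul

/-- `Ω^p(A) = Γ(Λ^p A^*)`, as alternating `C^∞(M)`-multilinear maps `Γ(A)^p → C^∞(M)`. -/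
abbrev ScalarForm (p : ℕ) : Type _ := 𝔄.A.Sec [⋀^Fin p]→ₗ[SmoothFun E₀ M] SmoothFun E₀ M

/-- `Ω^p(A; V) = Γ(Λ^p A^* ⊗ V)`, as alternating `C^∞(M)`-multilinear maps `Γ(A)^p → Γ(V)`. -/
abbrev Form (V : VBundle.{w} E₀ M) (p : ℕ) : Type _ :=
  𝔄.A.Sec [⋀^Fin p]→ₗ[SmoothFun E₀ M] V.Sec

instance : IsAddTorsionFree (SmoothFun E₀ M) := isAddTorsionFree_of_real _

/-- The de Rham operator `d_A` on `Ω(A)`. -/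
noncomputable def dA {p : ℕ} (ψ : 𝔄.ScalarForm p) : 𝔄.ScalarForm (p + 1) := 𝔄.trivialData.koszul ψ

/-- The product `ψ η ∈ Ω^{k+p}(A; V)` of `ψ ∈ Ω^k(A)` and `η ∈ Ω^p(A; V)`, the sum over
`(k, p)`-shuffles `∑ sgn(σ) ψ(α_{σ(1)}, …, α_{σ(k)}) η(α_{σ(k+1)}, …, α_{σ(k+p)})`. -/
noncomputable def mulForm {V : VBundle.{w} E₀ M} {k p : ℕ} (ψ : 𝔄.ScalarForm k) (η : 𝔄.Form V p) :
    𝔄.Form V (k + p) :=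
  ((TensorProduct.lid (SmoothFun E₀ M) V.Sec).toLinearMap.compAlternatingMap
    (ψ.domCoprod η)).domDomCongr finSumFinEquiv

/-- `mulForm` as an `ℝ`-linear map in the second variable. -/
noncomputable def mulFormLin {V : VBundle.{w} E₀ M} {k : ℕ} (ψ : 𝔄.ScalarForm k) (p : ℕ) :
    𝔄.Form V p →ₗ[ℝ] 𝔄.Form V (k + p) where
  toFun := 𝔄.mulForm ψ
  map_add' η θ := by
    have h := (AlternatingMap.domCoprod' (R' := SmoothFun E₀ M)).map_add (ψ ⊗ₜ η) (ψ ⊗ₜ θ)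
    rw [← TensorProduct.tmul_add] at h
    simp only [AlternatingMap.domCoprod'_apply] at h
    ext1 v
    simp [mulForm, h]
  map_smul' c η := by
    have key : ∀ {q : ℕ} (θ : 𝔄.Form V q), algebraMap ℝ (SmoothFun E₀ M) c • θ = c • θ := by
      intro q θ
      ext1 v
      exact algebraMap_smul (SmoothFun E₀ M) c (θ v)
    have h := (AlternatingMap.domCoprod' (R' := SmoothFun E₀ M)).map_smul
      (algebraMap ℝ (SmoothFun E₀ M) c) (ψ ⊗ₜ η)
    rw [← TensorProduct.tmul_smul] at h
    simp only [AlternatingMap.domCoprod'_apply] at h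
    rw [RingHom.id_apply, ← key, ← key]
    ext1 v
    rw [mulForm, h]
    exact (TensorProduct.lid (SmoothFun E₀ M) V.Sec).toLinearMap.map_smul _ _

/-- `Ω(A; E) = ⨁_{i, j} Ω^i(A; E^j)` for a graded vector bundle `E = ⨁_j E^j`, given as the family
of the vector bundles `E^j`, `j ∈ ℤ`. (That only finitely many `E^j` are nonzero is not needed.) -/
def GForm (E : ℤ → VBundle.{w} E₀ M) : Type _ :=
  DirectSum (ℕ × ℤ) fun ij => 𝔄.Form (E ij.2) ij.1

section GForm

variable (E : ℤ → VBundle.{w} E₀ M)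

noncomputable instance : AddCommGroup (𝔄.GForm E) :=
  inferInstanceAs (AddCommGroup (DirectSum (ℕ × ℤ) fun ij => 𝔄.Form (E ij.2) ij.1))

noncomputable instance : Module ℝ (𝔄.GForm E) :=
  inferInstanceAs (Module ℝ (DirectSum (ℕ × ℤ) fun ij => 𝔄.Form (E ij.2) ij.1))

/-- The projection `Ω(A; E) → Ω^i(A; E^j)`. -/
noncomputable def component (i : ℕ) (j : ℤ) : 𝔄.GForm E →ₗ[ℝ] 𝔄.Form (E j) i :=
  DirectSum.component ℝ (ℕ × ℤ) (fun ij => 𝔄.Form (E ij.2) ij.1) (i, j)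

/-- The inclusion `Ω^i(A; E^j) → Ω(A; E)`. -/
noncomputable def inclusion (i : ℕ) (j : ℤ) : 𝔄.Form (E j) i →ₗ[ℝ] 𝔄.GForm E :=
  DirectSum.lof ℝ (ℕ × ℤ) (fun ij => 𝔄.Form (E ij.2) ij.1) (i, j)

/-- The part of `Ω(A; E)` of total degree `n`: the sum of the `Ω^i(A; E^j)` with `i + j = n`. -/
noncomputable def totalDegree (n : ℤ) : Submodule ℝ (𝔄.GForm E) :=
  ⨅ (i : ℕ) (j : ℤ) (_ : (i : ℤ) + j ≠ n), LinearMap.ker (𝔄.component E i j)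

/-- `F^p Ω(A; E) = Ω^p(A; E) ⊕ Ω^{p+1}(A; E) ⊕ …`, the filtration by the form degree. -/
noncomputable def formFiltration (p : ℤ) : Submodule ℝ (𝔄.GForm E) :=
  ⨅ (i : ℕ) (j : ℤ) (_ : (i : ℤ) < p), LinearMap.ker (𝔄.component E i j)

variable {E}

/-- The left multiplication by `ψ ∈ Ω^k(A)` on `Ω(A; E)`. -/
noncomputable def mul {k : ℕ} (ψ : 𝔄.ScalarForm k) : 𝔄.GForm E →ₗ[ℝ] 𝔄.GForm E :=
  DirectSum.toModule ℝ (ℕ × ℤ) (𝔄.GForm E) fun ij =>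
    𝔄.inclusion E (k + ij.1) ij.2 ∘ₗ 𝔄.mulFormLin ψ ij.1

/-- The inclusion `Γ(E^n) = Ω^0(A; E^n) → Ω(A; E)`. -/
noncomputable def ofSec (n : ℤ) : (E n).Sec →ₗ[ℝ] 𝔄.GForm E :=
  𝔄.inclusion E 0 n ∘ₗ
    { toFun := fun s => AlternatingMap.constOfIsEmpty (SmoothFun E₀ M) 𝔄.A.Sec (Fin 0) s
      map_add' := fun _ _ => rfl
      map_smul' := fun _ _ => rfl }

/-- The component of an element of `Ω(A; E)` in `Ω^0(A; E^n) = Γ(E^n)`. -/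
noncomputable def toSec (n : ℤ) : 𝔄.GForm E →ₗ[ℝ] (E n).Sec where
  toFun η := 𝔄.component E 0 n η Fin.elim0
  map_add' _ _ := by simp
  map_smul' _ _ := by simp

end GForm

end LieAlgebroid

variable (𝔄 : LieAlgebroid.{v} E₀ M)

/-- An `A`-connection on `V`. -/
@[ext]
structure AConnection (V : VBundle.{w} E₀ M) where
  nabla : 𝔄.A.Sec →ₗ[ℝ] V.Sec →ₗ[ℝ] V.Sec
  smul_left : ∀ (f : SmoothFun E₀ M) (α : 𝔄.A.Sec) (s : V.Sec),
    nabla (f • α) s = f • nabla α s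
  leibniz : ∀ (α : 𝔄.A.Sec) (f : SmoothFun E₀ M) (s : V.Sec),
    nabla α (f • s) = f • nabla α s + 𝔄.lieDeriv α f • s

namespace AConnection

variable {𝔄} {V : VBundle.{w} E₀ M} (c : AConnection 𝔄 V)

/-- The `A`-curvature vanishes; `V` with such a connection is a representation of `A`. -/
def IsFlat : Prop :=
  ∀ (α β : 𝔄.A.Sec) (s : V.Sec),
    c.nabla α (c.nabla β s) - c.nabla β (c.nabla α s) - c.nabla (𝔄.bracket α β) s = 0

/-- The data for the Koszul formula on `Ω(A; V)`. -/
noncomputable def data : KoszulData (SmoothFun E₀ M) 𝔄.A.Sec V.Sec where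
  br α β := 𝔄.bracket α β
  anc := 𝔄.lieDeriv
  nab α s := c.nabla α s
  br_add_left α β γ := by simp
  br_self := 𝔄.bracket_self
  br_smul := 𝔄.bracket_smul
  br_add_right α β γ := by simp
  nab_add_left α β s := by simp
  nab_add_right α s t := by simp
  nab_smul_left := c.smul_left
  nab_smul_right := c.leibniz

instance : IsAddTorsionFree V.Sec := isAddTorsionFree_of_real _

/-- The operator `d_∇ : Ω^p(A; V) → Ω^{p+1}(A; V)`. -/
noncomputable def d (p : ℕ) : 𝔄.Form V p →ₗ[ℝ] 𝔄.Form V (p + 1) where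
  toFun ψ := c.data.koszul ψ
  map_add' ψ η := by
    ext1 v
    change koszulFst _ (ψ + η) v + koszulSnd _ (ψ + η) v =
      koszulFst _ ψ v + koszulSnd _ ψ v + (koszulFst _ η v + koszulSnd _ η v)
    cases p <;> simp [koszulFst, koszulSnd, data, Finset.sum_add_distrib]
    abel
  map_smul' a ψ := by
    ext1 v
    change koszulFst _ (a • ψ) v + koszulSnd _ (a • ψ) v =
      a • (koszulFst _ ψ v + koszulSnd _ ψ v)
    cases p <;> simp [koszulFst, koszulSnd, data, Finset.smul_sum, smul_comm a]

/-- The coboundaries in `Ω^p(A; V)`. -/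
noncomputable def coboundaries : (p : ℕ) → Submodule ℝ (𝔄.Form V p)
  | 0 => ⊥
  | p + 1 => LinearMap.range (c.d p)

/-- `H^p(A; V)`, the cohomology of `(Ω(A; V), d_∇)` for a representation `(V, ∇)`. -/
abbrev Cohomology (p : ℕ) : Type _ :=
  LinearMap.ker (c.d p) ⧸ (c.coboundaries p).comap (LinearMap.ker (c.d p)).subtype

end AConnection

/-- A structure of representation up to homotopy of `A` on the graded vector bundle `E`: a structure
operator `D` on `Ω(A; E)`, that is, an operator of total degree one with `D² = 0` and
`D(ψ η) = d_A(ψ) η + (-1)^k ψ D(η)` for `ψ ∈ Ω^k(A)`. -/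
structure RepUpToHomotopy (E : ℤ → VBundle.{w} E₀ M) where
  D : 𝔄.GForm E →ₗ[ℝ] 𝔄.GForm E
  map_totalDegree : ∀ (n : ℤ), ∀ η ∈ 𝔄.totalDegree E n, D η ∈ 𝔄.totalDegree E (n + 1)
  sq_zero : ∀ η, D (D η) = 0
  derivation : ∀ {k : ℕ} (ψ : 𝔄.ScalarForm k) (η : 𝔄.GForm E),
    D (𝔄.mul ψ η) = 𝔄.mul (𝔄.dA ψ) η + (-1 : ℝ) ^ k • 𝔄.mul ψ (D η)

namespace RepUpToHomotopy

variable {𝔄} {E : ℤ → VBundle.{w} E₀ M} (R : RepUpToHomotopy 𝔄 E)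

/-- The component `Γ(E^m) → Γ(E^n)` of `D`. For `n = m + 1` it is the differential `∂` of the
underlying complex, on sections (for other `n` it is zero). -/
noncomputable def del (m n : ℤ) : (E m).Sec →ₗ[ℝ] (E n).Sec :=
  𝔄.toSec n ∘ₗ R.D ∘ₗ 𝔄.ofSec m

/-- The `A`-connection `∇` on `E^n`: the component `Γ(E^n) → Ω^1(A; E^n)` of `D`. -/
noncomputable def nabla (n : ℤ) (α : 𝔄.A.Sec) (s : (E n).Sec) : (E n).Sec :=
  𝔄.component E 1 n (R.D (𝔄.ofSec n s)) fun _ => α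

/-- The kernel of `∂` in the fibre `E^n_x`. As `∂` is `C^∞(M)`-linear, `(∂ s)(x)` only depends on
`s(x)`, and every vector of `E^n_x` is the value of a section. -/
noncomputable def kerAt (n : ℤ) (x : M) : Submodule ℝ ((E n).Fib x) :=
  (LinearMap.ker ((E (n + 1)).evalAt x ∘ₗ R.del n (n + 1))).map ((E n).evalAt x)

/-- The image of `∂` in the fibre `E^n_x`. -/
noncomputable def imAt (n : ℤ) (x : M) : Submodule ℝ ((E n).Fib x) :=
  LinearMap.range ((E n).evalAt x ∘ₗ R.del (n - 1) n)

/-- The underlying complex `(E, ∂)` is regular: every `∂ : E^n → E^{n+1}` has constant rank. -/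
def IsRegular : Prop :=
  ∀ n : ℤ, ∃ r : ℕ, ∀ x : M, Module.finrank ℝ (R.imAt n x) = r

theorem mem_kerAt {n : ℤ} {S : (E n).Sec} (hS : R.del n (n + 1) S = 0) (x : M) :
    S x ∈ R.kerAt n x :=
  ⟨S, by simp [hS], rfl⟩

/-- The cocycles of total degree `n` in `(Ω(A; E), D)`. -/
noncomputable def cocycles (n : ℤ) : Submodule ℝ (𝔄.GForm E) := LinearMap.ker R.D ⊓ 𝔄.totalDegree E n

/-- `H^n(A; E)`, the cohomology of `(Ω(A; E), D)`. -/
abbrev Cohomology (n : ℤ) : Type _ :=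
  R.cocycles n ⧸ ((𝔄.totalDegree E (n - 1)).map R.D).comap (R.cocycles n).subtype

/-- The classes in `H^n(A; E)` that have a representative in `F^p Ω(A; E)`. -/
noncomputable def cohomologyFiltration (p n : ℤ) : Submodule ℝ (R.Cohomology n) :=
  ((𝔄.formFiltration E p).comap (R.cocycles n).subtype).map (Submodule.mkQ _)

/-- The cohomology bundles `H^n(E) = Ker ∂ / Im ∂`: smooth vector bundles with fibrewise surjections
`Ker ∂ → H^n(E)` of kernel `Im ∂`, such that smooth sections of `Ker ∂` have smooth images. (For a
regular complex, this determines `H^n(E)` up to a unique isomorphism.) -/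
structure CohomologyBundle where
  H : ℤ → VBundle.{w} E₀ M
  proj : ∀ (n : ℤ) (x : M), R.kerAt n x →ₗ[ℝ] (H n).Fib x
  proj_surjective : ∀ n x, Function.Surjective (proj n x)
  ker_proj : ∀ n x, LinearMap.ker (proj n x) = (R.imAt n x).comap (R.kerAt n x).subtype
  contMDiff_proj : ∀ (n : ℤ) (S : (E n).Sec) (hS : R.del n (n + 1) S = 0),
    ContMDiff 𝓘(ℝ, E₀) (𝓘(ℝ, E₀).prod 𝓘(ℝ, (H n).F)) ∞
      (fun x => TotalSpace.mk' (H n).F x (proj n x ⟨S x, R.mem_kerAt hS x⟩))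

/-- The class `[S] ∈ Γ(H^n(E))` of a section `S` of `E^n` with `∂ S = 0`. -/
noncomputable def CohomologyBundle.cls {R : RepUpToHomotopy 𝔄 E} (C : R.CohomologyBundle) {n : ℤ}
    (S : (E n).Sec) (hS : R.del n (n + 1) S = 0) : (C.H n).Sec :=
  ⟨fun x => C.proj n x ⟨S x, R.mem_kerAt hS x⟩, C.contMDiff_proj n S hS⟩

end RepUpToHomotopy

/-- A morphism of representations up to homotopy: an `Ω(A)`-linear map `Ω(A; E) → Ω(A; F)` of degree
zero that commutes with the structure operators. -/
structure RepMorphism {𝔄 : LieAlgebroid.{v} E₀ M} {E F : ℤ → VBundle.{w} E₀ M}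
    (R : RepUpToHomotopy 𝔄 E) (R' : RepUpToHomotopy 𝔄 F) where
  Φ : 𝔄.GForm E →ₗ[ℝ] 𝔄.GForm F
  map_totalDegree : ∀ (n : ℤ), ∀ η ∈ 𝔄.totalDegree E n, Φ η ∈ 𝔄.totalDegree F n
  map_mul : ∀ {k : ℕ} (ψ : 𝔄.ScalarForm k) (η : 𝔄.GForm E), Φ (𝔄.mul ψ η) = 𝔄.mul ψ (Φ η)
  comm : ∀ η, Φ (R.D η) = R'.D (Φ η)

namespace RepMorphism

variable {𝔄} {E F : ℤ → VBundle.{w} E₀ M} {R : RepUpToHomotopy 𝔄 E} {R' : RepUpToHomotopy 𝔄 F}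

/-- The map of complexes `Φ_0`, on sections. -/
noncomputable def comp₀ (f : RepMorphism R R') (n : ℤ) : (E n).Sec →ₗ[ℝ] (F n).Sec :=
  𝔄.toSec n ∘ₗ f.Φ ∘ₗ 𝔄.ofSec n

/-- `Φ_0` induces bijections `Ker ∂_x / Im ∂_x → Ker ∂_x / Im ∂_x` of the pointwise cohomologies.
Vectors in the fibres over `x` are written as values `s(x)` of sections. -/
def IsQuasiIso (f : RepMorphism R R') : Prop :=
  ∀ (n : ℤ) (x : M),
    (∀ s : (E n).Sec, s x ∈ R.kerAt n x → f.comp₀ n s x ∈ R'.imAt n x → s x ∈ R.imAt n x) ∧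
    (∀ t : (F n).Sec, t x ∈ R'.kerAt n x →
      ∃ s : (E n).Sec, s x ∈ R.kerAt n x ∧ f.comp₀ n s x - t x ∈ R'.imAt n x)

end RepMorphism

end Bundles

section Convergence

open CategoryTheory

/-- An `E₂`-spectral sequence of real vector spaces converges to the graded space `H`, filtered by
`Fil`: the filtration is decreasing and finite in every degree, and for each `(p, q)` there is an
`r₀` such that all differentials into and out of `E_r^{pq}` vanish and
`E_r^{pq} ≅ F^p H^{p+q} / F^{p+1} H^{p+q}` for `r ≥ r₀`. -/
structure SpectralConverges (S : E₂CohomologicalSpectralSequence (ModuleCat.{w} ℝ)) (H : ℤ → Type w)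
    [∀ n, AddCommGroup (H n)] [∀ n, Module ℝ (H n)] (Fil : ℤ → ∀ n, Submodule ℝ (H n)) : Prop where
  antitone : ∀ n, Antitone fun p => Fil p n
  exhaustive : ∀ n, ∃ p, Fil p n = ⊤
  separated : ∀ n, ∃ p, Fil p n = ⊥
  stable : ∀ p q : ℤ, ∃ r₀ : ℤ, ∀ (r : ℤ) (hr : 2 ≤ r), r₀ ≤ r →
    (∀ k : ℤ × ℤ, (S.page r hr).d k (p, q) = 0 ∧ (S.page r hr).d (p, q) k = 0) ∧
    Nonempty ((S.page r hr).X (p, q) ≅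
      ModuleCat.of ℝ (Fil p (p + q) ⧸ (Fil (p + 1) (p + q)).comap (Fil p (p + q)).subtype))

end Convergence

/-! Regularity makes `∂` a bundle map of constant rank, so it has a smooth generalized inverse `K`:
local ones come from frames of the image, and a partition of unity glues them because `T K T = T`
survives convex combinations (`VBundle.exists_generalized_inverse`). An algebraic correction gives
`k` with `∂k∂ = ∂`, `k∂k = k` and `k² = 0` (`IsRegular.exists_splitting`). Then `1 - ∂k - k∂`
projects onto a complement of `Im ∂` in `Ker ∂`. A trace computation shows that its rank is
constant, its image is a model of the cohomology bundle, and for any cohomology bundle it yields a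
contraction with a projection `p` and an inclusion `i` (`Splitting.exists_contraction`).

On `Ω(A; E)` the operator `D` is `∂` plus terms that raise the form degree (`D_sub_delOp_mem`).
Since `∂k + k∂ + ip = 1`, the operator `N = Dk + kD + ip` is `1` minus an operator that raises the
form degree. Form degrees are bounded by the rank of `A`, so this operator is nilpotent and `N` has
an inverse `W`, a finite geometric series, which is `Ω(A)`-linear. The rest of the homological
perturbation is formal (`PerturbationData`): `D' = pWDi` is a differential, `p' = pW` and `i' = Wi`
are chain maps with `p'i' = 1`, and `h' = kW` is a homotopy from `i'p'` to `1`.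

`D'` is the structure operator wanted on the cohomology bundle. It has no `∂`-component because `∂i
= 0`; its connection is `p∇i`, which sends `[S]` to `[∇S]`; flatness is the part of `D'² = 0` in
form degree two; and `p'` is the quasi-isomorphism.

The spectral sequence is that of `(Ω(A; H), D')`, filtered by the form degree. As `D'` raises the
form degree, with leading term `d_∇`, the second page can be read off directly (`pageTwoEquiv`). The
maps `p'` and `i'` respect the filtrations, so the convergence carries over to the cohomology of
`E`. -/

/-! ### Sections near a point, maps of constant rank and their generalized inverses -/

section LocalSections

open Filter Topology

variable {E₀ : Type*} [NormedAddCommGroup E₀] [NormedSpace ℝ E₀] {M : Type u} [TopologicalSpace M]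
  [ChartedSpace E₀ M]

namespace SmoothFun

/-- Evaluation at a point as a ring homomorphism. -/
noncomputable def evalHom (x : M) : SmoothFun E₀ M →+* ℝ where
  toFun f := f x
  map_one' := rfl
  map_mul' _ _ := rfl
  map_zero' := rfl
  map_add' _ _ := rfl

@[simp] theorem evalHom_apply (x : M) (f : SmoothFun E₀ M) : evalHom x f = f x := rfl

theorem sum_apply {ι : Type*} (t : Finset ι) (f : ι → SmoothFun E₀ M) (x : M) :
    (∑ i ∈ t, f i) x = ∑ i ∈ t, f i x := map_sum (evalHom x) f t

variable [FiniteDimensional ℝ E₀] [IsManifold 𝓘(ℝ, E₀) ∞ M] [T2Space M]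

theorem exists_bump {x₀ : M} {U : Set M} (hU : U ∈ 𝓝 x₀) :
    ∃ χ : SmoothFun E₀ M, (∀ᶠ y in 𝓝 x₀, χ y = 1) ∧ tsupport χ ⊆ U := by
  obtain ⟨f, -, hf⟩ := (SmoothBumpFunction.nhds_basis_tsupport (I := 𝓘(ℝ, E₀)) x₀).mem_iff.mp hU
  exact ⟨⟨f, f.contMDiff⟩, f.eventuallyEq_one, hf⟩

theorem exists_mul_eq_one (f : SmoothFun E₀ M) {x₀ : M} (hf : f x₀ ≠ 0) :
    ∃ g : SmoothFun E₀ M, ∀ᶠ y in 𝓝 x₀, g y * f y = 1 := by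
  have hU : {y | f y ≠ 0} ∈ 𝓝 x₀ := f.contMDiff.continuous.continuousAt.eventually_ne hf
  obtain ⟨χ, h1, h2⟩ := exists_bump (E₀ := E₀) hU
  refine ⟨⟨fun y => χ y * (f y)⁻¹, ?_⟩, ?_⟩
  · refine contMDiff_of_tsupport fun y hy => ?_
    have hy' : f y ≠ 0 := h2 (tsupport_mul_subset_left hy)
    exact χ.contMDiff.contMDiffAt.mul (f.contMDiff.contMDiffAt.inv₀ hy')
  · filter_upwards [h1, hU] with y h h'
    change χ y * (f y)⁻¹ * f y = 1
    rw [h, one_mul, inv_mul_cancel₀ h']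

end SmoothFun

namespace VBundle

variable (V : VBundle.{v} E₀ M) {W : VBundle.{w} E₀ M}

theorem sum_apply {ι : Type*} (t : Finset ι) (s : ι → V.Sec) (x : M) :
    (∑ i ∈ t, s i) x = ∑ i ∈ t, s i x := map_sum (V.evalAt x) s t

@[simp] theorem evalAt_apply (x : M) (s : V.Sec) : V.evalAt x s = s x := rfl

instance finiteDimensional_fib (x : M) : FiniteDimensional ℝ (V.Fib x) :=
  LinearEquiv.finiteDimensional
    ((trivializationAt V.F V.Fib x).linearEquivAt ℝ x
      (FiberBundle.mem_baseSet_trivializationAt' x)).symm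

theorem finrank_fib (x : M) : Module.finrank ℝ (V.Fib x) = Module.finrank ℝ V.F :=
  LinearEquiv.finrank_eq ((trivializationAt V.F V.Fib x).linearEquivAt ℝ x
      (FiberBundle.mem_baseSet_trivializationAt' x))

variable [FiniteDimensional ℝ E₀] [IsManifold 𝓘(ℝ, E₀) ∞ M] [T2Space M]

/-- Cut-off functions make a local frame and its coefficients global. The expansion of `χ • t`
reduces questions about `C^∞(M)`-linear maps near `x₀` to finitely many sections. -/
theorem exists_local_dual_basis (x₀ : M) :
    ∃ (χ : SmoothFun E₀ M) (s : Fin (Module.finrank ℝ V.F) → V.Sec)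
      (θ : Fin (Module.finrank ℝ V.F) → V.Sec →ₗ[SmoothFun E₀ M] SmoothFun E₀ M),
      (∀ᶠ y in 𝓝 x₀, χ y = 1) ∧ (∀ t, χ • t = ∑ a, θ a t • s a) ∧
      (∀ a t x, t x = 0 → θ a t x = 0) ∧ Submodule.span ℝ (Set.range fun a => s a x₀) = ⊤ := by
  have : ContMDiffVectorBundle 1 V.F V.Fib 𝓘(ℝ, E₀) := ContMDiffVectorBundle.of_le (n := ∞) (by simp)
  let e := trivializationAt V.F V.Fib x₀
  have hx₀ : x₀ ∈ e.baseSet := FiberBundle.mem_baseSet_trivializationAt' x₀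
  let b := Module.finBasis ℝ V.F
  obtain ⟨χ, h1, h2⟩ := SmoothFun.exists_bump (E₀ := E₀) (e.open_baseSet.mem_nhds hx₀)
  let s : Fin (Module.finrank ℝ V.F) → V.Sec := fun a =>
    ⟨fun x => χ x • e.localFrame b a x,
      ContMDiffOn.smul_section_of_tsupport χ.contMDiff.contMDiffOn e.open_baseSet h2
        (e.contMDiffOn_localFrame_baseSet ∞ b a)⟩
  let θ : Fin (Module.finrank ℝ V.F) → V.Sec →ₗ[SmoothFun E₀ M] SmoothFun E₀ M := fun a =>
    { toFun := fun t => ⟨fun x => χ x * e.localFrameCoeff 𝓘(ℝ, E₀) b a x (t x), by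
        refine contMDiff_of_tsupport fun y hy => ?_
        have hy' := h2 (tsupport_mul_subset_left hy)
        exact χ.contMDiff.contMDiffAt.mul (contMDiffAt_localFrameCoeff b hy' t.contMDiff.contMDiffAt a)⟩
      map_add' := fun t t' => by
        ext x
        change χ x * e.localFrameCoeff 𝓘(ℝ, E₀) b a x (t x + t' x) = χ x * _ + χ x * _
        rw [map_add, mul_add]
      map_smul' := fun f t => by
        ext x
        change χ x * e.localFrameCoeff 𝓘(ℝ, E₀) b a x (f x • t x) = f x * (χ x * _)
        rw [map_smul, smul_eq_mul]; ring }
  -- The sections and the coefficients each carry one factor `χ`, so the expansion reproduces `t` up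
  -- to the square.
  refine ⟨χ * χ, s, θ, ?_, fun t => ?_, fun a t x h => ?_, ?_⟩
  · filter_upwards [h1] with y h
    change χ y * χ y = 1
    rw [h, one_mul]
  · ext x
    rw [sum_apply]
    change (χ x * χ x) • t x =
      ∑ a, (χ x * e.localFrameCoeff 𝓘(ℝ, E₀) b a x (t x)) • (χ x • e.localFrame b a x)
    by_cases hx : x ∈ e.baseSet
    · conv_lhs => rw [e.eq_sum_localFrameCoeff_smul (I := 𝓘(ℝ, E₀)) (b := b) (s := t) hx]
      rw [Finset.smul_sum]
      refine Finset.sum_congr rfl fun a _ => ?_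
      simp only [smul_smul]
      congr 1; ring
    · have : χ x = 0 := image_eq_zero_of_notMem_tsupport fun h => hx (h2 h)
      simp [this]
  · change χ x * e.localFrameCoeff 𝓘(ℝ, E₀) b a x (t x) = 0
    rw [h, map_zero, mul_zero]
  · have : (fun a => s a x₀) = e.basisAt b hx₀ := by
      funext a
      change χ x₀ • e.localFrame b a x₀ = _
      rw [h1.self_of_nhds, one_smul, e.localFrame_apply_of_mem_baseSet b hx₀]
    rw [this, Module.Basis.span_eq]

theorem exists_sec_eq {x : M} (v : V.Fib x) : ∃ s : V.Sec, s x = v := by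
  obtain ⟨χ, s, θ, -, -, -, h⟩ := V.exists_local_dual_basis x
  have hv : v ∈ Submodule.span ℝ (Set.range fun a => s a x) := h ▸ Submodule.mem_top
  obtain ⟨c, rfl⟩ := (Submodule.mem_span_range_iff_exists_fun ℝ).mp hv
  refine ⟨∑ a, c a • s a, ?_⟩
  rw [sum_apply]; rfl

variable {V}

/-- `C^∞(M)`-linear operations on sections are pointwise. -/
theorem pointwise {N P : Type*} [AddCommGroup N] [Module (SmoothFun E₀ M) N] [AddCommGroup P]
    [Module ℝ P] {x : M} (T : V.Sec →ₗ[SmoothFun E₀ M] N) (ev : N →+ P)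
    (hev : ∀ (f : SmoothFun E₀ M) n, ev (f • n) = f x • ev n) {s : V.Sec} (hs : s x = 0) :
    ev (T s) = 0 := by
  obtain ⟨χ, σ, θ, h1, h2, h3, -⟩ := V.exists_local_dual_basis x
  have h := congrArg (fun t => ev (T t)) (h2 s)
  simp only [map_smul, map_sum, hev, h3 _ _ _ hs, h1.self_of_nhds, one_smul, zero_smul] at h
  rw [h, Finset.sum_const_zero]

/-- By `pointwise` the value depends on `s x` only. The target is any module with an evaluation, so
that sections and functions are treated together. -/
theorem exists_fib_map {N P : Type*} [AddCommGroup N] [Module (SmoothFun E₀ M) N] [AddCommGroup P]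
    [Module ℝ P] {x : M} (T : V.Sec →ₗ[SmoothFun E₀ M] N) (ev : N →+ P)
    (hev : ∀ (f : SmoothFun E₀ M) n, ev (f • n) = f x • ev n) :
    ∃ φ : V.Fib x →ₗ[ℝ] P, ∀ s : V.Sec, φ (s x) = ev (T s) := by
  have key : ∀ s t : V.Sec, s x = t x → ev (T s) = ev (T t) := fun s t h => by
    have h0 := pointwise T ev hev (s := s - t) (by simp [h])
    rw [map_sub, map_sub] at h0
    exact sub_eq_zero.mp h0
  choose S hS using fun v : V.Fib x => V.exists_sec_eq v
  refine ⟨{ toFun := fun v => ev (T (S v)), map_add' := fun v v' => ?_, map_smul' := fun c v => ?_ },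
    fun s => key _ _ (hS _)⟩
  · rw [key (S (v + v')) (S v + S v') (by rw [hS]; exact congrArg₂ (· + ·) (hS v).symm (hS v').symm),
      map_add, map_add]
  · rw [key (S (c • v)) (algebraMap ℝ (SmoothFun E₀ M) c • S v)
      (by rw [hS]; exact congrArg (c • ·) (hS v).symm), map_smul, hev]
    rfl

/-- The linear map between the fibres induced by a `C^∞(M)`-linear map of sections. -/
noncomputable def fibMap (T : V.Sec →ₗ[SmoothFun E₀ M] W.Sec) (x : M) : V.Fib x →ₗ[ℝ] W.Fib x :=
  (exists_fib_map T (W.evalAt x).toAddMonoidHom fun _ _ => rfl).choose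

@[simp] theorem fibMap_apply (T : V.Sec →ₗ[SmoothFun E₀ M] W.Sec) (x : M) (s : V.Sec) :
    fibMap T x (s x) = T s x :=
  (exists_fib_map T (W.evalAt x).toAddMonoidHom fun _ _ => rfl).choose_spec s

theorem apply_eq_zero (T : V.Sec →ₗ[SmoothFun E₀ M] W.Sec) {x : M} {s : V.Sec} (hs : s x = 0) :
    T s x = 0 := by
  rw [← fibMap_apply, hs, map_zero]

theorem apply_congr (T : V.Sec →ₗ[SmoothFun E₀ M] W.Sec) {x : M} {s t : V.Sec} (h : s x = t x) :
    T s x = T t x := by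
  rw [← fibMap_apply, h, fibMap_apply]

/-- The linear form on a fibre induced by a `C^∞(M)`-linear map from sections to functions. -/
noncomputable def fibFun (θ : V.Sec →ₗ[SmoothFun E₀ M] SmoothFun E₀ M) (x : M) : V.Fib x →ₗ[ℝ] ℝ :=
  (exists_fib_map θ (SmoothFun.evalHom x).toAddMonoidHom fun _ _ => rfl).choose

@[simp] theorem fibFun_apply (θ : V.Sec →ₗ[SmoothFun E₀ M] SmoothFun E₀ M) (x : M) (s : V.Sec) :
    fibFun θ x (s x) = θ s x :=
  (exists_fib_map θ (SmoothFun.evalHom x).toAddMonoidHom fun _ _ => rfl).choose_spec s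

theorem range_fibMap (T : V.Sec →ₗ[SmoothFun E₀ M] W.Sec) (x : M) {v : W.Fib x} :
    v ∈ LinearMap.range (fibMap T x) ↔ ∃ s, T s x = v := by
  constructor
  · rintro ⟨v', rfl⟩
    obtain ⟨s, rfl⟩ := V.exists_sec_eq v'
    exact ⟨s, (fibMap_apply T x s).symm⟩
  · rintro ⟨s, rfl⟩
    exact ⟨s x, fibMap_apply T x s⟩

theorem exists_functional (x : M) (φ : V.Fib x →ₗ[ℝ] ℝ) :
    ∃ θ : V.Sec →ₗ[SmoothFun E₀ M] SmoothFun E₀ M, ∀ t, θ t x = φ (t x) := by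
  obtain ⟨χ, s, θ, h1, h2, h3, -⟩ := V.exists_local_dual_basis x
  refine ⟨∑ a, algebraMap ℝ (SmoothFun E₀ M) (φ (s a x)) • θ a, fun t => ?_⟩
  have h := congrArg (fun t => φ (t x)) (h2 t)
  simp only [sum_apply, smul_apply, h1.self_of_nhds, one_smul, map_sum, map_smul] at h
  rw [h, LinearMap.sum_apply, SmoothFun.sum_apply]
  refine Finset.sum_congr rfl fun a _ => ?_
  change φ (s a x) * θ a t x = θ a t x • φ (s a x)
  rw [smul_eq_mul, mul_comm]

/-- Local dual frames for the image of a map of constant rank. -/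
theorem exists_frame_range (T : V.Sec →ₗ[SmoothFun E₀ M] W.Sec) {r : ℕ}
    (hr : ∀ x, Module.finrank ℝ (LinearMap.range (fibMap T x)) = r) (x₀ : M) :
    ∃ (σ : Fin r → V.Sec) (θ : Fin r → W.Sec →ₗ[SmoothFun E₀ M] SmoothFun E₀ M),
      ∀ᶠ y in 𝓝 x₀, (∀ a b, θ a (T (σ b)) y = if a = b then 1 else 0) ∧
        ∀ s, T s y = ∑ a, θ a (T s) y • T (σ a) y := by
  classical
  let b := Module.finBasisOfFinrankEq ℝ (LinearMap.range (fibMap T x₀)) (hr x₀)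
  have hb : ∀ a, ∃ s : V.Sec, T s x₀ = b a := fun a => (range_fibMap T x₀).mp (b a).2
  choose σ₀ hσ₀ using hb
  have hφ : ∀ a, ∃ φ : W.Fib x₀ →ₗ[ℝ] ℝ, φ ∘ₗ (LinearMap.range (fibMap T x₀)).subtype = b.coord a :=
    fun a => LinearMap.exists_extend _
  choose φ hφ using hφ
  choose θ hθ using fun a => exists_functional x₀ (φ a)
  -- This matrix is the identity at `x₀`, hence invertible nearby. The adjugate times a function `g`
  -- that inverts the determinant near `x₀` gives correcting coefficients that are smooth on all of
  -- `M`.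
  let G : Matrix (Fin r) (Fin r) (SmoothFun E₀ M) := fun a c => θ a (T (σ₀ c))
  have hG : (SmoothFun.evalHom x₀).mapMatrix G = 1 := by
    ext a c
    change θ a (T (σ₀ c)) x₀ = _
    rw [hθ, hσ₀]
    have := LinearMap.congr_fun (hφ a) (b c)
    simp only [LinearMap.comp_apply, Submodule.subtype_apply] at this
    rw [this, Module.Basis.coord_apply, Module.Basis.repr_self, Matrix.one_apply,
      Finsupp.single_apply]
    simp [eq_comm]
  have hdet : G.det x₀ ≠ 0 := by
    rw [← SmoothFun.evalHom_apply x₀, RingHom.map_det, hG, Matrix.det_one]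
    exact one_ne_zero
  obtain ⟨g, hg⟩ := SmoothFun.exists_mul_eq_one G.det hdet
  let σ : Fin r → V.Sec := fun c => ∑ d, (g * G.adjugate d c) • σ₀ d
  refine ⟨σ, θ, ?_⟩
  filter_upwards [hg] with y hy
  have key : ∀ a c, θ a (T (σ c)) y = if a = c then 1 else 0 := by
    intro a c
    have h1 : θ a (T (σ c)) = g * (G * G.adjugate) a c := by
      simp only [σ, map_sum, map_smul, smul_eq_mul, Matrix.mul_apply, Finset.mul_sum]
      refine Finset.sum_congr rfl fun d _ => ?_
      change _ * G a d = _
      ring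
    rw [h1, Matrix.mul_adjugate, Matrix.smul_apply, smul_eq_mul, ← mul_assoc]
    change (g y * G.det y) * ((1 : Matrix (Fin r) (Fin r) (SmoothFun E₀ M)) a c) y = _
    rw [hy, one_mul, Matrix.one_apply]
    split_ifs <;> rfl
  refine ⟨key, fun s => ?_⟩
  -- Constant rank enters here: `Θ` is onto by duality, and the range at `y` still has dimension
  -- `r`, so `Θ` is injective and the coordinates `θ a` determine `T s y`.
  let Θ : LinearMap.range (fibMap T y) →ₗ[ℝ] Fin r → ℝ :=
    LinearMap.pi fun a => fibFun (θ a) y ∘ₗ Submodule.subtype _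
  have hΘ : ∀ (t : W.Sec) (ht : t y ∈ LinearMap.range (fibMap T y)) a, Θ ⟨t y, ht⟩ a = θ a t y :=
    fun t ht a => fibFun_apply (θ a) y t
  have hmem : ∀ s, T s y ∈ LinearMap.range (fibMap T y) := fun s => (range_fibMap T y).mpr ⟨s, rfl⟩
  have hsum : ∀ (c : Fin r → ℝ), Θ (∑ a, c a • ⟨T (σ a) y, hmem _⟩) = c := fun c => by
    funext d
    simp only [map_sum, map_smul, Finset.sum_apply, Pi.smul_apply, hΘ, key]
    simp
  have hinj : Function.Injective Θ :=
    (LinearMap.injective_iff_surjective_of_finrank_eq_finrank (by rw [hr y]; simp)).mpr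
      fun c => ⟨_, hsum c⟩
  have : (⟨T s y, hmem s⟩ : LinearMap.range (fibMap T y)) =
      ∑ a, θ a (T s) y • ⟨T (σ a) y, hmem _⟩ := by
    apply hinj
    rw [hsum]
    funext d
    rw [hΘ]
  simpa [Submodule.coe_sum] using congrArg Subtype.val this

variable [SecondCountableTopology M]

/-- A `C^∞(M)`-linear map of constant rank has a generalized inverse. -/
theorem exists_generalized_inverse (T : V.Sec →ₗ[SmoothFun E₀ M] W.Sec) {r : ℕ}
    (hr : ∀ x, Module.finrank ℝ (LinearMap.range (fibMap T x)) = r) :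
    ∃ K : W.Sec →ₗ[SmoothFun E₀ M] V.Sec, ∀ s, T (K (T s)) = T s := by
  have : LocallyCompactSpace M := ChartedSpace.locallyCompactSpace E₀ M
  choose σ θ h using fun x₀ => exists_frame_range T hr x₀
  choose U hU hUo hxU using fun x₀ => eventually_nhds_iff.mp (h x₀)
  obtain ⟨ρ, hρ⟩ := SmoothPartitionOfUnity.exists_isSubordinate 𝓘(ℝ, E₀) isClosed_univ U hUo
    (fun x _ => Set.mem_iUnion.mpr ⟨x, hxU x⟩)
  -- On `U x₀` the expansion of `T s` in the frame `T (σ x₀ a)` says that `T k T = T`.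
  let k : M → W.Sec →ₗ[SmoothFun E₀ M] V.Sec := fun x₀ => ∑ a, (θ x₀ a).smulRight (σ x₀ a)
  have hk : ∀ x₀, ∀ y ∈ U x₀, ∀ s, T (k x₀ (T s)) y = T s y := fun x₀ y hy s => by
    have h2 := (hU x₀ y hy).2 s
    rw [h2]
    simp only [k, LinearMap.sum_apply, map_sum, LinearMap.smulRight_apply, map_smul, sum_apply,
      smul_apply]
  have hfin : ∀ y, (Function.support fun i => ρ i y).Finite := fun y => ρ.locallyFinite.point_finite y
  have hfs : ∀ (t : W.Sec) y, (Function.support fun i => ρ i y • k i t y).Finite := fun t y =>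
    (hfin y).subset fun i hi hi' => hi (by simp only [hi', zero_smul])
  let K : W.Sec →ₗ[SmoothFun E₀ M] V.Sec :=
    { toFun := fun t => ⟨fun y => ∑ᶠ i, ρ i y • k i t y, by
        refine ContMDiff.finsum_section_of_locallyFinite (t := fun i y => ρ i y • k i t y)
          (ρ.locallyFinite.subset fun i y hy hy' => hy (by simp only [hy', zero_smul]))
          fun i => (ρ i).contMDiff.smul_section (k i t).contMDiff⟩
      map_add' := fun t t' => by
        ext y
        change ∑ᶠ i, ρ i y • k i (t + t') y = (∑ᶠ i, ρ i y • k i t y) + ∑ᶠ i, ρ i y • k i t' y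
        rw [← finsum_add_distrib (hfs t y) (hfs t' y)]
        refine finsum_congr fun i => ?_
        rw [map_add, ← smul_add]; rfl
      map_smul' := fun f t => by
        ext y
        change ∑ᶠ i, ρ i y • k i (f • t) y = f y • ∑ᶠ i, ρ i y • k i t y
        rw [smul_finsum' _ (hfs t y)]
        refine finsum_congr fun i => ?_
        rw [map_smul, smul_apply, smul_comm] }
  refine ⟨K, fun s => ?_⟩
  ext y
  have hKy : K (T s) y = ∑ i ∈ (hfin y).toFinset, ρ i y • k i (T s) y :=
    finsum_eq_sum_of_support_subset _ fun i hi => by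
      simp only [Set.Finite.coe_toFinset]
      exact fun hi' => hi (by simp only [hi', zero_smul])
  have h1 : ∑ i ∈ (hfin y).toFinset, ρ i y = 1 := by
    rw [← ρ.sum_eq_one (Set.mem_univ y)]
    exact (finsum_eq_sum_of_support_subset _ (by simp)).symm
  rw [← fibMap_apply, hKy, map_sum]
  simp only [map_smul, fibMap_apply]
  conv_rhs => rw [← one_smul ℝ (T s y), ← h1, Finset.sum_smul]
  refine Finset.sum_congr rfl fun i hi => ?_
  rw [hk i y (hρ i (subset_closure (by simpa using hi)))]

end VBundle

end LocalSections

/-! ### Shuffles with a block of length zero or one -/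

section Shuffles

open Equiv

theorem Equiv.Perm.subsingleton_modSumCongr_left {α β : Type*} [Finite α] [IsEmpty β] :
    Subsingleton (Perm.ModSumCongr α β) := by
  classical
  refine ⟨fun a b => ?_⟩
  induction a using Quotient.inductionOn' with | _ σ
  induction b using Quotient.inductionOn' with | _ τ
  refine Quotient.sound' ((QuotientGroup.leftRel_apply).mpr ?_)
  refine Perm.mem_sumCongrHom_range_of_perm_mapsTo_inl fun x hx => ?_
  cases h : (σ⁻¹ * τ) x with
  | inl y => exact ⟨y, rfl⟩
  | inr y => exact isEmptyElim y

theorem Equiv.Perm.subsingleton_modSumCongr_right {α β : Type*} [Finite β] [IsEmpty α] :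
    Subsingleton (Perm.ModSumCongr α β) := by
  classical
  refine ⟨fun a b => ?_⟩
  induction a using Quotient.inductionOn' with | _ σ
  induction b using Quotient.inductionOn' with | _ τ
  refine Quotient.sound' ((QuotientGroup.leftRel_apply).mpr ?_)
  have : Finite (α ⊕ β) := inferInstance
  refine Perm.mem_sumCongrHom_range_of_perm_mapsTo_inl ?_
  rintro _ ⟨a, rfl⟩
  exact isEmptyElim a

/-- The permutation of `Fin k ⊕ Fin 1` that moves the last element to the place `i`. -/
def insertPerm {k : ℕ} (i : Fin (k + 1)) : Perm (Fin k ⊕ Fin 1) :=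
  finSumFinEquiv.permCongr.symm (i.cycleRange.symm * finRotate (k + 1))

theorem insertPerm_inl {k : ℕ} (i : Fin (k + 1)) (j : Fin k) :
    finSumFinEquiv (insertPerm i (Sum.inl j)) = i.succAbove j := by
  simp only [insertPerm, Equiv.permCongr_symm, Equiv.permCongr_apply, Equiv.symm_symm,
    Equiv.apply_symm_apply, Perm.mul_apply, finSumFinEquiv_apply_left]
  have : finRotate (k + 1) (Fin.castAdd 1 j) = j.succ := by
    rw [finRotate_apply]
    exact Fin.coeSucc_eq_succ
  rw [this, Fin.cycleRange_symm_succ]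

theorem insertPerm_inr {k : ℕ} (i : Fin (k + 1)) (j : Fin 1) :
    finSumFinEquiv (insertPerm i (Sum.inr j)) = i := by
  simp only [insertPerm, Equiv.permCongr_symm, Equiv.permCongr_apply, Equiv.symm_symm,
    Equiv.apply_symm_apply, Perm.mul_apply, finSumFinEquiv_apply_right]
  have : finRotate (k + 1) (Fin.natAdd k j) = 0 := by
    have hj : Fin.natAdd k j = Fin.last k := by ext; simp
    rw [hj, finRotate_last]
  rw [this, Fin.cycleRange_symm_zero]

theorem sign_insertPerm {k : ℕ} (i : Fin (k + 1)) :
    Perm.sign (insertPerm i) = (-1) ^ ((i : ℕ) + k) := by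
  rw [insertPerm, Equiv.permCongr_symm, Perm.sign_permCongr, map_mul, ← Perm.inv_def, Perm.sign_inv,
    Fin.sign_cycleRange, sign_finRotate, pow_add, Nat.add_sub_cancel]

/-- A coset modulo permutations within the two blocks is determined by the place of the single
element of the second block. -/
theorem bijective_insertPerm {k : ℕ} : Function.Bijective
    fun i : Fin (k + 1) => (Quotient.mk'' (insertPerm i) : Perm.ModSumCongr (Fin k) (Fin 1)) := by
  constructor
  · intro i j h
    have h := (QuotientGroup.leftRel_apply).mp (Quotient.exact' h)
    obtain ⟨⟨sl, sr⟩, h⟩ := h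
    have h := inv_mul_eq_iff_eq_mul.mp h.symm
    have h := congrArg finSumFinEquiv (Perm.congr_fun h (Sum.inr 0))
    rw [insertPerm_inr] at h
    simpa [insertPerm_inr] using h.symm
  · intro a
    induction a using Quotient.inductionOn' with | _ σ
    refine ⟨finSumFinEquiv (σ (Sum.inr 0)), ?_⟩
    refine Quotient.sound' ((QuotientGroup.leftRel_apply).mpr ?_)
    have h1 : ((insertPerm (finSumFinEquiv (σ (Sum.inr 0))))⁻¹ * σ) (Sum.inr 0) = Sum.inr 0 := by
      rw [Perm.mul_apply, Perm.inv_eq_iff_eq]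
      exact finSumFinEquiv.injective (insertPerm_inr _ _).symm
    refine Perm.mem_sumCongrHom_range_of_perm_mapsTo_inl ?_
    rintro _ ⟨x, rfl⟩
    cases h : ((insertPerm (finSumFinEquiv (σ (Sum.inr 0))))⁻¹ * σ) (Sum.inl x) with
    | inl y => exact ⟨y, rfl⟩
    | inr y =>
      obtain rfl : y = 0 := Subsingleton.elim _ _
      exact absurd ((Equiv.injective _) (h.trans h1.symm)) (by simp)

end Shuffles

/-! ### Products of forms and the bigrading of `Ω(A; E)` -/

section FormAlgebra

variable {E₀ : Type*} [NormedAddCommGroup E₀] [NormedSpace ℝ E₀] {M : Type u} [TopologicalSpace M]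
  [ChartedSpace E₀ M] [IsManifold 𝓘(ℝ, E₀) ∞ M] {𝔄 : LieAlgebroid.{v} E₀ M}
  {V W : VBundle.{w} E₀ M}

namespace LieAlgebroid

theorem mulForm_apply {k p : ℕ} (ψ : 𝔄.ScalarForm k) (η : 𝔄.Form V p) (v : Fin (k + p) → 𝔄.A.Sec) :
    𝔄.mulForm ψ η v = ∑ σ : Equiv.Perm.ModSumCongr (Fin k) (Fin p),
      TensorProduct.lid (SmoothFun E₀ M) V.Sec
        (AlternatingMap.domCoprod.summand ψ η σ fun i => v (finSumFinEquiv i)) := by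
  change TensorProduct.lid (SmoothFun E₀ M) V.Sec (ψ.domCoprod η fun i => v (finSumFinEquiv i)) = _
  rw [← map_sum, ← _root_.sum_apply]
  rfl

theorem lid_summand {k p : ℕ} (ψ : 𝔄.ScalarForm k) (η : 𝔄.Form V p) (σ : Equiv.Perm (Fin k ⊕ Fin p))
    (v : Fin k ⊕ Fin p → 𝔄.A.Sec) :
    TensorProduct.lid (SmoothFun E₀ M) V.Sec
      (AlternatingMap.domCoprod.summand ψ η (Quotient.mk'' σ) v) =
    Equiv.Perm.sign σ • (ψ (fun i => v (σ (Sum.inl i))) • η fun i => v (σ (Sum.inr i))) := by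
  rw [AlternatingMap.domCoprod.summand_mk'']
  simp only [_root_.smul_apply, MultilinearMap.domDomCongr_apply,
    MultilinearMap.domCoprod_apply, AlternatingMap.coe_multilinearMap]
  rw [Units.smul_def, Units.smul_def, map_zsmul, TensorProduct.lid_tmul]

theorem comp_mulForm (T : V.Sec →ₗ[SmoothFun E₀ M] W.Sec) {k p : ℕ} (ψ : 𝔄.ScalarForm k)
    (η : 𝔄.Form V p) :
    T.compAlternatingMap (𝔄.mulForm ψ η) = 𝔄.mulForm ψ (T.compAlternatingMap η) := by
  ext1 v
  rw [LinearMap.compAlternatingMap_apply, mulForm_apply, mulForm_apply, map_sum]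
  refine Finset.sum_congr rfl fun σ _ => ?_
  induction σ using Quotient.inductionOn' with | _ σ
  rw [lid_summand, lid_summand, Units.smul_def, Units.smul_def, map_zsmul, map_smul]
  rfl

theorem mulForm_apply_eq_zero {k p : ℕ} {ψ : 𝔄.ScalarForm k} {x : M} (hψ : ∀ v, ψ v x = 0)
    (η : 𝔄.Form V p) (v : Fin (k + p) → 𝔄.A.Sec) : 𝔄.mulForm ψ η v x = 0 := by
  rw [mulForm_apply, VBundle.sum_apply]
  refine Finset.sum_eq_zero fun σ _ => ?_
  induction σ using Quotient.inductionOn' with | _ σ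
  rw [lid_summand, Units.smul_def]
  change (V.evalAt x) _ = 0
  rw [map_zsmul, VBundle.evalAt_apply, VBundle.smul_apply, hψ, zero_smul, smul_zero]

/-- A section as a form of degree `0`. -/
noncomputable abbrev constForm (𝔄 : LieAlgebroid.{v} E₀ M) (s : V.Sec) : 𝔄.Form V 0 :=
  AlternatingMap.constOfIsEmpty (SmoothFun E₀ M) 𝔄.A.Sec (Fin 0) s

/-- A function as a scalar form of degree `0`. -/
noncomputable abbrev constScalar (𝔄 : LieAlgebroid.{v} E₀ M) (f : SmoothFun E₀ M) : 𝔄.ScalarForm 0 :=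
  AlternatingMap.constOfIsEmpty (SmoothFun E₀ M) 𝔄.A.Sec (Fin 0) f

theorem mulForm_constForm {k : ℕ} (ψ : 𝔄.ScalarForm k) (s : V.Sec) (v : Fin k → 𝔄.A.Sec) :
    𝔄.mulForm ψ (𝔄.constForm s) v = ψ v • s := by
  have := Equiv.Perm.subsingleton_modSumCongr_left (α := Fin k) (β := Fin 0)
  refine (mulForm_apply ψ (𝔄.constForm s) v).trans ?_
  refine (Finset.sum_eq_single (Quotient.mk'' 1) (fun b _ hb => absurd (Subsingleton.elim b _) hb)
    (fun h => absurd (Finset.mem_univ _) h)).trans ?_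
  rw [lid_summand, Equiv.Perm.sign_one, one_smul]
  rfl

theorem mulForm_constScalar {p : ℕ} (f : SmoothFun E₀ M) (η : 𝔄.Form V p)
    (v : Fin (0 + p) → 𝔄.A.Sec) :
    𝔄.mulForm (𝔄.constScalar f) η v = f • η fun i => v (Fin.natAdd 0 i) := by
  have := Equiv.Perm.subsingleton_modSumCongr_right (α := Fin 0) (β := Fin p)
  refine (mulForm_apply _ η v).trans ?_
  refine (Finset.sum_eq_single (Quotient.mk'' 1) (fun b _ hb => absurd (Subsingleton.elim b _) hb)
    (fun h => absurd (Finset.mem_univ _) h)).trans ?_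
  rw [lid_summand, Equiv.Perm.sign_one, one_smul]
  rfl

/-- The shuffle that sends the argument `i` to the end passes `k - i` others, whence the sign.
Besides products with `0`-forms this is the only product that has to be expanded, because it occurs
in the Leibniz rule for `d_∇`. -/
theorem mulForm_one {k : ℕ} (ψ : 𝔄.ScalarForm k) (β : 𝔄.Form V 1) (v : Fin (k + 1) → 𝔄.A.Sec) :
    𝔄.mulForm ψ β v =
      ∑ i : Fin (k + 1), (-1 : ℤ) ^ ((i : ℕ) + k) • (ψ (i.removeNth v) • β fun _ => v i) := by
  rw [mulForm_apply]
  refine (bijective_insertPerm.sum_comp _).symm.trans (Finset.sum_congr rfl fun i _ => ?_)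
  rw [lid_summand, sign_insertPerm, Units.smul_def]
  simp only [insertPerm_inl, insertPerm_inr]
  push_cast
  rfl

theorem form_sum_apply {ι : Type*} {p : ℕ} (t : Finset ι) (η : ι → 𝔄.Form V p)
    (v : Fin p → 𝔄.A.Sec) : (∑ i ∈ t, η i) v = ∑ i ∈ t, η i v :=
  map_sum ({ toFun := fun η => η v, map_zero' := rfl, map_add' := fun _ _ => rfl } :
    𝔄.Form V p →+ V.Sec) η t

section Components

variable {E F : ℤ → VBundle.{w} E₀ M}

theorem component_inclusion_self (i : ℕ) (j : ℤ) (η : 𝔄.Form (E j) i) :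
    𝔄.component E i j (𝔄.inclusion E i j η) = η :=
  DirectSum.component.lof_self ℝ (M := fun ij : ℕ × ℤ => 𝔄.Form (E ij.2) ij.1) (i, j) η

theorem component_inclusion_of_ne {i i' : ℕ} {j j' : ℤ} (h : (i, j) ≠ (i', j'))
    (η : 𝔄.Form (E j) i) : 𝔄.component E i' j' (𝔄.inclusion E i j η) = 0 := by
  have := DirectSum.component.of ℝ (M := fun ij : ℕ × ℤ => 𝔄.Form (E ij.2) ij.1) (i', j') (i, j) η
  exact this.trans (dif_neg h)

theorem gform_ext {ξ ξ' : 𝔄.GForm E} (h : ∀ i j, 𝔄.component E i j ξ = 𝔄.component E i j ξ') :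
    ξ = ξ' :=
  DirectSum.ext_component ℝ (M := fun ij : ℕ × ℤ => 𝔄.Form (E ij.2) ij.1) fun ij => h ij.1 ij.2

theorem gform_induction {P : 𝔄.GForm E → Prop} (h0 : P 0)
    (hi : ∀ i j (η : 𝔄.Form (E j) i), P (𝔄.inclusion E i j η))
    (ha : ∀ ξ ξ', P ξ → P ξ' → P (ξ + ξ')) (ξ : 𝔄.GForm E) : P ξ :=
  DirectSum.induction_on (β := fun ij : ℕ × ℤ => 𝔄.Form (E ij.2) ij.1) (motive := P) ξ h0
    (fun ij η => hi ij.1 ij.2 η) ha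

/-- This absorbs the cast between the degrees `0 + i` and `i` in products with functions. -/
theorem inclusion_congr {i i' : ℕ} {j : ℤ} (h : i = i') {η : 𝔄.Form (E j) i} {η' : 𝔄.Form (E j) i'}
    (hη : ∀ v, η v = η' fun l => v (Fin.cast h.symm l)) :
    𝔄.inclusion E i j η = 𝔄.inclusion E i' j η' := by
  subst h
  congr 1
  ext1 v
  exact hη v

theorem mul_inclusion {k : ℕ} (ψ : 𝔄.ScalarForm k) (i : ℕ) (j : ℤ) (η : 𝔄.Form (E j) i) :
    𝔄.mul ψ (𝔄.inclusion E i j η) = 𝔄.inclusion E (k + i) j (𝔄.mulForm ψ η) :=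
  DirectSum.toModule_lof ℝ (M := fun ij : ℕ × ℤ => 𝔄.Form (E ij.2) ij.1) (i, j) η

theorem component_mul {k : ℕ} (ψ : 𝔄.ScalarForm k) (i : ℕ) (j : ℤ) (ξ : 𝔄.GForm E) :
    𝔄.component E (k + i) j (𝔄.mul ψ ξ) = 𝔄.mulForm ψ (𝔄.component E i j ξ) := by
  induction ξ using gform_induction with
  | h0 => rw [map_zero, map_zero, map_zero]; exact ((𝔄.mulFormLin ψ i).map_zero).symm
  | hi i' j' η =>
    rw [mul_inclusion]
    by_cases h : (i', j') = (i, j)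
    · obtain ⟨rfl, rfl⟩ := Prod.mk.inj h
      rw [component_inclusion_self, component_inclusion_self]
    · rw [component_inclusion_of_ne h, component_inclusion_of_ne]
      · exact ((𝔄.mulFormLin ψ i).map_zero).symm
      · simpa using h
  | ha ξ ξ' h h' =>
    rw [map_add, map_add, map_add, h, h']
    exact ((𝔄.mulFormLin ψ i).map_add _ _).symm

theorem component_mul_of_lt {k : ℕ} (ψ : 𝔄.ScalarForm k) {i : ℕ} (hi : i < k) (j : ℤ)
    (ξ : 𝔄.GForm E) : 𝔄.component E i j (𝔄.mul ψ ξ) = 0 := by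
  induction ξ using gform_induction with
  | h0 => simp
  | hi i' j' η =>
    rw [mul_inclusion, component_inclusion_of_ne]
    simp only [ne_eq, Prod.mk.injEq, not_and]
    omega
  | ha ξ ξ' h h' => rw [map_add, map_add, h, h', add_zero]

theorem component_mul_apply_eq_zero {k : ℕ} {ψ : 𝔄.ScalarForm k} {x : M} (hψ : ∀ v, ψ v x = 0)
    (i : ℕ) (j : ℤ) (ξ : 𝔄.GForm E) (v : Fin i → 𝔄.A.Sec) :
    𝔄.component E i j (𝔄.mul ψ ξ) v x = 0 := by
  by_cases hi : i < k
  · rw [component_mul_of_lt ψ hi]; rfl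
  · obtain ⟨i, rfl⟩ := Nat.exists_eq_add_of_le (not_lt.mp hi)
    rw [component_mul]
    exact mulForm_apply_eq_zero hψ _ v

theorem mul_constScalar_inclusion (f : SmoothFun E₀ M) (i : ℕ) (j : ℤ) (η : 𝔄.Form (E j) i) :
    𝔄.mul (𝔄.constScalar f) (𝔄.inclusion E i j η) = 𝔄.inclusion E i j (f • η) := by
  rw [mul_inclusion]
  refine inclusion_congr (zero_add i) fun v => ?_
  rw [mulForm_constScalar]
  change f • η _ = f • η _
  congr 2
  funext l
  congr 1
  ext; simp

theorem component_mul_constScalar (f : SmoothFun E₀ M) (i : ℕ) (j : ℤ) (ξ : 𝔄.GForm E) :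
    𝔄.component E i j (𝔄.mul (𝔄.constScalar f) ξ) = f • 𝔄.component E i j ξ := by
  induction ξ using gform_induction with
  | h0 => rw [map_zero, map_zero, smul_zero]
  | hi i' j' η =>
    rw [mul_constScalar_inclusion]
    by_cases h : (i', j') = (i, j)
    · obtain ⟨rfl, rfl⟩ := Prod.mk.inj h
      rw [component_inclusion_self, component_inclusion_self]
    · rw [component_inclusion_of_ne h, component_inclusion_of_ne h, smul_zero]
  | ha ξ ξ' h h' => rw [map_add, map_add, map_add, h, h', smul_add]

theorem ofSec_eq (n : ℤ) (s : (E n).Sec) : 𝔄.ofSec n s = 𝔄.inclusion E 0 n (𝔄.constForm s) := rfl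

theorem ofSec_smul (n : ℤ) (f : SmoothFun E₀ M) (s : (E n).Sec) :
    𝔄.ofSec (E := E) n (f • s) = 𝔄.mul (𝔄.constScalar f) (𝔄.ofSec n s) := by
  rw [ofSec_eq, ofSec_eq, mul_constScalar_inclusion]
  rfl

/-- The product `ψ s` of a scalar form and a section. -/
noncomputable def tensorSec {k : ℕ} (ψ : 𝔄.ScalarForm k) (s : V.Sec) : 𝔄.Form V k :=
  (LinearMap.toSpanSingleton (SmoothFun E₀ M) V.Sec s).compAlternatingMap ψ

@[simp] theorem tensorSec_apply {k : ℕ} (ψ : 𝔄.ScalarForm k) (s : V.Sec) (v : Fin k → 𝔄.A.Sec) :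
    tensorSec ψ s v = ψ v • s := rfl

theorem comp_tensorSec (T : V.Sec →ₗ[SmoothFun E₀ M] W.Sec) {k : ℕ} (ψ : 𝔄.ScalarForm k)
    (s : V.Sec) : T.compAlternatingMap (tensorSec ψ s) = tensorSec ψ (T s) := by
  ext1 v
  exact map_smul T (ψ v) s

theorem mulForm_constForm_eq {k : ℕ} (ψ : 𝔄.ScalarForm k) (s : V.Sec) :
    𝔄.mulForm ψ (𝔄.constForm s) = tensorSec ψ s := by
  ext1 v
  exact mulForm_constForm ψ s v

theorem mul_ofSec {k : ℕ} (ψ : 𝔄.ScalarForm k) (n : ℤ) (s : (E n).Sec) :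
    𝔄.mul ψ (𝔄.ofSec (E := E) n s) = 𝔄.inclusion E k n (tensorSec ψ s) := by
  rw [ofSec_eq, mul_inclusion, mulForm_constForm_eq]; rfl

theorem mem_totalDegree {n : ℤ} {ξ : 𝔄.GForm E} : ξ ∈ 𝔄.totalDegree E n ↔
    ∀ (i : ℕ) (j : ℤ), (i : ℤ) + j ≠ n → 𝔄.component E i j ξ = 0 := by
  simp [totalDegree, Submodule.mem_iInf]

theorem mem_formFiltration {p : ℤ} {ξ : 𝔄.GForm E} : ξ ∈ 𝔄.formFiltration E p ↔
    ∀ (i : ℕ) (j : ℤ), (i : ℤ) < p → 𝔄.component E i j ξ = 0 := by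
  simp [formFiltration, Submodule.mem_iInf]

theorem inclusion_mem_totalDegree (i : ℕ) (j : ℤ) (η : 𝔄.Form (E j) i) :
    𝔄.inclusion E i j η ∈ 𝔄.totalDegree E (i + j) :=
  mem_totalDegree.mpr fun i' j' h => component_inclusion_of_ne (by rintro ⟨⟩; exact h rfl) η

theorem inclusion_mem_totalDegree' {i : ℕ} {j n : ℤ} (h : i + j = n) (η : 𝔄.Form (E j) i) :
    𝔄.inclusion E i j η ∈ 𝔄.totalDegree E n :=
  h ▸ inclusion_mem_totalDegree i j η

theorem inclusion_mem_formFiltration {p : ℤ} {i : ℕ} (hi : p ≤ i) (j : ℤ) (η : 𝔄.Form (E j) i) :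
    𝔄.inclusion E i j η ∈ 𝔄.formFiltration E p :=
  mem_formFiltration.mpr fun i' j' h => component_inclusion_of_ne (by rintro ⟨⟩; omega) η

theorem formFiltration_antitone : Antitone fun p => 𝔄.formFiltration E p := fun _ _ h _ hξ =>
  mem_formFiltration.mpr fun i j hi => mem_formFiltration.mp hξ i j (hi.trans_le h)

theorem formFiltration_eq_top {p : ℤ} (hp : p ≤ 0) : 𝔄.formFiltration E p = ⊤ :=
  eq_top_iff.mpr fun _ _ => mem_formFiltration.mpr fun i j hi => by omega

theorem toSec_ofSec_self (n : ℤ) (s : (E n).Sec) : 𝔄.toSec n (𝔄.ofSec (E := E) n s) = s := by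
  change 𝔄.component E 0 n (𝔄.inclusion E 0 n (𝔄.constForm s)) Fin.elim0 = s
  rw [component_inclusion_self]; rfl

theorem component_zero_eq (n : ℤ) (ξ : 𝔄.GForm E) :
    𝔄.component E 0 n ξ = 𝔄.constForm (𝔄.toSec n ξ) := by
  ext1 v
  change _ = 𝔄.component E 0 n ξ Fin.elim0
  rw [Subsingleton.elim v Fin.elim0]

end Components

end LieAlgebroid

end FormAlgebra

/-! ### Local operators on forms, fibrewise operators and the Leibniz rule for `d_∇` -/

section FormCalculus

open Filter Topology

variable {E₀ : Type*} [NormedAddCommGroup E₀] [NormedSpace ℝ E₀] {M : Type u} [TopologicalSpace M]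
  [ChartedSpace E₀ M] [IsManifold 𝓘(ℝ, E₀) ∞ M] {𝔄 : LieAlgebroid.{v} E₀ M}
  {V W : VBundle.{w} E₀ M}

namespace LieAlgebroid

section Locality

theorem lieDeriv_apply_eq_zero (α : 𝔄.A.Sec) {f : SmoothFun E₀ M} {x : M}
    (hf : ∀ᶠ y in 𝓝 x, f y = 1) : 𝔄.lieDeriv α f x = 0 := by
  have h : (f : M → ℝ) =ᶠ[𝓝 x] fun _ => (1 : ℝ) := hf
  rw [lieDeriv_apply, mvfderiv]
  simp only [ContinuousLinearMap.comp_apply]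
  rw [h.mfderiv_eq, mfderiv_const]
  exact map_zero _

theorem dA_constScalar_apply (f : SmoothFun E₀ M) (v : Fin 1 → 𝔄.A.Sec) :
    𝔄.dA (𝔄.constScalar f) v = 𝔄.lieDeriv (v 0) f := by
  change koszulFst 𝔄.lieDeriv (𝔄.constScalar f) v + 0 = _
  simp [koszulFst]

/-- An operator on forms is local if it is not affected by cut-off functions. -/
def IsLocalOp {p q : ℕ} (L : 𝔄.Form V p →ₗ[ℝ] 𝔄.Form W q) : Prop :=
  ∀ (f : SmoothFun E₀ M) (x : M), (∀ᶠ y in 𝓝 x, f y = 1) → ∀ η v, L (f • η) v x = L η v x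

variable [FiniteDimensional ℝ E₀] [T2Space M]

theorem exists_local_decomposition {p : ℕ} (η : 𝔄.Form V p) (x : M) :
    ∃ χ : SmoothFun E₀ M, (∀ᶠ y in 𝓝 x, χ y = 1) ∧ ∃ (r : ℕ) (ψ : Fin r → 𝔄.ScalarForm p)
      (s : Fin r → V.Sec), χ • η = ∑ a, tensorSec (ψ a) (s a) := by
  obtain ⟨χ, s, θ, h1, h2, -, -⟩ := V.exists_local_dual_basis x
  refine ⟨χ, h1, _, fun a => (θ a).compAlternatingMap η, s, ?_⟩
  ext1 v
  rw [form_sum_apply, AlternatingMap.smul_apply, h2]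
  rfl

/-- After a cut-off every form is a finite sum of products `ψ s`, and a local operator does not see
the cut-off. Identities between components of `D` therefore need checking on products only, where
the derivation rule computes them. -/
theorem IsLocalOp.ext {p q : ℕ} {L L' : 𝔄.Form V p →ₗ[ℝ] 𝔄.Form W q} (hL : IsLocalOp L)
    (hL' : IsLocalOp L') (h : ∀ (ψ : 𝔄.ScalarForm p) (s : V.Sec),
      L (tensorSec ψ s) = L' (tensorSec ψ s)) :
    L = L' := by
  ext η v x
  obtain ⟨χ, h1, r, ψ, s, h2⟩ := exists_local_decomposition η x
  rw [← hL χ x h1, ← hL' χ x h1, h2, map_sum, map_sum]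
  simp only [h]

/-- Near a point `A` is spanned by as many sections as its rank, so in each term of the expansion of
a longer list of arguments one of them is repeated. This bound on the form degree gives both the
nilpotency in the perturbation argument and the finiteness of the filtration. -/
theorem form_eq_zero {p : ℕ} (hp : Module.finrank ℝ 𝔄.A.F < p) (η : 𝔄.Form V p) : η = 0 := by
  ext v x
  obtain ⟨χ, s, θ, h1, h2, -, -⟩ := 𝔄.A.exists_local_dual_basis x
  -- Each argument is cut off separately so that it can be expanded; at `x` the resulting factor `χ
  -- ^ p` is `1`.
  have h3 : η (fun i => χ • v i) = 0 := by
    simp only [h2]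
    rw [← AlternatingMap.coe_multilinearMap, MultilinearMap.map_sum]
    refine Finset.sum_eq_zero fun σ _ => ?_
    rw [MultilinearMap.map_smul_univ, AlternatingMap.coe_multilinearMap,
      AlternatingMap.map_eq_zero_of_not_injective, smul_zero]
    intro hinj
    have := Fintype.card_le_of_injective σ fun i j hij => hinj (congrArg s hij)
    simp only [Fintype.card_fin] at this
    omega
  have h4 : η (fun i => χ • v i) x = η v x := by
    rw [← AlternatingMap.coe_multilinearMap, MultilinearMap.map_smul_univ, VBundle.smul_apply,
      AlternatingMap.coe_multilinearMap, Finset.prod_const]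
    change (SmoothFun.evalHom x) (χ ^ _) • _ = _
    rw [map_pow, SmoothFun.evalHom_apply, h1.self_of_nhds, one_pow, one_smul]
  rw [← h4, h3]; rfl

theorem formFiltration_eq_bot {E : ℤ → VBundle.{w} E₀ M} {p : ℤ}
    (hp : (Module.finrank ℝ 𝔄.A.F : ℤ) < p) : 𝔄.formFiltration E p = ⊥ := by
  refine eq_bot_iff.mpr fun ξ hξ => (Submodule.mem_bot ℝ).mpr (gform_ext fun i j => ?_)
  rw [map_zero]
  by_cases hi : (i : ℤ) < p
  · exact mem_formFiltration.mp hξ i j hi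
  · exact form_eq_zero (by omega) _

end Locality

section FibrewiseOperators

variable {E F G : ℤ → VBundle.{w} E₀ M}

theorem gform_induction_on {P : 𝔄.GForm E → Prop} (S : ℕ → ℤ → Prop) (h0 : P 0)
    (hi : ∀ i j (η : 𝔄.Form (E j) i), S i j → P (𝔄.inclusion E i j η))
    (ha : ∀ ξ ξ', P ξ → P ξ' → P (ξ + ξ')) {ξ : 𝔄.GForm E}
    (hξ : ∀ i j, ¬ S i j → 𝔄.component E i j ξ = 0) : P ξ := by
  classical
  have h := DirectSum.sum_support_of (β := fun ij : ℕ × ℤ => 𝔄.Form (E ij.2) ij.1) ξ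
  rw [← h]
  refine Finset.sum_induction _ P ha h0 fun ij hij => hi ij.1 ij.2 _ ?_
  by_contra hS
  exact (DFinsupp.mem_support_iff.mp hij) (hξ ij.1 ij.2 hS)

/-- The operator `Ω^i(A; E^j) → Ω^i(A; F^{j+d})` induced by linear maps `E^m → F^n`, with
the sign `ε^i`. -/
noncomputable def fibOp (𝔄 : LieAlgebroid.{v} E₀ M) (ε : ℝ) (d : ℤ)
    (T : ∀ m n, (E m).Sec →ₗ[SmoothFun E₀ M] (F n).Sec) : 𝔄.GForm E →ₗ[ℝ] 𝔄.GForm F :=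
  DirectSum.toModule ℝ (ℕ × ℤ) (𝔄.GForm F) fun ij =>
    ε ^ ij.1 • 𝔄.inclusion F ij.1 (ij.2 + d) ∘ₗ
      ({ toFun := fun η => (T ij.2 (ij.2 + d)).compAlternatingMap η
         map_add' := fun η η' => by ext1 v; exact map_add (T _ _) (η v) (η' v)
         map_smul' := fun c η => by
           ext1 v; exact (T _ _).map_smul_of_tower c (η v) } :
        𝔄.Form (E ij.2) ij.1 →ₗ[ℝ] 𝔄.Form (F (ij.2 + d)) ij.1)

variable {ε : ℝ} {d : ℤ} {T : ∀ m n, (E m).Sec →ₗ[SmoothFun E₀ M] (F n).Sec}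

theorem fibOp_inclusion {i : ℕ} {m n : ℤ} (h : m + d = n) (η : 𝔄.Form (E m) i) :
    𝔄.fibOp ε d T (𝔄.inclusion E i m η) =
      ε ^ i • 𝔄.inclusion F i n ((T m n).compAlternatingMap η) := by
  subst h
  exact DirectSum.toModule_lof ℝ (M := fun ij : ℕ × ℤ => 𝔄.Form (E ij.2) ij.1) (i, m) η

/-- With `ε = -1` this is the graded commutation of `∂` and `k`, of degree `1` and `-1`, with forms;
with `ε = 1` it is the `Ω(A)`-linearity of `p` and `i`. -/
theorem fibOp_mul {k : ℕ} (ψ : 𝔄.ScalarForm k) (ξ : 𝔄.GForm E) :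
    𝔄.fibOp ε d T (𝔄.mul ψ ξ) = ε ^ k • 𝔄.mul ψ (𝔄.fibOp ε d T ξ) := by
  induction ξ using gform_induction with
  | h0 => simp
  | hi i j η =>
    rw [mul_inclusion, fibOp_inclusion rfl, fibOp_inclusion rfl, comp_mulForm, map_smul,
      mul_inclusion, smul_smul, pow_add]
  | ha ξ ξ' h h' => rw [map_add, map_add, map_add, map_add, h, h', smul_add]

theorem fibOp_ofSec {m n : ℤ} (h : m + d = n) (s : (E m).Sec) :
    𝔄.fibOp ε d T (𝔄.ofSec m s) = 𝔄.ofSec n (T m n s) := by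
  rw [ofSec_eq, fibOp_inclusion h, pow_zero, one_smul]
  rfl

theorem component_fibOp {i : ℕ} {m n : ℤ} (h : m + d = n) (ξ : 𝔄.GForm E) :
    𝔄.component F i n (𝔄.fibOp ε d T ξ) =
      ε ^ i • (T m n).compAlternatingMap (𝔄.component E i m ξ) := by
  induction ξ using gform_induction with
  | h0 =>
    simp only [map_zero]
    ext1 v
    change 0 = ε ^ i • T m n 0
    rw [map_zero, smul_zero]
  | hi i' m' η =>
    rw [fibOp_inclusion rfl, map_smul]
    by_cases h' : (i', m') = (i, m)
    · obtain ⟨rfl, rfl⟩ := Prod.mk.inj h'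
      subst h
      rw [component_inclusion_self, component_inclusion_self]
    · rw [component_inclusion_of_ne h', component_inclusion_of_ne]
      · ext1 v
        change ε ^ i' • 0 = ε ^ i • T m n 0
        rw [map_zero, smul_zero, smul_zero]
      · rintro h2
        obtain ⟨rfl, h3⟩ := Prod.mk.inj h2
        exact h' (Prod.ext rfl (by dsimp only; omega))
  | ha ξ ξ' h h' =>
    rw [map_add, map_add, map_add, h, h', ← smul_add]
    congr 1
    ext1 v
    exact (map_add (T m n) _ _).symm

theorem fibOp_mem_formFiltration {p : ℤ} {ξ : 𝔄.GForm E} (h : ξ ∈ 𝔄.formFiltration E p) :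
    𝔄.fibOp ε d T ξ ∈ 𝔄.formFiltration F p := by
  refine mem_formFiltration.mpr fun i j hi => ?_
  rw [component_fibOp (sub_add_cancel j d), mem_formFiltration.mp h i _ hi]
  ext1 v
  change ε ^ i • T _ _ 0 = 0
  rw [map_zero, smul_zero]

theorem fibOp_mem_totalDegree {n n' : ℤ} (hn : n + d = n') {ξ : 𝔄.GForm E}
    (h : ξ ∈ 𝔄.totalDegree E n) : 𝔄.fibOp ε d T ξ ∈ 𝔄.totalDegree F n' := by
  refine mem_totalDegree.mpr fun i j hi => ?_
  rw [component_fibOp (sub_add_cancel j d), mem_totalDegree.mp h i _ (by omega)]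
  ext1 v
  change ε ^ i • T _ _ 0 = 0
  rw [map_zero, smul_zero]

end FibrewiseOperators

end LieAlgebroid

namespace AConnection

open LieAlgebroid

variable (c : AConnection 𝔄 V)

theorem d_apply {p : ℕ} (η : 𝔄.Form V p) (v : Fin (p + 1) → 𝔄.A.Sec) :
    c.d p η v = koszulFst (fun α s => c.nabla α s) η v + koszulSnd (fun α β => 𝔄.bracket α β) η v :=
  rfl

theorem d_zero_apply (s : V.Sec) (v : Fin 1 → 𝔄.A.Sec) :
    c.d 0 (𝔄.constForm s) v = c.nabla (v 0) s := by
  rw [d_apply]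
  change _ + 0 = _
  simp [koszulFst]

theorem d_isLocalOp (p : ℕ) : IsLocalOp (c.d p) := by
  intro f x hf η v
  rw [d_apply, d_apply]
  have h1 : koszulFst (fun α s => c.nabla α s) (f • η) v x =
      koszulFst (fun α s => c.nabla α s) η v x := by
    rw [koszulFst, koszulFst, VBundle.sum_apply, VBundle.sum_apply]
    refine Finset.sum_congr rfl fun i _ => ?_
    change V.evalAt x _ = V.evalAt x _
    rw [map_zsmul, map_zsmul, AlternatingMap.smul_apply, c.leibniz, VBundle.evalAt_apply,
      VBundle.evalAt_apply]
    congr 1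
    change f x • c.nabla (v i) (η (i.removeNth v)) x + 𝔄.lieDeriv (v i) f x • η (i.removeNth v) x = _
    rw [hf.self_of_nhds, lieDeriv_apply_eq_zero _ hf, one_smul, zero_smul, add_zero]
  have h2 : koszulSnd (fun α β => 𝔄.bracket α β) (f • η) v x =
      koszulSnd (fun α β => 𝔄.bracket α β) η v x := by
    cases p with
    | zero => rfl
    | succ p =>
      simp only [koszulSnd, VBundle.sum_apply]
      refine Finset.sum_congr rfl fun i _ => Finset.sum_congr rfl fun j _ => ?_
      change V.evalAt x _ = V.evalAt x _
      rw [map_zsmul, map_zsmul, AlternatingMap.smul_apply, VBundle.evalAt_apply,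
        VBundle.evalAt_apply, VBundle.smul_apply, hf.self_of_nhds, one_smul]
  exact congrArg₂ (· + ·) h1 h2

/-- On products `d_∇` obeys the derivation rule of `D`; together with locality this identifies it
with a component of `D`. -/
theorem d_tensorSec {k : ℕ} (ψ : 𝔄.ScalarForm k) (s : V.Sec) :
    c.d k (tensorSec ψ s) =
      tensorSec (𝔄.dA ψ) s + (-1 : ℝ) ^ k • 𝔄.mulForm ψ (c.d 0 (𝔄.constForm s)) := by
  ext1 v
  have hd : 𝔄.dA ψ v = koszulFst 𝔄.lieDeriv ψ v + koszulSnd (fun α β => 𝔄.bracket α β) ψ v := rfl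
  -- The shuffle sign `(-1)^(i+k)` and the factor `(-1)^k` combine to the sign `(-1)^i` of the
  -- Koszul formula.
  have hR : ((-1 : ℝ) ^ k • 𝔄.mulForm ψ (c.d 0 (𝔄.constForm s))) v =
      ∑ i : Fin (k + 1), (-1 : ℤ) ^ (i : ℕ) • (ψ (i.removeNth v) • c.nabla (v i) s) := by
    rw [AlternatingMap.smul_apply, mulForm_one, Finset.smul_sum]
    refine Finset.sum_congr rfl fun i _ => ?_
    rw [d_zero_apply, pow_add, ← Int.cast_smul_eq_zsmul ℝ, ← Int.cast_smul_eq_zsmul ℝ, smul_smul]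
    congr 1
    push_cast
    rw [mul_comm, mul_assoc, ← mul_pow]
    simp
  rw [d_apply, AlternatingMap.add_apply, hR]
  rw [tensorSec_apply, hd, add_smul]
  have h1 : koszulFst (fun α s => c.nabla α s) (tensorSec ψ s) v =
      koszulFst 𝔄.lieDeriv ψ v • s +
        ∑ i : Fin (k + 1), (-1 : ℤ) ^ (i : ℕ) • (ψ (i.removeNth v) • c.nabla (v i) s) := by
    rw [koszulFst, koszulFst, Finset.sum_smul, ← Finset.sum_add_distrib]
    refine Finset.sum_congr rfl fun i _ => ?_
    rw [smul_assoc, ← smul_add, add_comm (_ • s), ← c.leibniz]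
    rfl
  have h2 : koszulSnd (fun α β => 𝔄.bracket α β) (tensorSec ψ s) v =
      koszulSnd (fun α β => 𝔄.bracket α β) ψ v • s := by
    cases k with
    | zero => exact (zero_smul _ s).symm
    | succ k =>
      simp only [koszulSnd, Finset.sum_smul]
      refine Finset.sum_congr rfl fun i _ => Finset.sum_congr rfl fun j _ => ?_
      rw [smul_assoc]
      rfl
  rw [h1, h2]
  abel

end AConnection

end FormCalculus

/-! ### The components of `D` and the consequences of `D² = 0` -/

section StructureOperator

open Filter Topology LieAlgebroid

variable {E₀ : Type*} [NormedAddCommGroup E₀] [NormedSpace ℝ E₀] {M : Type u} [TopologicalSpace M]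
  [ChartedSpace E₀ M] [IsManifold 𝓘(ℝ, E₀) ∞ M] {𝔄 : LieAlgebroid.{v} E₀ M}
  {E : ℤ → VBundle.{w} E₀ M}

namespace RepUpToHomotopy

variable (R : RepUpToHomotopy 𝔄 E)

theorem D_constScalar_mul (f : SmoothFun E₀ M) (ξ : 𝔄.GForm E) :
    R.D (𝔄.mul (𝔄.constScalar f) ξ) =
      𝔄.mul (𝔄.dA (𝔄.constScalar f)) ξ + 𝔄.mul (𝔄.constScalar f) (R.D ξ) := by
  rw [R.derivation, pow_zero, one_smul]

/-- The component `Γ(E^m) → Γ(E^n)` of `D` is `C^∞(M)`-linear. -/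
noncomputable def delLin (m n : ℤ) : (E m).Sec →ₗ[SmoothFun E₀ M] (E n).Sec where
  toFun := R.del m n
  map_add' := map_add _
  map_smul' f s := by
    change 𝔄.component E 0 n (R.D (𝔄.ofSec m (f • s))) Fin.elim0 =
      f • 𝔄.component E 0 n (R.D (𝔄.ofSec m s)) Fin.elim0
    -- The term `d_A(f) s` has form degree one and does not contribute in degree zero.
    rw [ofSec_smul, D_constScalar_mul, map_add, component_mul_of_lt _ one_pos,
      component_mul_constScalar, zero_add]
    rfl

theorem D_ofSec_mem (n : ℤ) (s : (E n).Sec) : R.D (𝔄.ofSec n s) ∈ 𝔄.totalDegree E (n + 1) :=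
  R.map_totalDegree n _ (inclusion_mem_totalDegree' (by simp) _)

theorem del_eq_zero {m n : ℤ} (h : n ≠ m + 1) (s : (E m).Sec) : R.del m n s = 0 := by
  change 𝔄.component E 0 n (R.D (𝔄.ofSec m s)) Fin.elim0 = 0
  rw [mem_totalDegree.mp (R.D_ofSec_mem m s) 0 n (by simpa using h)]
  rfl

/-- The `A`-connection on `E^n` given by `D`. -/
noncomputable def conn (n : ℤ) : AConnection 𝔄 (E n) where
  nabla := LinearMap.mk₂ ℝ (R.nabla n)
    (fun α β s => map_add ((AlternatingMap.ofSubsingleton (SmoothFun E₀ M) 𝔄.A.Sec (E n).Sec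
      (0 : Fin 1)).symm (𝔄.component E 1 n (R.D (𝔄.ofSec n s)))) α β)
    (fun c α s => LinearMap.map_smul_of_tower ((AlternatingMap.ofSubsingleton (SmoothFun E₀ M)
      𝔄.A.Sec (E n).Sec (0 : Fin 1)).symm (𝔄.component E 1 n (R.D (𝔄.ofSec n s)))) c α)
    (fun α s t => by simp only [RepUpToHomotopy.nabla, map_add]; rfl)
    (fun c α s => by simp only [RepUpToHomotopy.nabla, map_smul]; rfl)
  smul_left f α s := map_smul ((AlternatingMap.ofSubsingleton (SmoothFun E₀ M) 𝔄.A.Sec (E n).Sec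
      (0 : Fin 1)).symm (𝔄.component E 1 n (R.D (𝔄.ofSec n s)))) f α
  leibniz α f s := by
    change 𝔄.component E 1 n (R.D (𝔄.ofSec n (f • s))) (fun _ => α) = f • R.nabla n α s + _
    rw [ofSec_smul, D_constScalar_mul, map_add, component_mul_constScalar, mul_ofSec,
      component_inclusion_self, add_comm, AlternatingMap.add_apply, tensorSec_apply,
      dA_constScalar_apply]
    rfl

@[simp] theorem conn_nabla (n : ℤ) (α : 𝔄.A.Sec) (s : (E n).Sec) :
    (R.conn n).nabla α s = R.nabla n α s := rfl

theorem component_one_D_ofSec (n : ℤ) (s : (E n).Sec) :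
    𝔄.component E 1 n (R.D (𝔄.ofSec n s)) = (R.conn n).d 0 (𝔄.constForm s) := by
  ext1 v
  rw [AConnection.d_zero_apply, conn_nabla, RepUpToHomotopy.nabla]
  congr 1
  funext i
  rw [Subsingleton.elim i 0]

theorem component_zero_D_ofSec (m n : ℤ) (s : (E m).Sec) :
    𝔄.component E 0 n (R.D (𝔄.ofSec m s)) = 𝔄.constForm (R.del m n s) :=
  component_zero_eq n _

theorem D_tensorSec (i : ℕ) (j : ℤ) (ψ : 𝔄.ScalarForm i) (s : (E j).Sec) :
    R.D (𝔄.inclusion E i j (tensorSec ψ s)) = 𝔄.inclusion E (i + 1) j (tensorSec (𝔄.dA ψ) s) +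
      (-1 : ℝ) ^ i • 𝔄.mul ψ (R.D (𝔄.ofSec j s)) := by
  rw [← mul_ofSec, R.derivation, mul_ofSec]

/-- In `D(f η) = d_A(f) η + f D(η)` the first term vanishes at `x` if `f` is `1` near `x`. -/
theorem isLocalOp_component_D (i : ℕ) (j : ℤ) (i' : ℕ) (j' : ℤ) :
    IsLocalOp (𝔄.component E i' j' ∘ₗ R.D ∘ₗ 𝔄.inclusion E i j) := by
  intro f x hf η v
  simp only [LinearMap.comp_apply]
  rw [← mul_constScalar_inclusion, D_constScalar_mul, map_add, component_mul_constScalar]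
  change 𝔄.component E i' j' (𝔄.mul (𝔄.dA (𝔄.constScalar f)) (𝔄.inclusion E i j η)) v x +
    f x • 𝔄.component E i' j' (R.D (𝔄.inclusion E i j η)) v x = _
  rw [component_mul_apply_eq_zero, hf.self_of_nhds, one_smul, zero_add]
  intro v
  rw [dA_constScalar_apply]
  exact lieDeriv_apply_eq_zero _ hf

theorem isLocalOp_zero {V W : VBundle.{w} E₀ M} {p q : ℕ} :
    IsLocalOp (0 : 𝔄.Form V p →ₗ[ℝ] 𝔄.Form W q) := fun _ _ _ _ _ => rfl

theorem isLocalOp_comp {V W : VBundle.{w} E₀ M} {p : ℕ} {L : 𝔄.Form V p →ₗ[ℝ] 𝔄.Form W p}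
    (T : V.Sec →ₗ[SmoothFun E₀ M] W.Sec) (c : ℝ) (hL : ∀ η, L η = c • T.compAlternatingMap η) :
    IsLocalOp L := fun f x hf η v => by
  rw [hL, hL]
  change c • T (f • η v) x = c • T (η v) x
  rw [map_smul, VBundle.smul_apply, hf.self_of_nhds, one_smul]

variable [FiniteDimensional ℝ E₀] [T2Space M]

/-- Both terms of `D(ψ s) = d_A(ψ) s ± ψ D(s)` have at least the form degree of `ψ`. -/
theorem component_D_of_lt {i i' : ℕ} (h : i' < i) (j j' : ℤ) (η : 𝔄.Form (E j) i) :
    𝔄.component E i' j' (R.D (𝔄.inclusion E i j η)) = 0 := by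
  refine LinearMap.congr_fun ((R.isLocalOp_component_D i j i' j').ext isLocalOp_zero
    fun ψ s => ?_) η
  simp only [LinearMap.comp_apply, LinearMap.zero_apply]
  rw [D_tensorSec, map_add, map_smul, component_mul_of_lt ψ h, smul_zero, add_zero,
    component_inclusion_of_ne]
  rintro ⟨⟩
  omega

/-- The differential `∂` as an operator on `Ω(A; E)`. -/
noncomputable def delOp : 𝔄.GForm E →ₗ[ℝ] 𝔄.GForm E := 𝔄.fibOp (-1) 1 R.delLin

theorem component_D_self (i : ℕ) (j j' : ℤ) (η : 𝔄.Form (E j) i) :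
    𝔄.component E i j' (R.D (𝔄.inclusion E i j η)) =
      𝔄.component E i j' (R.delOp (𝔄.inclusion E i j η)) := by
  have h2 : IsLocalOp (𝔄.component E i j' ∘ₗ R.delOp ∘ₗ 𝔄.inclusion E i j) := by
    by_cases hj : j + 1 = j'
    · refine isLocalOp_comp (R.delLin j j') ((-1) ^ i) fun η => ?_
      simp only [LinearMap.comp_apply, delOp]
      rw [fibOp_inclusion hj, map_smul, component_inclusion_self]
    · convert! isLocalOp_zero
      ext1 η
      simp only [LinearMap.comp_apply, delOp]
      rw [fibOp_inclusion rfl, map_smul, component_inclusion_of_ne (by rintro ⟨⟩; exact hj rfl),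
        smul_zero, LinearMap.zero_apply]
  refine LinearMap.congr_fun ((R.isLocalOp_component_D i j i j').ext h2 fun ψ s => ?_) η
  simp only [LinearMap.comp_apply]
  rw [D_tensorSec, map_add, map_smul, component_inclusion_of_ne (by rintro h; simp at h), zero_add,
    delOp]
  have h3 : 𝔄.component E i j' (𝔄.mul ψ (R.D (𝔄.ofSec j s))) = tensorSec ψ (R.del j j' s) := by
    rw [← mulForm_constForm_eq, ← component_zero_D_ofSec]
    exact component_mul ψ 0 j' _
  rw [h3]
  by_cases hj : j + 1 = j'
  · rw [fibOp_inclusion hj, map_smul, component_inclusion_self, comp_tensorSec]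
    rfl
  · rw [R.del_eq_zero (fun h => hj h.symm), fibOp_inclusion rfl, map_smul,
      component_inclusion_of_ne (by rintro ⟨⟩; exact hj rfl), smul_zero]
    ext1 v
    change (-1 : ℝ) ^ i • (ψ v • (0 : (E j').Sec)) = 0
    rw [smul_zero, smul_zero]

theorem component_D_succ (i : ℕ) (j : ℤ) (η : 𝔄.Form (E j) i) :
    𝔄.component E (i + 1) j (R.D (𝔄.inclusion E i j η)) = (R.conn j).d i η := by
  refine LinearMap.congr_fun ((R.isLocalOp_component_D i j (i + 1) j).ext
    ((R.conn j).d_isLocalOp i) fun ψ s => ?_) η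
  simp only [LinearMap.comp_apply]
  rw [D_tensorSec, map_add, map_smul, component_inclusion_self, component_mul,
    component_one_D_ofSec, AConnection.d_tensorSec]

/-- The part of `D` that preserves the form degree is `∂`, and nothing lowers it. The nilpotency of
the perturbation rests on this. -/
theorem D_sub_delOp_mem {p : ℤ} {ξ : 𝔄.GForm E} (h : ξ ∈ 𝔄.formFiltration E p) :
    R.D ξ - R.delOp ξ ∈ 𝔄.formFiltration E (p + 1) := by
  refine gform_induction_on (P := fun ξ => R.D ξ - R.delOp ξ ∈ 𝔄.formFiltration E (p + 1))
    (fun i _ => p ≤ i) ?_ (fun i j η hi => ?_) (fun ξ ξ' h h' => ?_)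
    fun i j hi => mem_formFiltration.mp h i j (not_le.mp hi)
  · rw [map_zero, map_zero, sub_zero]; exact Submodule.zero_mem _
  · refine mem_formFiltration.mpr fun i' j' hi' => ?_
    rw [map_sub]
    rcases lt_or_ge i' i with hlt | hge
    · rw [R.component_D_of_lt hlt, delOp, mem_formFiltration.mp
        (fibOp_mem_formFiltration (inclusion_mem_formFiltration le_rfl j η)) i' j' (by omega),
        sub_zero]
    · obtain rfl : i' = i := by omega
      rw [component_D_self, sub_self]
  · rw [map_add, map_add, add_sub_add_comm]; exact Submodule.add_mem _ h h'

theorem component_D_of_mem {i : ℕ} {m n : ℤ} (hn : m + 1 = n) {ξ : 𝔄.GForm E}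
    (h : ξ ∈ 𝔄.formFiltration E i) :
    𝔄.component E i n (R.D ξ) = (-1 : ℝ) ^ i •
      (R.delLin m n).compAlternatingMap (𝔄.component E i m ξ) := by
  have h1 := mem_formFiltration.mp (R.D_sub_delOp_mem h) i n (by omega)
  rw [map_sub, sub_eq_zero] at h1
  rw [h1, delOp, component_fibOp hn]

theorem toSec_D {m n : ℤ} (hn : m + 1 = n) (ξ : 𝔄.GForm E) :
    𝔄.toSec n (R.D ξ) = R.del m n (𝔄.toSec m ξ) := by
  have h := R.component_D_of_mem (i := 0) hn (ξ := ξ)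
    (by rw [formFiltration_eq_top (by simp)]; trivial)
  change 𝔄.component E 0 n (R.D ξ) Fin.elim0 = _
  rw [h, pow_zero, one_smul]
  rfl

theorem del_del {m n l : ℤ} (hl : n + 1 = l) (s : (E m).Sec) :
    R.del n l (R.del m n s) = 0 := by
  change R.del n l (𝔄.toSec n (R.D (𝔄.ofSec m s))) = 0
  rw [← R.toSec_D hl, R.sq_zero, map_zero]

theorem component_succ_D_of_mem {i : ℕ} {m n : ℤ} (hn : m + 1 = n) {ξ : 𝔄.GForm E}
    (h : ξ ∈ 𝔄.formFiltration E i) :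
    𝔄.component E (i + 1) n (R.D ξ) = (R.conn n).d i (𝔄.component E i n ξ) + (-1 : ℝ) ^ (i + 1) •
      (R.delLin m n).compAlternatingMap (𝔄.component E (i + 1) m ξ) := by
  have h1 : ξ - 𝔄.inclusion E i n (𝔄.component E i n ξ) ∈ 𝔄.formFiltration E i :=
    Submodule.sub_mem _ h (inclusion_mem_formFiltration le_rfl n _)
  rw [← R.component_D_succ, ← component_fibOp hn, ← sub_eq_iff_eq_add', ← map_sub, ← map_sub]
  -- Once the component in bidegree `(i, n)` is removed, only `∂` reaches the bidegree `(i + 1, n)`: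
  -- the other components of form degree `i` have the wrong total degree, those of form degree `i +
  -- 1` enter through `∂`, and higher ones cannot come down.
  have key : ∀ ζ : 𝔄.GForm E, ζ ∈ 𝔄.formFiltration E i → 𝔄.component E i n ζ = 0 →
      𝔄.component E (i + 1) n (R.D ζ) = 𝔄.component E (i + 1) n (R.delOp ζ) := by
    intro ζ hζ hζ0
    refine gform_induction_on (P := fun ζ => 𝔄.component E (i + 1) n (R.D ζ) =
      𝔄.component E (i + 1) n (R.delOp ζ)) (fun i' j => i ≤ i' ∧ (i' = i → j ≠ n)) ?_
      (fun i' j η hi => ?_) (fun ζ ζ' h h' => ?_) fun i' j hi => ?_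
    · simp
    · rcases hi.1.lt_or_eq with h2 | rfl
      · rcases Nat.lt_or_ge i' (i + 2) with h3 | h3
        · obtain rfl : i' = i + 1 := by omega
          exact R.component_D_self (i + 1) j n η
        · rw [R.component_D_of_lt (by omega), delOp, fibOp_inclusion rfl, map_smul,
            component_inclusion_of_ne (by rintro ⟨⟩; omega), smul_zero]
      · have hj := hi.2 rfl
        rw [delOp, fibOp_inclusion rfl, map_smul,
            component_inclusion_of_ne (by rintro h; simp at h), smul_zero]
        refine mem_totalDegree.mp (R.map_totalDegree _ _ (inclusion_mem_totalDegree i j η)) _ _ ?_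
        push_cast
        omega
    · rw [map_add, map_add, map_add, map_add, h, h']
    · by_cases h2 : i ≤ i'
      · have h3 : i' = i ∧ j = n := by tauto
        obtain ⟨rfl, rfl⟩ := h3
        exact hζ0
      · exact mem_formFiltration.mp hζ i' j (by omega)
  rw [key _ h1 (by rw [map_sub, component_inclusion_self, sub_self])]
  change _ = 𝔄.component E (i + 1) n (R.delOp ξ)
  rw [map_sub, map_sub, sub_eq_self, delOp, fibOp_inclusion rfl, map_smul,
    component_inclusion_of_ne (by rintro h; simp at h), smul_zero]

/-- In form degree one, `D² s = 0` reads `∇ ∂s - ∂ ∇s = 0`; the minus sign is that of `∂` on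
`1`-forms. -/
theorem del_nabla {m n : ℤ} (hn : m + 1 = n) (α : 𝔄.A.Sec) (s : (E m).Sec) :
    R.del m n (R.nabla m α s) = R.nabla n α (R.del m n s) := by
  have h := R.component_succ_D_of_mem (i := 0) hn (ξ := R.D (𝔄.ofSec m s))
    (by rw [formFiltration_eq_top (by simp)]; trivial)
  rw [R.sq_zero, map_zero, component_zero_D_ofSec] at h
  have h1 := congrArg (fun η : 𝔄.Form (E n) 1 => η fun _ => α) h
  change 0 = (R.conn n).d 0 (𝔄.constForm (R.del m n s)) (fun _ => α) +
    (-1 : ℝ) ^ (0 + 1) • R.del m n (R.nabla m α s) at h1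
  rw [AConnection.d_zero_apply, conn_nabla, zero_add, pow_one, neg_one_smul] at h1
  exact (sub_eq_zero.mp (by rw [sub_eq_add_neg]; exact h1.symm)).symm

/-- In form degree two, `D² s = 0` says that the curvature is cancelled by terms that contain `∂`
into or out of `E^n`. Here these vanish. -/
theorem conn_isFlat {n : ℤ} (h0 : ∀ m, R.del m n = 0) (h1 : ∀ m, R.del n m = 0) :
    (R.conn n).IsFlat := by
  intro α β s
  have hF : R.D (𝔄.ofSec n s) ∈ 𝔄.formFiltration E (1 : ℕ) := by
    refine mem_formFiltration.mpr fun i j hi => ?_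
    obtain rfl : i = 0 := by omega
    rw [component_zero_D_ofSec, h1]; rfl
  have h := R.component_succ_D_of_mem (i := 1) (sub_add_cancel n 1) hF
  rw [R.sq_zero, map_zero, component_one_D_ofSec] at h
  have h2 := congrArg (fun η : 𝔄.Form (E n) 2 => η ![α, β]) h
  change 0 = (R.conn n).d 1 ((R.conn n).d 0 (𝔄.constForm s)) ![α, β] +
    (-1 : ℝ) ^ (1 + 1) • R.del (n - 1) n _ at h2
  rw [h0, LinearMap.zero_apply, smul_zero, add_zero, AConnection.d_apply] at h2
  simp only [koszulFst, koszulSnd, AConnection.d_zero_apply, Fin.removeNth, Fin.cons_zero] at h2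
  simp at h2
  rw [h2]
  abel

end RepUpToHomotopy

end StructureOperator

/-! ### The spectral sequence of a filtered complex and its convergence -/

section FilteredComplex

open CategoryTheory

/-- A surjection with kernel `B` identifies the quotient by `B` with its target. -/
noncomputable def quotEquivOfSurjective {Z P : Type*} [AddCommGroup Z] [Module ℝ Z] [AddCommGroup P]
    [Module ℝ P] (φ : Z →ₗ[ℝ] P) (hφ : Function.Surjective φ) (B : Submodule ℝ Z)
    (hB : ∀ z, φ z = 0 ↔ z ∈ B) : (Z ⧸ B) ≃ₗ[ℝ] P :=
  (Submodule.quotEquivOfEq B (LinearMap.ker φ) (by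
    ext z; rw [LinearMap.mem_ker, hB])).trans (φ.quotKerEquivOfSurjective hφ)

/-- A filtered complex, with differential and grading on one ambient vector space. -/
structure FilteredComplex (G : Type w) [AddCommGroup G] [Module ℝ G] where
  D : G →ₗ[ℝ] G
  T : ℤ → Submodule ℝ G
  F : ℤ → Submodule ℝ G
  D_D : ∀ z, D (D z) = 0
  D_T : ∀ n, ∀ z ∈ T n, D z ∈ T (n + 1)
  antitone_F : Antitone F

namespace FilteredComplex

variable {G : Type w} [AddCommGroup G] [Module ℝ G] (K : FilteredComplex G)

/-- The elements of `F^p` and degree `n` with differential in `F^{p+r}`. -/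
def Zs (r p n : ℤ) : Submodule ℝ G := K.F p ⊓ K.T n ⊓ (K.F (p + r)).comap K.D

/-- The submodule that is divided out on the page `r`. -/
def Bs (r p n : ℤ) : Submodule ℝ G := K.Zs (r - 1) (p + 1) n ⊔ (K.Zs (r - 1) (p - r + 1) (n - 1)).map K.D

variable {K}

theorem mem_Zs {r p n : ℤ} {z : G} : z ∈ K.Zs r p n ↔ (z ∈ K.F p ∧ z ∈ K.T n) ∧ K.D z ∈ K.F (p + r) :=
  Iff.rfl

theorem mem_Bs {r p n : ℤ} {z : G} : z ∈ K.Bs r p n ↔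
    ∃ b ∈ K.Zs (r - 1) (p + 1) n, ∃ y ∈ K.Zs (r - 1) (p - r + 1) (n - 1), b + K.D y = z := by
  rw [Bs, Submodule.mem_sup]
  simp only [Submodule.mem_map]
  constructor
  · rintro ⟨b, hb, _, ⟨y, hy, rfl⟩, h⟩
    exact ⟨b, hb, y, hy, h⟩
  · rintro ⟨b, hb, y, hy, h⟩
    exact ⟨b, hb, _, ⟨y, hy, rfl⟩, h⟩

theorem Zs_mono {r r' p p' n : ℤ} (hp : p ≤ p') (hr : p + r ≤ p' + r') : K.Zs r' p' n ≤ K.Zs r p n :=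
  fun _ h => ⟨⟨K.antitone_F hp h.1.1, h.1.2⟩, K.antitone_F hr h.2⟩

theorem D_mem_Zs {r p n r' p' n' : ℤ} {z : G} (hz : z ∈ K.Zs r p n) (hp : p' = p + r)
    (hn : n' = n + 1) : K.D z ∈ K.Zs r' p' n' := by
  subst hp hn
  exact mem_Zs.mpr ⟨⟨hz.2, K.D_T n z hz.1.2⟩, by rw [K.D_D]; exact Submodule.zero_mem _⟩

variable (K)

/-- The entries of the pages. -/
abbrev PageX (r : ℤ) (pq : ℤ × ℤ) : Type w :=
  K.Zs r pq.1 (pq.1 + pq.2) ⧸ (K.Bs r pq.1 (pq.1 + pq.2)).comap (K.Zs r pq.1 (pq.1 + pq.2)).subtype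

open scoped Classical in
/-- The differentials of the pages. -/
noncomputable def pageD (r : ℤ) (pq pq' : ℤ × ℤ) : K.PageX r pq →ₗ[ℝ] K.PageX r pq' :=
  if h : pq + (r, 1 - r) = pq' then
    Submodule.mapQ _ _ (K.D.restrict (p := K.Zs r pq.1 (pq.1 + pq.2))
      (q := K.Zs r pq'.1 (pq'.1 + pq'.2))
      fun z hz => by
        subst h
        exact D_mem_Zs hz rfl (by simp only [Prod.fst_add, Prod.snd_add]; ring)) (by
      rintro ⟨z, hz⟩ hB
      subst h
      obtain ⟨b, hb, y, hy, rfl⟩ := mem_Bs.mp hB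
      -- `D (b + D y) = D b`, and `b` lies in the piece whose image under `D` is divided out at the
      -- target: its filtration index is `(p + r) - r + 1 = p + 1`.
      refine mem_Bs.mpr ⟨0, Submodule.zero_mem _, b, ?_, ?_⟩
      · have h1 := hb
        simp only [Prod.fst_add, Prod.snd_add]
        convert! h1 using 1
        congr 1 <;> ring
      · rw [zero_add]
        change K.D b = K.D (b + K.D y)
        rw [map_add, K.D_D, add_zero])
  else 0

variable {K}

/-- The class of an element on a page. -/
def pageMk (r : ℤ) (pq : ℤ × ℤ) (z : K.Zs r pq.1 (pq.1 + pq.2)) : K.PageX r pq :=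
  Submodule.Quotient.mk z

theorem pageMk_eq_zero {r : ℤ} {pq : ℤ × ℤ} (z : K.Zs r pq.1 (pq.1 + pq.2)) :
    pageMk r pq z = 0 ↔ (z : G) ∈ K.Bs r pq.1 (pq.1 + pq.2) :=
  Submodule.Quotient.mk_eq_zero _

theorem pageMk_eq_iff {r : ℤ} {pq : ℤ × ℤ} (z z' : K.Zs r pq.1 (pq.1 + pq.2)) :
    pageMk r pq z = pageMk r pq z' ↔ (z : G) - z' ∈ K.Bs r pq.1 (pq.1 + pq.2) :=
  Submodule.Quotient.eq _

theorem pageMk_surjective (r : ℤ) (pq : ℤ × ℤ) : Function.Surjective (pageMk (K := K) r pq) :=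
  Submodule.Quotient.mk_surjective _

theorem pageD_mk {r : ℤ} {pq pq' : ℤ × ℤ} (h : pq + (r, 1 - r) = pq')
    (z : K.Zs r pq.1 (pq.1 + pq.2)) : ∃ h' : K.D z ∈ K.Zs r pq'.1 (pq'.1 + pq'.2),
      K.pageD r pq pq' (pageMk r pq z) = pageMk r pq' ⟨K.D z, h'⟩ := by
  have h' : K.D z ∈ K.Zs r pq'.1 (pq'.1 + pq'.2) := by
    subst h
    exact D_mem_Zs z.2 rfl (by simp only [Prod.fst_add, Prod.snd_add]; ring)
  refine ⟨h', ?_⟩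
  rw [pageD, dif_pos h]
  rfl

theorem pageD_of_not {r : ℤ} {pq pq' : ℤ × ℤ} (h : pq + (r, 1 - r) ≠ pq') : K.pageD r pq pq' = 0 :=
  dif_neg h

variable (K)

/-- The pages of the spectral sequence. -/
noncomputable def page (r : ℤ) :
    HomologicalComplex (ModuleCat.{w} ℝ) (ComplexShape.up' ((r, 1 - r) : ℤ × ℤ)) where
  X pq := ModuleCat.of ℝ (K.PageX r pq)
  d pq pq' := ModuleCat.ofHom (K.pageD r pq pq')
  shape pq pq' h := by rw [pageD_of_not h]; rfl
  d_comp_d' a b c hab hbc := by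
    refine ModuleCat.hom_ext (LinearMap.ext fun x => ?_)
    obtain ⟨z, rfl⟩ := pageMk_surjective r a x
    obtain ⟨h1, h2⟩ := pageD_mk hab z
    obtain ⟨h3, h4⟩ := pageD_mk hbc ⟨K.D z, h1⟩
    change K.pageD r b c (K.pageD r a b (pageMk r a z)) = 0
    rw [h2, h4, pageMk_eq_zero]
    change K.D (K.D z) ∈ _
    rw [K.D_D]
    exact Submodule.zero_mem _

/-- If `D z = b + D y` represents zero, then `z - y` has its differential one step deeper in the
filtration, and `y` itself is trivial on the page. So the kernel is represented by the elements that
survive to the next page. -/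
theorem mk_mem_ker {r : ℤ} {pq pq' : ℤ × ℤ} (h : pq + (r, 1 - r) = pq')
    (z : K.Zs r pq.1 (pq.1 + pq.2)) : pageMk r pq z ∈ LinearMap.ker (K.pageD r pq pq') ↔
      ∃ y ∈ K.Zs (r - 1) (pq.1 + 1) (pq.1 + pq.2),
        (z : G) - y ∈ K.Zs (r + 1) pq.1 (pq.1 + pq.2) := by
  obtain ⟨h1, h2⟩ := pageD_mk h z
  rw [LinearMap.mem_ker, h2, pageMk_eq_zero, mem_Bs]
  subst h
  simp only [Prod.fst_add, Prod.snd_add]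
  constructor
  · rintro ⟨b, hb, y, hy, hby⟩
    have hy' : y ∈ K.Zs (r - 1) (pq.1 + 1) (pq.1 + pq.2) := by
      convert! hy using 1; congr 1 <;> ring
    refine ⟨y, hy', mem_Zs.mpr ⟨⟨Submodule.sub_mem _ z.2.1.1 (K.antitone_F (by omega) hy'.1.1),
      Submodule.sub_mem _ z.2.1.2 hy'.1.2⟩, ?_⟩⟩
    rw [map_sub, ← hby, add_sub_cancel_right]
    exact K.antitone_F (by omega) hb.1.1
  · rintro ⟨y, hy, hz⟩
    refine ⟨K.D (z - y), ?_, y, ?_, ?_⟩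
    · exact D_mem_Zs hz (by ring) (by ring)
    · convert! hy using 1; congr 1 <;> ring
    · rw [map_sub, sub_add_cancel]

/-- `Bs (r + 1)` consists of the `D y` with `y` of filtration `p - r`, which are the values of the
differential, and of elements of filtration `p + 1`, which are already zero on the page `r`. -/
theorem mk_mem_range {r : ℤ} {pq₀ pq : ℤ × ℤ} (h : pq₀ + (r, 1 - r) = pq) {z : G}
    (hz : z ∈ K.Zs r pq.1 (pq.1 + pq.2)) (hz' : z ∈ K.Zs (r + 1) pq.1 (pq.1 + pq.2)) :
    (∃ y, K.pageD r pq₀ pq y = pageMk r pq ⟨z, hz⟩) ↔ z ∈ K.Bs (r + 1) pq.1 (pq.1 + pq.2) := by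
  have h1 : pq₀.1 = pq.1 - r := by rw [← h, Prod.fst_add]; ring
  have h2 : pq₀.1 + pq₀.2 = pq.1 + pq.2 - 1 := by rw [← h, Prod.fst_add, Prod.snd_add]; ring
  constructor
  · rintro ⟨y, hy⟩
    obtain ⟨⟨y, hy₀⟩, rfl⟩ := pageMk_surjective r pq₀ y
    obtain ⟨h3, h4⟩ := pageD_mk h ⟨y, hy₀⟩
    rw [h4] at hy
    obtain ⟨b, hb, y', hy', h5⟩ := mem_Bs.mp ((pageMk_eq_iff _ _).mp hy.symm)
    have hzb : z = b + K.D (y' + y) := by rw [map_add, ← add_assoc, h5, sub_add_cancel]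
    refine mem_Bs.mpr ⟨b, mem_Zs.mpr ⟨hb.1, ?_⟩, y' + y, Submodule.add_mem _ ?_ ?_, hzb.symm⟩
    · have h6 : K.D z ∈ K.F (pq.1 + (r + 1)) := hz'.2
      rw [hzb, map_add, K.D_D, add_zero] at h6
      exact K.antitone_F (by omega) h6
    · exact Zs_mono (by omega) (by omega) hy'
    · rw [h2, h1] at hy₀
      exact Zs_mono (by omega) (by omega) hy₀
  · intro hzB
    obtain ⟨b, hb, y, hy, h5⟩ := mem_Bs.mp hzB
    have hy₀ : y ∈ K.Zs r pq₀.1 (pq₀.1 + pq₀.2) := by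
      rw [h2, h1]
      exact Zs_mono (by omega) (by omega) hy
    refine ⟨pageMk r pq₀ ⟨y, hy₀⟩, ?_⟩
    obtain ⟨h3, h4⟩ := pageD_mk h ⟨y, hy₀⟩
    rw [h4]
    refine ((pageMk_eq_iff _ _).mpr ?_).symm
    change z - K.D y ∈ K.Bs r _ _
    rw [← h5, add_sub_cancel_right]
    exact mem_Bs.mpr ⟨b, Zs_mono le_rfl (by omega) hb, 0, Submodule.zero_mem _, by simp⟩

/-- The homology of a page is the next page. -/
noncomputable def pageIso (r : ℤ) (pq : ℤ × ℤ) :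
    (K.page r).homology pq ≅ (K.page (r + 1)).X pq := by
  let S := (K.page r).sc pq
  have hn : pq + (r, 1 - r) = (ComplexShape.up' ((r, 1 - r) : ℤ × ℤ)).next pq :=
    ((ComplexShape.up' ((r, 1 - r) : ℤ × ℤ)).next_eq' rfl).symm
  have hp : (ComplexShape.up' ((r, 1 - r) : ℤ × ℤ)).prev pq + (r, 1 - r) = pq := by
    have h0 : (ComplexShape.up' ((r, 1 - r) : ℤ × ℤ)).Rel (pq - (r, 1 - r)) pq := sub_add_cancel _ _
    have h := (ComplexShape.up' ((r, 1 - r) : ℤ × ℤ)).prev_eq' h0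
    rw [h, sub_add_cancel]
  have hle : K.Zs (r + 1) pq.1 (pq.1 + pq.2) ≤ K.Zs r pq.1 (pq.1 + pq.2) :=
    Zs_mono le_rfl (by omega)
  have hker : ∀ z : K.Zs (r + 1) pq.1 (pq.1 + pq.2),
      (pageMk r pq ⟨z.1, hle z.2⟩ : K.PageX r pq) ∈ LinearMap.ker S.g.hom := fun z =>
    (K.mk_mem_ker hn _).mpr ⟨0, Submodule.zero_mem _, by rw [sub_zero]; exact z.2⟩
  let φ : K.Zs (r + 1) pq.1 (pq.1 + pq.2) →ₗ[ℝ] LinearMap.ker S.g.hom :=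
    { toFun := fun z => ⟨pageMk r pq ⟨z.1, hle z.2⟩, hker z⟩
      map_add' := fun _ _ => rfl
      map_smul' := fun _ _ => rfl }
  -- Elements surviving to the page `r + 1` map onto kernel modulo image by `mk_mem_ker`, and the
  -- kernel of this map is `Bs (r + 1)` by `mk_mem_range`.
  let ψ := (LinearMap.range S.moduleCatToCycles).mkQ ∘ₗ φ
  have hsurj : Function.Surjective ψ := by
    intro x
    obtain ⟨⟨x, hx⟩, rfl⟩ := Submodule.mkQ_surjective _ x
    obtain ⟨z, rfl⟩ := pageMk_surjective r pq x
    obtain ⟨y, hy, hz⟩ := (K.mk_mem_ker hn z).mp hx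
    refine ⟨⟨_, hz⟩, ?_⟩
    change (LinearMap.range S.moduleCatToCycles).mkQ (φ ⟨_, hz⟩) = _
    congr 1
    apply Subtype.ext
    change pageMk r pq _ = pageMk r pq z
    refine (pageMk_eq_iff _ _).mpr ?_
    change (z : G) - y - z ∈ K.Bs r pq.1 (pq.1 + pq.2)
    rw [sub_sub_cancel_left]
    exact Submodule.neg_mem _ (mem_Bs.mpr ⟨y, hy, 0, Submodule.zero_mem _, by simp⟩)
  have hB : ∀ z, ψ z = 0 ↔ z ∈ (K.Bs (r + 1) pq.1 (pq.1 + pq.2)).comap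
      (K.Zs (r + 1) pq.1 (pq.1 + pq.2)).subtype := by
    intro z
    have h0 : ψ z = 0 ↔ φ z ∈ LinearMap.range S.moduleCatToCycles := Submodule.Quotient.mk_eq_zero _
    have h1 : φ z ∈ LinearMap.range S.moduleCatToCycles ↔
        ∃ y : K.PageX r ((ComplexShape.up' ((r, 1 - r) : ℤ × ℤ)).prev pq),
          K.pageD r _ pq y = pageMk r pq ⟨z.1, hle z.2⟩ := by
      constructor
      · rintro ⟨y, hy⟩
        exact ⟨y, congrArg Subtype.val hy⟩
      · rintro ⟨y, hy⟩
        exact ⟨y, Subtype.ext hy⟩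
    exact h0.trans (h1.trans (K.mk_mem_range hp _ z.2))
  exact S.moduleCatHomologyIso ≪≫ (quotEquivOfSurjective ψ hsurj _ hB).symm.toModuleIso

/-- The spectral sequence of a filtered complex. -/
noncomputable def spectralSequence : E₂CohomologicalSpectralSequence (ModuleCat.{w} ℝ) where
  page r _ := K.page r
  iso r r' pq h _ := K.pageIso r pq ≪≫ eqToIso (by rw [h])

/-- The cohomology of a filtered complex. -/
abbrev H (n : ℤ) : Type w :=
  (LinearMap.ker K.D ⊓ K.T n : Submodule ℝ G) ⧸
    ((K.T (n - 1)).map K.D).comap (LinearMap.ker K.D ⊓ K.T n : Submodule ℝ G).subtype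

/-- The filtration of the cohomology. -/
def Fil (p n : ℤ) : Submodule ℝ (K.H n) :=
  ((K.F p).comap (LinearMap.ker K.D ⊓ K.T n : Submodule ℝ G).subtype).map (Submodule.mkQ _)

variable {K}

theorem mem_Fil {p n : ℤ} {z : (LinearMap.ker K.D ⊓ K.T n : Submodule ℝ G)} :
    Submodule.mkQ _ z ∈ K.Fil p n ↔ ∃ y ∈ K.T (n - 1), (z : G) - K.D y ∈ K.F p := by
  constructor
  · rintro ⟨z', hz', h⟩
    obtain ⟨y, hy, h2⟩ := (Submodule.Quotient.eq _).mp h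
    refine ⟨-y, Submodule.neg_mem _ hy, ?_⟩
    have h3 : (z : G) - K.D (-y) = z' := by
      rw [map_neg, sub_neg_eq_add, h2]
      exact add_sub_cancel _ _
    rw [h3]
    exact hz'
  · rintro ⟨y, hy, h⟩
    have hDy : K.D y ∈ (LinearMap.ker K.D ⊓ K.T n : Submodule ℝ G) :=
      ⟨K.D_D y, by have := K.D_T _ y hy; rwa [sub_add_cancel] at this⟩
    refine ⟨z - ⟨_, hDy⟩, h, ?_⟩
    refine (Submodule.Quotient.eq _).mpr ⟨-y, Submodule.neg_mem _ hy, ?_⟩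
    change K.D (-y) = (z : G) - K.D y - z
    rw [map_neg]
    abel

theorem converges {a b : ℤ} (ha : K.F a = ⊤) (hb : K.F b = ⊥) :
    SpectralConverges K.spectralSequence K.H K.Fil where
  antitone n p p' h := Submodule.map_mono (Submodule.comap_mono (K.antitone_F h))
  exhaustive n := ⟨a, by
    refine eq_top_iff.mpr fun x _ => ?_
    obtain ⟨z, rfl⟩ := Submodule.mkQ_surjective _ x
    exact mem_Fil.mpr ⟨0, Submodule.zero_mem _, by rw [ha]; trivial⟩⟩
  separated n := ⟨b, by
    refine eq_bot_iff.mpr fun x hx => ?_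
    obtain ⟨z, rfl⟩ := Submodule.mkQ_surjective _ x
    obtain ⟨y, hy, h⟩ := mem_Fil.mp hx
    rw [hb, Submodule.mem_bot, sub_eq_zero] at h
    exact (Submodule.mem_bot ℝ).mpr ((Submodule.Quotient.mk_eq_zero _).mpr ⟨y, hy, h.symm⟩)⟩
  stable p q := by
    -- From `b ≤ p + r` on, `Zs` contains only cocycles and the target of the outgoing differential
    -- vanishes. From `p - r + 1 ≤ a` on, all coboundaries in `F p` are divided out and the source
    -- of the incoming differential vanishes.
    refine ⟨max (b - p) (p + 1 - a), fun r hr hr₀ => ?_⟩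
    have hFb : ∀ i, b ≤ i → K.F i = ⊥ := fun i hi => eq_bot_iff.mpr (hb ▸ K.antitone_F hi)
    have hFa : ∀ i, i ≤ a → K.F i = ⊤ := fun i hi => eq_top_iff.mpr (ha ▸ K.antitone_F hi)
    have hr1 : b ≤ p + r := by have := le_max_left (b - p) (p + 1 - a); omega
    have hr2 : p - r + 1 ≤ a := by have := le_max_right (b - p) (p + 1 - a); omega
    refine ⟨fun k => ⟨?_, ?_⟩, ?_⟩
    · change ModuleCat.ofHom (K.pageD r k (p, q)) = 0
      by_cases h : k + (r, 1 - r) = (p, q)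
      · refine ModuleCat.hom_ext (LinearMap.ext fun x => ?_)
        obtain ⟨z, rfl⟩ := pageMk_surjective r k x
        have h1 : k.1 + r = p := congrArg Prod.fst h
        have hz : pageMk r k z = 0 := (pageMk_eq_zero z).mpr (mem_Bs.mpr
          ⟨z, ⟨⟨by rw [hFa _ (by omega)]; trivial, z.2.1.2⟩, K.antitone_F (by omega) z.2.2⟩,
            0, Submodule.zero_mem _, by simp⟩)
        change K.pageD r k (p, q) (pageMk r k z) = 0
        rw [hz, map_zero]
      · rw [pageD_of_not h]; rfl
    · change ModuleCat.ofHom (K.pageD r (p, q) k) = 0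
      by_cases h : (p, q) + (r, 1 - r) = k
      · refine ModuleCat.hom_ext (LinearMap.ext fun x => ?_)
        obtain ⟨z, hz⟩ := pageMk_surjective r k (K.pageD r (p, q) k x)
        have h1 : p + r = k.1 := congrArg Prod.fst h
        change K.pageD r (p, q) k x = 0
        rw [← hz, pageMk_eq_zero]
        have h2 : (z : G) ∈ K.F k.1 := z.2.1.1
        rw [hFb _ (by omega), Submodule.mem_bot] at h2
        rw [h2]
        exact Submodule.zero_mem _
      · rw [pageD_of_not h]; rfl
    · have hker : K.Zs r p (p + q) ≤ (LinearMap.ker K.D ⊓ K.T (p + q) : Submodule ℝ G) := fun z hz => by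
        have h2 := hz.2
        change K.D z ∈ K.F (p + r) at h2
        rw [hFb _ hr1, Submodule.mem_bot] at h2
        exact ⟨h2, hz.1.2⟩
      let φ₀ : K.Zs r p (p + q) →ₗ[ℝ] K.Fil p (p + q) :=
        LinearMap.codRestrict _ (Submodule.mkQ _ ∘ₗ Submodule.inclusion hker)
          fun z => ⟨Submodule.inclusion hker z, z.2.1.1, rfl⟩
      let φ := Submodule.mkQ ((K.Fil (p + 1) (p + q)).comap (K.Fil p (p + q)).subtype) ∘ₗ φ₀
      have hsurj : Function.Surjective φ := by
        refine (Submodule.mkQ_surjective _).comp ?_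
        rintro ⟨x, z, hz, rfl⟩
        refine ⟨⟨z, ⟨hz, z.2.2⟩, ?_⟩, rfl⟩
        change K.D z ∈ K.F (p + r)
        rw [LinearMap.mem_ker.mp z.2.1]
        exact Submodule.zero_mem _
      refine ⟨(quotEquivOfSurjective φ hsurj _ fun z => ?_).toModuleIso⟩
      have h1 : φ z = 0 ↔ φ₀ z ∈ (K.Fil (p + 1) (p + q)).comap (K.Fil p (p + q)).subtype :=
        Submodule.Quotient.mk_eq_zero _
      have h2 : φ₀ z ∈ (K.Fil (p + 1) (p + q)).comap (K.Fil p (p + q)).subtype ↔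
        Submodule.mkQ _ (Submodule.inclusion hker z) ∈ K.Fil (p + 1) (p + q) := Iff.rfl
      rw [h1, h2, mem_Fil, Submodule.mem_comap, Submodule.subtype_apply, mem_Bs]
      have hz0 : K.D z = 0 := (hker z.2).1
      constructor
      · rintro ⟨y, hy, h⟩
        refine ⟨z - K.D y, mem_Zs.mpr ⟨⟨h, ?_⟩, ?_⟩, y,
          mem_Zs.mpr ⟨⟨by rw [hFa _ hr2]; trivial, hy⟩, ?_⟩,
          sub_add_cancel _ _⟩
        · refine Submodule.sub_mem _ z.2.1.2 ?_
          have := K.D_T _ y hy; rwa [sub_add_cancel] at this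
        · rw [map_sub, K.D_D, hz0, sub_zero]
          exact Submodule.zero_mem _
        · have h3 : K.D y = z - (z - K.D y) := by abel
          rw [h3]
          refine K.antitone_F (a := p - r + 1 + (r - 1)) (b := p) (by omega)
            (Submodule.sub_mem _ z.2.1.1 (K.antitone_F (by omega) h))
      · rintro ⟨c, hc, y, hy, h⟩
        refine ⟨y, hy.1.2, ?_⟩
        change (z : G) - K.D y ∈ _
        rw [← h, add_sub_cancel_right]
        exact hc.1.1

end FilteredComplex

/-- This allows the spectral sequence of the transferred complex to converge to the cohomology of
the original one. -/
theorem SpectralConverges.congr {S : E₂CohomologicalSpectralSequence (ModuleCat.{w} ℝ)}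
    {H H' : ℤ → Type w} [∀ n, AddCommGroup (H n)] [∀ n, Module ℝ (H n)] [∀ n, AddCommGroup (H' n)]
    [∀ n, Module ℝ (H' n)] {Fil : ℤ → ∀ n, Submodule ℝ (H n)} {Fil' : ℤ → ∀ n, Submodule ℝ (H' n)}
    (h : SpectralConverges S H Fil) (e : ∀ n, H' n ≃ₗ[ℝ] H n)
    (he : ∀ p n, Fil' p n = (Fil p n).comap (e n).toLinearMap) : SpectralConverges S H' Fil' where
  antitone n p p' hp := by
    change Fil' p' n ≤ Fil' p n
    rw [he, he]; exact Submodule.comap_mono (h.antitone n hp)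
  exhaustive n := by
    obtain ⟨p, hp⟩ := h.exhaustive n
    exact ⟨p, by rw [he, hp, Submodule.comap_top]⟩
  separated n := by
    obtain ⟨p, hp⟩ := h.separated n
    exact ⟨p, by rw [he, hp, Submodule.comap_bot]; exact LinearEquiv.ker _⟩
  stable p q := by
    obtain ⟨r₀, hr₀⟩ := h.stable p q
    refine ⟨r₀, fun r hr hr' => ⟨(hr₀ r hr hr').1, (hr₀ r hr hr').2.map fun i => i ≪≫ ?_⟩⟩
    have hmap : ∀ p', (Fil' p' (p + q)).map (e (p + q)).toLinearMap = Fil p' (p + q) := fun p' => by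
      rw [he]; exact Submodule.map_comap_eq_of_surjective (e (p + q)).surjective _
    let ε : Fil' p (p + q) ≃ₗ[ℝ] Fil p (p + q) := (e (p + q)).submoduleMap _ ≪≫ₗ
      LinearEquiv.ofEq _ _ (hmap p)
    refine (Submodule.Quotient.equiv _ _ ε ?_).symm.toModuleIso
    ext ⟨x, hx⟩
    rw [Submodule.mem_map]
    simp only [Submodule.mem_comap, Submodule.subtype_apply]
    constructor
    · rintro ⟨y, hy, h2⟩
      have h3 : e (p + q) y = x := congrArg Subtype.val h2
      rw [he] at hy
      exact h3 ▸ hy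
    · intro hx'
      refine ⟨ε.symm ⟨x, hx⟩, ?_, ε.apply_symm_apply _⟩
      rw [he, Submodule.mem_comap]
      have h2 : (e (p + q)) (ε.symm ⟨x, hx⟩ : H' (p + q)) = (ε (ε.symm ⟨x, hx⟩) : H (p + q)) := rfl
      change (e (p + q)) (ε.symm ⟨x, hx⟩ : H' (p + q)) ∈ _
      rw [h2, ε.apply_symm_apply]
      exact hx'

end FilteredComplex

/-! ### The image of a map of constant rank as a vector bundle -/

section Splitting

set_option linter.unusedSectionVars false

open Filter Topology

variable {E₀ : Type*} [NormedAddCommGroup E₀] [NormedSpace ℝ E₀] {M : Type u} [TopologicalSpace M]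
  [ChartedSpace E₀ M] [FiniteDimensional ℝ E₀] [IsManifold 𝓘(ℝ, E₀) ∞ M] [T2Space M]

namespace VBundle

variable {V : VBundle.{v} E₀ M} {W : VBundle.{w} E₀ M}

section ImageBundle

variable {r : ℕ} (T : V.Sec →ₗ[SmoothFun E₀ M] W.Sec) (σ : M → Fin r → V.Sec)
  (θ : M → Fin r → W.Sec →ₗ[SmoothFun E₀ M] SmoothFun E₀ M) (U : M → Set M)

/-- The coordinate changes between the frames of the image of a map of constant rank. -/
noncomputable def imageCoordChange (i j y : M) :
    (ULift.{v} (Fin r) → ℝ) →L[ℝ] (ULift.{v} (Fin r) → ℝ) :=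
  ∑ a, ∑ b, (θ j b (T (σ i a)) y) • (ContinuousLinearMap.proj (ULift.up a)).smulRight
    (Pi.single (ULift.up b) 1)

theorem imageCoordChange_apply (i j y : M) (c : ULift.{v} (Fin r) → ℝ) (b : Fin r) :
    imageCoordChange T σ θ i j y c ⟨b⟩ = ∑ a, θ j b (T (σ i a)) y * c ⟨a⟩ := by
  simp only [imageCoordChange, _root_.sum_apply, _root_.smul_apply,
    ContinuousLinearMap.smulRight_apply, ContinuousLinearMap.proj_apply, Finset.sum_apply,
    Pi.smul_apply, smul_eq_mul]
  refine Finset.sum_congr rfl fun a _ => ?_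
  rw [Finset.sum_eq_single b]
  · simp
  · intro b' _ hb'
    rw [Pi.single_eq_of_ne (by simpa using hb'.symm)]
    simp
  · simp

theorem contMDiff_imageCoordChange (i j : M) :
    ContMDiff 𝓘(ℝ, E₀) 𝓘(ℝ, (ULift.{v} (Fin r) → ℝ) →L[ℝ] (ULift.{v} (Fin r) → ℝ)) ∞
      (imageCoordChange T σ θ i j) := by
  refine ContMDiff.sum fun a _ => ContMDiff.sum fun b _ => ?_
  exact (θ j b (T (σ i a))).contMDiff.smul contMDiff_const

variable (hUo : ∀ x, IsOpen (U x)) (hxU : ∀ x, x ∈ U x)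
  (hU : ∀ x, ∀ y ∈ U x, (∀ a b, θ x a (T (σ x b)) y = if a = b then 1 else 0) ∧
    ∀ s, T s y = ∑ a, θ x a (T s) y • T (σ x a) y)

/-- The image of a map of constant rank as a vector bundle. -/
noncomputable def imageCore : VectorBundleCore ℝ M (ULift.{v} (Fin r) → ℝ) M where
  baseSet := U
  isOpen_baseSet := hUo
  indexAt := id
  mem_baseSet_at := hxU
  coordChange := imageCoordChange T σ θ
  coordChange_self i y hy c := by
    ext ⟨b⟩
    rw [imageCoordChange_apply]
    simp only [(hU i y hy).1, ite_mul, one_mul, zero_mul, Finset.sum_ite_eq, Finset.mem_univ, if_true]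
  continuousOn_coordChange i j := (contMDiff_imageCoordChange T σ θ i j).continuous.continuousOn
  coordChange_comp i j k y hy c := by
    ext ⟨b⟩
    simp only [imageCoordChange_apply, Finset.mul_sum, ← mul_assoc]
    rw [Finset.sum_comm]
    refine Finset.sum_congr rfl fun a _ => ?_
    rw [← Finset.sum_mul]
    congr 1
    have h := congrArg (fibFun (θ k b) y) ((hU j y hy.1.2).2 (σ i a))
    simp only [map_sum, map_smul, fibFun_apply, smul_eq_mul] at h
    rw [h]
    exact Finset.sum_congr rfl fun _ _ => mul_comm _ _

instance imageCore_isContMDiff :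
    (imageCore T σ θ U hUo hxU hU).IsContMDiff 𝓘(ℝ, E₀) ∞ :=
  ⟨fun i j => (contMDiff_imageCoordChange T σ θ i j).contMDiffOn⟩

/-- The image of a map of constant rank, with the bundle structure of `imageCore`. -/
noncomputable def imageBundle : VBundle.{v} E₀ M where
  F := ULift.{v} (Fin r) → ℝ
  Fib := (imageCore T σ θ U hUo hxU hU).Fiber

/-- The coordinates of `T s` in the frames. -/
noncomputable def imageCoord (s : V.Sec) (x : M) : (imageBundle T σ θ U hUo hxU hU).Fib x :=
  fun a : ULift.{v} (Fin r) => θ x a.down (T s) x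

/-- The fibre over `x` is written in the frame chosen at `x`, which need not depend continuously on
`x`. Changing to the fixed frame of `x₀` turns the coordinates into the smooth functions `θ x₀ a (T
s)`. -/
theorem contMDiff_imageCoord (s : V.Sec) :
    ContMDiff 𝓘(ℝ, E₀) (𝓘(ℝ, E₀).prod 𝓘(ℝ, (imageBundle T σ θ U hUo hxU hU).F)) ∞
      (fun x => TotalSpace.mk' (imageBundle T σ θ U hUo hxU hU).F x
        (imageCoord T σ θ U hUo hxU hU s x)) := by
  intro x₀
  refine (Bundle.contMDiffAt_section x₀).mpr ?_
  have h : ContMDiffAt 𝓘(ℝ, E₀) 𝓘(ℝ, ULift.{v} (Fin r) → ℝ) ∞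
      (fun x => fun a : ULift.{v} (Fin r) => θ x₀ a.down (T s) x) x₀ :=
    contMDiffAt_pi_space.mpr fun a => (θ x₀ a.down (T s)).contMDiff.contMDiffAt
  refine h.congr_of_eventuallyEq (Filter.Eventually.of_forall fun x => ?_)
  change imageCoordChange T σ θ x x₀ x (fun a => θ x a.down (T s) x) = _
  ext ⟨b⟩
  rw [imageCoordChange_apply]
  have h2 := congrArg (fibFun (θ x₀ b) x) ((hU x x (hxU x)).2 s)
  simp only [map_sum, map_smul, fibFun_apply, smul_eq_mul] at h2
  exact (Finset.sum_congr rfl fun _ _ => mul_comm _ _).trans h2.symm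

/-- The map to the image bundle. -/
noncomputable def toImage : V.Sec →ₗ[SmoothFun E₀ M] (imageBundle T σ θ U hUo hxU hU).Sec where
  toFun s := ⟨imageCoord T σ θ U hUo hxU hU s, contMDiff_imageCoord T σ θ U hUo hxU hU s⟩
  map_add' s t := by
    ext x
    funext a
    change θ x a.down (T (s + t)) x = θ x a.down (T s) x + θ x a.down (T t) x
    rw [map_add, map_add]; rfl
  map_smul' f s := by
    ext x
    funext a
    change θ x a.down (T (f • s)) x = f x * θ x a.down (T s) x
    rw [map_smul, map_smul]; rfl

end ImageBundle

/-- All that is kept of the image bundle is a fibrewise surjection with the same kernel as `T`; this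
determines it as a quotient of `V`. -/
theorem exists_image_bundle (T : V.Sec →ₗ[SmoothFun E₀ M] W.Sec) {r : ℕ}
    (hr : ∀ x, Module.finrank ℝ (LinearMap.range (fibMap T x)) = r) :
    ∃ (I : VBundle.{v} E₀ M) (p : V.Sec →ₗ[SmoothFun E₀ M] I.Sec),
      ∀ x, (∀ t : I.Fib x, ∃ s, p s x = t) ∧ ∀ s, p s x = 0 ↔ T s x = 0 := by
  choose σ θ h using fun x₀ => exists_frame_range T hr x₀
  choose U hU hUo hxU using fun x₀ => eventually_nhds_iff.mp (h x₀)
  refine ⟨imageBundle T σ θ U hUo hxU hU, toImage T σ θ U hUo hxU hU, fun x => ⟨fun t => ?_, fun s => ?_⟩⟩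
  · let t' : ULift.{v} (Fin r) → ℝ := t
    refine ⟨∑ a, (algebraMap ℝ (SmoothFun E₀ M) (t' ⟨a⟩)) • σ x a, ?_⟩
    funext a
    change θ x a.down (T (∑ b, (algebraMap ℝ (SmoothFun E₀ M) (t' ⟨b⟩)) • σ x b)) x = t' a
    simp only [map_sum, map_smul, SmoothFun.sum_apply]
    have : ∀ b, ((algebraMap ℝ (SmoothFun E₀ M)) (t' ⟨b⟩) • θ x a.down (T (σ x b))) x =
        t' ⟨b⟩ * if a.down = b then 1 else 0 := fun b => by
      rw [← (hU x x (hxU x)).1 a.down b]; rfl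
    exact (Finset.sum_congr rfl fun b _ => this b).trans (by simp)
  · constructor
    · intro h0
      rw [(hU x x (hxU x)).2 s]
      refine Finset.sum_eq_zero fun a _ => ?_
      have h1 : θ x a (T s) x = 0 := congrFun h0 (ULift.up a)
      rw [h1, zero_smul]
    · intro h0
      funext a
      change θ x a.down (T s) x = 0
      rw [← fibFun_apply, h0, map_zero]

theorem fibMap_comp {X : VBundle E₀ M} (S : W.Sec →ₗ[SmoothFun E₀ M] X.Sec)
    (T : V.Sec →ₗ[SmoothFun E₀ M] W.Sec) (x : M) :
    fibMap (S ∘ₗ T) x = fibMap S x ∘ₗ fibMap T x := by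
  refine LinearMap.ext fun v => ?_
  obtain ⟨s, rfl⟩ := V.exists_sec_eq v
  simp

theorem fibMap_sub (S T : V.Sec →ₗ[SmoothFun E₀ M] W.Sec) (x : M) :
    fibMap (S - T) x = fibMap S x - fibMap T x := by
  refine LinearMap.ext fun v => ?_
  obtain ⟨s, rfl⟩ := V.exists_sec_eq v
  simp only [fibMap_apply, LinearMap.sub_apply]
  rfl

theorem fibMap_id (x : M) : fibMap (LinearMap.id : V.Sec →ₗ[SmoothFun E₀ M] V.Sec) x = LinearMap.id := by
  refine LinearMap.ext fun v => ?_
  obtain ⟨s, rfl⟩ := V.exists_sec_eq v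
  simp

/-- The trace of `T K` is the rank of `T`, if `K` is a generalized inverse of `T`. -/
theorem trace_comp_eq_finrank {X Y : Type*} [AddCommGroup X] [Module ℝ X]
    [AddCommGroup Y] [Module ℝ Y] [FiniteDimensional ℝ Y] {T : X →ₗ[ℝ] Y}
    {K : Y →ₗ[ℝ] X} (h : T ∘ₗ K ∘ₗ T = T) :
    LinearMap.trace ℝ Y (T ∘ₗ K) = Module.finrank ℝ (LinearMap.range T) := by
  have hp : LinearMap.IsProj (LinearMap.range T) (T ∘ₗ K) :=
    ⟨fun y => ⟨K y, rfl⟩, by rintro _ ⟨x, rfl⟩; exact LinearMap.congr_fun h x⟩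
  exact hp.trace

end VBundle

end Splitting

/-! ### Splittings of `∂`, existence of the cohomology bundle, contractions to it -/

section Contractions

set_option linter.unusedSectionVars false

open Filter Topology LieAlgebroid

variable {E₀ : Type*} [NormedAddCommGroup E₀] [NormedSpace ℝ E₀] {M : Type u} [TopologicalSpace M]
  [ChartedSpace E₀ M] [FiniteDimensional ℝ E₀] [IsManifold 𝓘(ℝ, E₀) ∞ M] [T2Space M]
  {𝔄 : LieAlgebroid.{v} E₀ M} {E : ℤ → VBundle.{w} E₀ M}

namespace RepUpToHomotopy

variable (R : RepUpToHomotopy 𝔄 E)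

theorem mem_imAt {n : ℤ} {x : M} {v : (E n).Fib x} :
    v ∈ R.imAt n x ↔ ∃ s, R.del (n - 1) n s x = v := Iff.rfl

theorem apply_mem_imAt {m n : ℤ} (hn : m + 1 = n) (s : (E m).Sec) (x : M) :
    R.del m n s x ∈ R.imAt n x := by
  obtain rfl : m = n - 1 := by omega
  exact R.mem_imAt.mpr ⟨s, rfl⟩

theorem range_fibMap_delLin {m n : ℤ} (hn : m + 1 = n) (x : M) :
    LinearMap.range (VBundle.fibMap (R.delLin m n) x) = R.imAt n x := by
  obtain rfl : m = n - 1 := by omega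
  ext v
  rw [VBundle.range_fibMap]
  exact Iff.rfl

theorem apply_mem_kerAt_iff {n : ℤ} (s : (E n).Sec) (x : M) :
    s x ∈ R.kerAt n x ↔ R.del n (n + 1) s x = 0 := by
  constructor
  · rintro ⟨t, ht, h⟩
    have h1 := VBundle.apply_congr (R.delLin n (n + 1)) (s := t) (t := s) h
    exact h1.symm.trans ht
  · exact fun h => ⟨s, h, rfl⟩

/-- A generalized inverse of `∂`, of square zero. -/
structure Splitting where
  k : ∀ m n : ℤ, (E m).Sec →ₗ[SmoothFun E₀ M] (E n).Sec
  del_k_del : ∀ {m n : ℤ}, m + 1 = n → ∀ s, R.del m n (k n m (R.del m n s)) = R.del m n s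
  k_del_k : ∀ {m n : ℤ}, m + 1 = n → ∀ s, k n m (R.del m n (k n m s)) = k n m s
  k_k : ∀ {l m n : ℤ}, l + 1 = m → m + 1 = n → ∀ s, k m l (k n m s) = 0

/-- A generalized inverse `K` is improved twice: `h = K ∂ K` satisfies `h ∂ h = h`, and `k = h (1 -
h ∂)` has square zero besides. The families run over all pairs of degrees, with the value `0` of `K`
on irrelevant pairs, to avoid casts between degrees. -/
theorem IsRegular.exists_splitting {R : RepUpToHomotopy 𝔄 E} [SecondCountableTopology M]
    (hR : R.IsRegular) : Nonempty R.Splitting := by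
  have hK : ∀ m n : ℤ, ∃ K : (E n).Sec →ₗ[SmoothFun E₀ M] (E m).Sec, m + 1 = n →
      ∀ s, R.del m n (K (R.del m n s)) = R.del m n s := fun m n => by
    by_cases h : m + 1 = n
    · obtain ⟨r, hr⟩ := hR n
      obtain ⟨K, hK⟩ := VBundle.exists_generalized_inverse (R.delLin m n) (r := r) fun x => by
        rw [R.range_fibMap_delLin h]; exact hr x
      exact ⟨K, fun _ => hK⟩
    · exact ⟨0, fun h' => absurd h' h⟩
  choose K hK using hK
  let h : ∀ m n : ℤ, (E n).Sec →ₗ[SmoothFun E₀ M] (E m).Sec := fun m n => K m n ∘ₗ R.delLin m n ∘ₗ K m n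
  have h1 : ∀ {m n : ℤ}, m + 1 = n → ∀ s, R.del m n (h m n (R.del m n s)) = R.del m n s :=
    fun {m n} hn s => by
      change R.del m n (K m n (R.del m n (K m n (R.del m n s)))) = _
      rw [hK m n hn, hK m n hn]
  have h2 : ∀ {m n : ℤ}, m + 1 = n → ∀ s, h m n (R.del m n (h m n s)) = h m n s :=
    fun {m n} hn s => by
      change K m n (R.del m n (K m n (R.del m n (K m n (R.del m n (K m n s)))))) =
        K m n (R.del m n (K m n s))
      rw [hK m n hn, hK m n hn]
  let k : ∀ n m : ℤ, (E n).Sec →ₗ[SmoothFun E₀ M] (E m).Sec := fun n m =>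
    h m n ∘ₗ (LinearMap.id - h n (n + 1) ∘ₗ R.delLin n (n + 1))
  have hk : ∀ n m s, k n m s = h m n (s - h n (n + 1) (R.del n (n + 1) s)) := fun _ _ _ => rfl
  have hkd : ∀ {m n : ℤ}, ∀ s, k n m (R.del m n s) = h m n (R.del m n s) := fun {m n} s => by
    rw [hk, R.del_del rfl, map_zero, sub_zero]
  refine ⟨⟨k, fun hn s => ?_, fun {m n} hn s => ?_, fun {l m n} hm hn s => ?_⟩⟩
  · rw [hkd, h1 hn]
  · rw [hkd, hk, h2 hn]
  -- The values of `k` are of the form `h z`, and `1 - h ∂` kills these because `h ∂ h = h`.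
  · subst hn
    rw [hk m l, hk (m + 1) m, h2 rfl, sub_self, map_zero]

namespace Splitting

variable {R} (σ : R.Splitting)

/-- The projection to a complement of the image of `∂` in its kernel. -/
noncomputable def proj (n : ℤ) : (E n).Sec →ₗ[SmoothFun E₀ M] (E n).Sec :=
  LinearMap.id - R.delLin (n - 1) n ∘ₗ σ.k n (n - 1) - σ.k (n + 1) n ∘ₗ R.delLin n (n + 1)

theorem proj_apply {l m n : ℤ} (hm : l + 1 = m) (hn : m + 1 = n) (s : (E m).Sec) :
    σ.proj m s = s - R.del l m (σ.k m l s) - σ.k n m (R.del m n s) := by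
  obtain rfl : l = m - 1 := by omega
  subst hn
  rfl

theorem proj_del {m n : ℤ} (hn : m + 1 = n) (s : (E m).Sec) : σ.proj n (R.del m n s) = 0 := by
  rw [σ.proj_apply hn rfl, σ.del_k_del hn, R.del_del rfl, map_zero, sub_self, sub_zero]

theorem del_proj {m n : ℤ} (hn : m + 1 = n) (s : (E m).Sec) : R.del m n (σ.proj m s) = 0 := by
  rw [σ.proj_apply (sub_add_cancel m 1) hn, map_sub, map_sub, R.del_del hn, σ.del_k_del hn, sub_zero,
    sub_self]

theorem proj_k {m n : ℤ} (hn : m + 1 = n) (s : (E n).Sec) : σ.proj m (σ.k n m s) = 0 := by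
  rw [σ.proj_apply (sub_add_cancel m 1) hn, σ.k_del_k hn, σ.k_k (sub_add_cancel m 1) hn, map_zero,
    sub_zero, sub_self]

theorem k_proj {m n : ℤ} (hn : m + 1 = n) (s : (E n).Sec) : σ.k n m (σ.proj n s) = 0 := by
  rw [σ.proj_apply hn rfl, map_sub, map_sub, σ.k_del_k hn, σ.k_k hn rfl, sub_zero, sub_self]

theorem proj_proj (n : ℤ) (s : (E n).Sec) : σ.proj n (σ.proj n s) = σ.proj n s := by
  conv_lhs => rw [σ.proj_apply (sub_add_cancel n 1) rfl (σ.proj n s)]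
  rw [σ.k_proj (sub_add_cancel n 1), σ.del_proj rfl, map_zero, map_zero, sub_zero, sub_zero]

theorem proj_apply_eq_zero {n : ℤ} {s : (E n).Sec} {x : M} (hs : s x ∈ R.imAt n x) :
    σ.proj n s x = 0 := by
  obtain ⟨t, ht⟩ := R.mem_imAt.mp hs
  rw [VBundle.apply_congr (σ.proj n) ht.symm, σ.proj_del (sub_add_cancel n 1)]
  rfl

theorem sub_proj_apply_mem {n : ℤ} {s : (E n).Sec} {x : M} (hs : R.del n (n + 1) s x = 0) :
    s x - σ.proj n s x ∈ R.imAt n x := by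
  have h : σ.k (n + 1) n (R.del n (n + 1) s) x = 0 := VBundle.apply_eq_zero _ hs
  have h2 : s x - σ.proj n s x =
      R.del (n - 1) n (σ.k n (n - 1) s) x + σ.k (n + 1) n (R.del n (n + 1) s) x := by
    rw [σ.proj_apply (sub_add_cancel n 1) rfl]
    change s x - (s x - _ - _) = _
    abel
  rw [h2, h, add_zero]
  exact R.apply_mem_imAt (sub_add_cancel n 1) _ x

theorem fibMap_del_k_del {m n : ℤ} (hn : m + 1 = n) (x : M) :
    VBundle.fibMap (R.delLin m n) x ∘ₗ VBundle.fibMap (σ.k n m) x ∘ₗ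
      VBundle.fibMap (R.delLin m n) x = VBundle.fibMap (R.delLin m n) x := by
  rw [← VBundle.fibMap_comp, ← VBundle.fibMap_comp]
  congr 1
  exact LinearMap.ext fun s => σ.del_k_del hn s

/-- The rank of a projector is its trace. The traces of `∂k` and `k∂` are the ranks of the incoming
and the outgoing `∂`, since `T K` is a projector onto the image of `T` and the trace is cyclic.
Constancy of the rank follows. -/
theorem finrank_range_proj {n : ℤ} (x : M) :
    Module.finrank ℝ (LinearMap.range (VBundle.fibMap (σ.proj n) x)) =
      Module.finrank ℝ (E n).F - Module.finrank ℝ (R.imAt n x) -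
        Module.finrank ℝ (R.imAt (n + 1) x) := by
  have he : LinearMap.IsProj (LinearMap.range (VBundle.fibMap (σ.proj n) x))
      (VBundle.fibMap (σ.proj n) x) := by
    refine ⟨fun y => ⟨y, rfl⟩, ?_⟩
    rintro _ ⟨v, rfl⟩
    obtain ⟨s, rfl⟩ := (E n).exists_sec_eq v
    rw [VBundle.fibMap_apply, VBundle.fibMap_apply, σ.proj_proj]
  have h := he.trace
  rw [proj, VBundle.fibMap_sub, VBundle.fibMap_sub, VBundle.fibMap_comp, VBundle.fibMap_comp,
    VBundle.fibMap_id, map_sub, map_sub, LinearMap.trace_id,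
    VBundle.trace_comp_eq_finrank (σ.fibMap_del_k_del (sub_add_cancel n 1) x),
    LinearMap.trace_comp_comm', VBundle.trace_comp_eq_finrank (σ.fibMap_del_k_del rfl x),
    R.range_fibMap_delLin (sub_add_cancel n 1), R.range_fibMap_delLin rfl, VBundle.finrank_fib] at h
  rw [← VBundle.fibMap_id, ← VBundle.fibMap_comp, ← VBundle.fibMap_comp, ← VBundle.fibMap_sub,
    ← VBundle.fibMap_sub] at h
  change _ = (Module.finrank ℝ (LinearMap.range (VBundle.fibMap (σ.proj n) x)) : ℝ) at h
  have h' : Module.finrank ℝ (E n).F =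
      Module.finrank ℝ (LinearMap.range (VBundle.fibMap (σ.proj n) x)) +
        Module.finrank ℝ (R.imAt (n + 1) x) + Module.finrank ℝ (R.imAt n x) := by
    have : (Module.finrank ℝ (E n).F : ℝ) =
      Module.finrank ℝ (LinearMap.range (VBundle.fibMap (σ.proj n) x)) +
        Module.finrank ℝ (R.imAt (n + 1) x) + Module.finrank ℝ (R.imAt n x) := by
      rw [← h]; ring
    exact_mod_cast this
  omega

/-- On `Ker ∂` the projector `proj` has kernel `Im ∂`, and all its values lie in `Ker ∂`; so its
image bundle is the cohomology bundle. -/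
theorem nonempty_cohomologyBundle (σ : R.Splitting) (hR : R.IsRegular) : Nonempty R.CohomologyBundle := by
  have hr : ∀ n, ∃ r, ∀ x, Module.finrank ℝ (LinearMap.range (VBundle.fibMap (σ.proj n) x)) = r :=
    fun n => by
      obtain ⟨r, hr⟩ := hR n
      obtain ⟨r', hr'⟩ := hR (n + 1)
      exact ⟨_, fun x => by rw [σ.finrank_range_proj, hr, hr']⟩
  choose r hr using hr
  choose I p hp using fun n => VBundle.exists_image_bundle (σ.proj n) (hr n)
  refine ⟨{ H := I
            proj := fun n x => VBundle.fibMap (p n) x ∘ₗ (R.kerAt n x).subtype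
            proj_surjective := fun n x t => ?_
            ker_proj := fun n x => ?_
            contMDiff_proj := fun n S hS => ?_ }⟩
  · obtain ⟨s, hs⟩ := (hp n x).1 t
    refine ⟨⟨σ.proj n s x, R.mem_kerAt (σ.del_proj rfl s) x⟩, ?_⟩
    change VBundle.fibMap (p n) x (σ.proj n s x) = t
    rw [VBundle.fibMap_apply, ← hs, ← sub_eq_zero]
    change (p n (σ.proj n s) - p n s) x = 0
    rw [← map_sub, (hp n x).2, map_sub, σ.proj_proj, sub_self]
    rfl
  · ext ⟨v, hv⟩
    obtain ⟨s, rfl⟩ := (E n).exists_sec_eq v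
    rw [LinearMap.mem_ker, Submodule.mem_comap]
    change VBundle.fibMap (p n) x (s x) = 0 ↔ s x ∈ R.imAt n x
    rw [VBundle.fibMap_apply, (hp n x).2]
    refine ⟨fun h => ?_, σ.proj_apply_eq_zero⟩
    have h2 := σ.sub_proj_apply_mem ((R.apply_mem_kerAt_iff s x).mp hv)
    rwa [h, sub_zero] at h2
  · refine (p n S).contMDiff.congr fun x => ?_
    change TotalSpace.mk' _ x (VBundle.fibMap (p n) x (S x)) = _
    rw [VBundle.fibMap_apply]

end Splitting

/-- A contraction of the complex `(E, ∂)` to a graded bundle `H`. -/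
structure Contraction (H : ℤ → VBundle.{w} E₀ M) extends R.Splitting where
  p : ∀ n, (E n).Sec →ₗ[SmoothFun E₀ M] (H n).Sec
  i : ∀ n, (H n).Sec →ₗ[SmoothFun E₀ M] (E n).Sec
  p_i : ∀ n t, p n (i n t) = t
  i_p : ∀ n s, i n (p n s) = toSplitting.proj n s

namespace Contraction

variable {R} {H : ℤ → VBundle.{w} E₀ M} (σ : R.Contraction H)

theorem p_proj (n : ℤ) (s : (E n).Sec) : σ.p n (σ.proj n s) = σ.p n s := by rw [← σ.i_p, σ.p_i]

theorem proj_i (n : ℤ) (t : (H n).Sec) : σ.proj n (σ.i n t) = σ.i n t := by rw [← σ.i_p, σ.p_i]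

theorem p_del {m n : ℤ} (hn : m + 1 = n) (s : (E m).Sec) : σ.p n (R.del m n s) = 0 := by
  rw [← σ.p_proj, σ.proj_del hn, map_zero]

theorem p_k {m n : ℤ} (hn : m + 1 = n) (s : (E n).Sec) : σ.p m (σ.k n m s) = 0 := by
  rw [← σ.p_proj, σ.proj_k hn, map_zero]

theorem del_i {m n : ℤ} (hn : m + 1 = n) (t : (H m).Sec) : R.del m n (σ.i m t) = 0 := by
  rw [← σ.proj_i, σ.del_proj hn]

theorem k_i {m n : ℤ} (hn : m + 1 = n) (t : (H n).Sec) : σ.k n m (σ.i n t) = 0 := by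
  rw [← σ.proj_i, σ.k_proj hn]

end Contraction

theorem CohomologyBundle.proj_eq_of_sub_mem {R : RepUpToHomotopy 𝔄 E} (C : R.CohomologyBundle)
    {n : ℤ} {x : M} (v w : R.kerAt n x) (h : (v : (E n).Fib x) - w ∈ R.imAt n x) :
    C.proj n x v = C.proj n x w := by
  rw [← sub_eq_zero, ← map_sub, ← LinearMap.mem_ker, C.ker_proj]
  exact h

/-- The projection is `s ↦ [proj s]`. The inclusion is `proj` applied to a smooth right inverse of
it. -/
theorem Splitting.exists_contraction {R : RepUpToHomotopy 𝔄 E} [SecondCountableTopology M]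
    (σ : R.Splitting) (C : R.CohomologyBundle) : ∃ τ : R.Contraction C.H,
      ∀ n S (hS : R.del n (n + 1) S = 0), C.cls S hS = τ.p n S := by
  let p : ∀ n, (E n).Sec →ₗ[SmoothFun E₀ M] (C.H n).Sec := fun n =>
    { toFun := fun s => C.cls (σ.proj n s) (σ.del_proj rfl s)
      map_add' := fun s t => by
        ext x
        refine Eq.trans ?_ (map_add (C.proj n x) _ _)
        exact congrArg (C.proj n x) (Subtype.ext (congrArg (fun u : (E n).Sec => u x)
          (map_add (σ.proj n) s t)))
      map_smul' := fun f s => by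
        ext x
        refine Eq.trans ?_ (map_smul (C.proj n x) (f x) _)
        exact congrArg (C.proj n x) (Subtype.ext (congrArg (fun u : (E n).Sec => u x)
          (map_smul (σ.proj n) f s))) }
  have hcls : ∀ n S (hS : R.del n (n + 1) S = 0), C.cls S hS = p n S := fun n S hS => by
    ext x
    exact C.proj_eq_of_sub_mem _ _ (σ.sub_proj_apply_mem (by rw [hS]; rfl))
  have hker : ∀ n (s : (E n).Sec) x, p n s x = 0 → σ.proj n s x = 0 := fun n s x h => by
    have h1 : C.proj n x ⟨σ.proj n s x, R.mem_kerAt (σ.del_proj rfl s) x⟩ = 0 := h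
    rw [← LinearMap.mem_ker, C.ker_proj] at h1
    rw [← σ.proj_proj]
    exact σ.proj_apply_eq_zero h1
  have hsurj : ∀ n x (t : (C.H n).Fib x), ∃ s, p n s x = t := fun n x t => by
    obtain ⟨⟨v, hv⟩, rfl⟩ := C.proj_surjective n x t
    obtain ⟨s, rfl⟩ := (E n).exists_sec_eq v
    refine ⟨s, C.proj_eq_of_sub_mem _ _ ?_⟩
    rw [← neg_sub]
    exact Submodule.neg_mem _ (σ.sub_proj_apply_mem ((R.apply_mem_kerAt_iff s x).mp hv))
  -- `p n` is fibrewise onto, hence of constant rank; surjectivity also turns `p K p = p` into `p K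
  -- = 1`.
  have hK : ∀ n, ∃ K : (C.H n).Sec →ₗ[SmoothFun E₀ M] (E n).Sec, ∀ s, p n (K (p n s)) = p n s :=
    fun n => VBundle.exists_generalized_inverse (p n) (r := Module.finrank ℝ (C.H n).F) fun x => by
      rw [LinearMap.range_eq_top.mpr fun t => ?_, finrank_top, VBundle.finrank_fib]
      obtain ⟨s, hs⟩ := hsurj n x t
      exact ⟨s x, (VBundle.fibMap_apply _ _ _).trans hs⟩
  choose K hK using hK
  have hp_e : ∀ n s, p n (σ.proj n s) = p n s := fun n s => by
    ext x
    change C.proj n x ⟨σ.proj n (σ.proj n s) x, _⟩ = C.proj n x ⟨σ.proj n s x, _⟩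
    congr 2
    rw [σ.proj_proj]
  refine ⟨{ σ with
    p := p
    i := fun n => σ.proj n ∘ₗ K n
    p_i := fun n t => ?_
    i_p := fun n s => ?_ }, hcls⟩
  · change p n (σ.proj n (K n t)) = t
    rw [hp_e]
    ext x
    obtain ⟨s, hs⟩ := hsurj n x (t x)
    have h := VBundle.apply_congr (p n ∘ₗ K n) hs
    rw [← hs]
    refine h.symm.trans ?_
    change p n (K n (p n s)) x = _
    rw [hK]
  · ext x
    change σ.proj n (K n (p n s)) x = σ.proj n s x
    have h1 : p n (K n (p n s) - s) x = 0 := by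
      rw [map_sub, hK, sub_self]; rfl
    have h := hker n _ x h1
    rw [map_sub] at h
    exact sub_eq_zero.mp h

theorem CohomologyBundle.exists_cls_eq {R : RepUpToHomotopy 𝔄 E} (C : R.CohomologyBundle)
    (σ : R.Contraction C.H) (hσ : ∀ n S (hS : R.del n (n + 1) S = 0), C.cls S hS = σ.p n S)
    (n : ℤ) (T : (C.H n).Sec) :
    ∃ (S : (E n).Sec) (hS : R.del n (n + 1) S = 0), C.cls S hS = T :=
  ⟨σ.i n T, σ.del_i rfl T, by rw [hσ, σ.p_i]⟩

end RepUpToHomotopy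

end Contractions

/-! ### Formal homological perturbation -/

section HomologicalPerturbation

/-- The algebraic data of a perturbation of a contraction: `W` is inverse to `D k + k D + i p`. -/
structure PerturbationData (G G' : Type*) [AddCommGroup G] [Module ℝ G] [AddCommGroup G']
    [Module ℝ G'] where
  D : G →ₗ[ℝ] G
  k : G →ₗ[ℝ] G
  W : G →ₗ[ℝ] G
  p : G →ₗ[ℝ] G'
  i : G' →ₗ[ℝ] G
  D_D : ∀ x, D (D x) = 0
  k_k : ∀ x, k (k x) = 0
  p_i : ∀ y, p (i y) = y
  p_k : ∀ x, p (k x) = 0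
  k_i : ∀ y, k (i y) = 0
  apply_W : ∀ x, D (k (W x)) + k (D (W x)) + i (p (W x)) = x
  W_apply : ∀ x, W (D (k x) + k (D x) + i (p x)) = x

namespace PerturbationData

variable {G G' : Type*} [AddCommGroup G] [Module ℝ G] [AddCommGroup G'] [Module ℝ G']
  (P : PerturbationData G G')

/-- The perturbed projection. -/
def p' : G →ₗ[ℝ] G' := P.p ∘ₗ P.W

/-- The perturbed inclusion. -/
def i' : G' →ₗ[ℝ] G := P.W ∘ₗ P.i

/-- The perturbed homotopy. -/
def h' : G →ₗ[ℝ] G := P.k ∘ₗ P.W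

/-- The transferred differential. -/
def D' : G' →ₗ[ℝ] G' := P.p ∘ₗ P.W ∘ₗ P.D ∘ₗ P.i

theorem p'_apply (x : G) : P.p' x = P.p (P.W x) := rfl

theorem i'_apply (y : G') : P.i' y = P.W (P.i y) := rfl

theorem h'_apply (x : G) : P.h' x = P.k (P.W x) := rfl

theorem D'_apply (y : G') : P.D' y = P.p' (P.D (P.i y)) := rfl

/-- `N = Dk + kD + ip` satisfies `kN = kDk = Nk` by the side conditions, so its inverse commutes
with `k` too. -/
theorem W_k (x : G) : P.W (P.k x) = P.k (P.W x) := by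
  have h1 := P.W_apply (P.k (P.W x))
  have h2 := congrArg P.k (P.apply_W x)
  rw [map_add, map_add, P.k_k, P.k_i, add_zero, add_zero] at h2
  rw [P.k_k, map_zero, P.p_k, map_zero, zero_add, add_zero, h2] at h1
  exact h1

theorem p'_k (x : G) : P.p' (P.k x) = 0 := by rw [p'_apply, P.W_k, P.p_k]

theorem k_i' (y : G') : P.k (P.i' y) = 0 := by rw [i'_apply, ← P.W_k, P.k_i, map_zero]

theorem p'_i (y : G') : P.p' (P.i y) = y := by
  have h := congrArg P.p (P.W_apply (P.i y))
  rw [P.k_i, map_zero, zero_add, P.p_i, map_add, map_add, P.W_k, P.p_k, zero_add] at h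
  exact h

theorem p_i' (y : G') : P.p (P.i' y) = y := P.p'_i y

/-- `D² = 0` gives `DN - ND = Dip - ipD`; conjugating by `W` turns this into the commutator of `W`
and `D`. Composed with `p` it shows that `p'` is a chain map, and applied to `i y` that `i'` is one.
-/
theorem W_D (x : G) :
    P.W (P.D x) = P.D (P.W x) - P.i' (P.p (P.D (P.W x))) + P.W (P.D (P.i (P.p' x))) := by
  have h1 := P.W_apply (P.D (P.W x))
  rw [P.D_D, map_zero, add_zero, map_add] at h1
  have h2 := congrArg (fun z => P.W (P.D z)) (P.apply_W x)
  simp only [map_add, P.D_D, zero_add] at h2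
  rw [← h2]
  rw [← eq_sub_iff_add_eq] at h1
  rw [h1]
  rfl

theorem p'_D (x : G) : P.p' (P.D x) = P.D' (P.p' x) := by
  rw [p'_apply, W_D, map_add, map_sub, P.p_i', sub_self, zero_add]
  rfl

theorem D'_D' (y : G') : P.D' (P.D' y) = 0 := by
  rw [P.D'_apply y, ← P.p'_D, P.D_D, map_zero]

theorem i_eq (y : G') : P.i y = P.i' y + P.h' (P.D (P.i y)) := by
  have h := P.W_apply (P.i y)
  rw [P.k_i, map_zero, zero_add, P.p_i, map_add, P.W_k, add_comm] at h
  exact h.symm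

theorem p'_i' (y : G') : P.p' (P.i' y) = y := by
  have h := congrArg P.p' (P.i_eq y)
  rw [map_add, h'_apply, p'_k, add_zero, p'_i] at h
  exact h.symm

theorem D_i' (y : G') : P.D (P.i' y) = P.i' (P.D' y) := by
  have h := P.W_D (P.i y)
  rw [P.p'_i, eq_comm, add_eq_right, sub_eq_zero] at h
  change P.D (P.i' y) = P.i' (P.p (P.D (P.i' y))) at h
  have h2 := congrArg P.p' h
  rw [p'_i', p'_D, p'_i'] at h2
  rw [h, h2]

/-- Moving `W` past `D` in `h' D`, one correction term dies by `k i' = 0`. The other, by `i_eq`,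
accounts for the difference between `i p'` and `i' p'` in `N W = 1`. -/
theorem homotopy (x : G) : P.D (P.h' x) + P.h' (P.D x) = x - P.i' (P.p' x) := by
  have h1 := P.apply_W x
  rw [h'_apply, h'_apply, W_D, map_add, map_sub, P.k_i', sub_zero]
  have h2 := P.i_eq (P.p' x)
  rw [P.p'_apply] at h2
  rw [h2] at h1
  rw [eq_sub_iff_add_eq, P.p'_apply]
  rw [P.h'_apply] at h1
  refine Eq.trans ?_ h1
  abel

end PerturbationData

end HomologicalPerturbation

/-! ### The contraction on forms and the inverse of `D k + k D + i p` -/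

section Transfer

set_option linter.unusedSectionVars false

open Filter Topology LieAlgebroid

variable {E₀ : Type*} [NormedAddCommGroup E₀] [NormedSpace ℝ E₀] {M : Type u} [TopologicalSpace M]
  [ChartedSpace E₀ M] [FiniteDimensional ℝ E₀] [IsManifold 𝓘(ℝ, E₀) ∞ M] [T2Space M]
  {𝔄 : LieAlgebroid.{v} E₀ M} {E H : ℤ → VBundle.{w} E₀ M}

/-- A family of maps `E^n → F^n` as a family of maps `E^m → F^n` that vanish for `m ≠ n`. -/
noncomputable def diagonalFamily {F : ℤ → VBundle.{w} E₀ M} (p : ∀ n, (E n).Sec →ₗ[SmoothFun E₀ M] (F n).Sec) (m n : ℤ) :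
    (E m).Sec →ₗ[SmoothFun E₀ M] (F n).Sec :=
  if h : m = n then by subst h; exact p m else 0

theorem diagonalFamily_self {F : ℤ → VBundle.{w} E₀ M}
    (p : ∀ n, (E n).Sec →ₗ[SmoothFun E₀ M] (F n).Sec) (n : ℤ) : diagonalFamily p n n = p n :=
  dif_pos rfl

namespace RepUpToHomotopy

namespace Contraction

variable {R : RepUpToHomotopy 𝔄 E} (σ : R.Contraction H)

/-- The homotopy on forms. -/
noncomputable def kOp : 𝔄.GForm E →ₗ[ℝ] 𝔄.GForm E := 𝔄.fibOp (-1) (-1) σ.k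

/-- The projection on forms. -/
noncomputable def pOp : 𝔄.GForm E →ₗ[ℝ] 𝔄.GForm H := 𝔄.fibOp 1 0 (diagonalFamily σ.p)

/-- The inclusion on forms. -/
noncomputable def iOp : 𝔄.GForm H →ₗ[ℝ] 𝔄.GForm E := 𝔄.fibOp 1 0 (diagonalFamily σ.i)

theorem component_pOp (i : ℕ) (n : ℤ) (ξ : 𝔄.GForm E) : 𝔄.component H i n (σ.pOp ξ) =
    (σ.p n).compAlternatingMap (𝔄.component E i n ξ) := by
  rw [pOp, component_fibOp (add_zero n), one_pow, one_smul, diagonalFamily_self]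

theorem component_iOp (i : ℕ) (n : ℤ) (ξ : 𝔄.GForm H) : 𝔄.component E i n (σ.iOp ξ) =
    (σ.i n).compAlternatingMap (𝔄.component H i n ξ) := by
  rw [iOp, component_fibOp (add_zero n), one_pow, one_smul, diagonalFamily_self]

theorem component_kOp_apply (i : ℕ) {m n : ℤ} (h : m + 1 = n) (ξ : 𝔄.GForm E) (v : Fin i → 𝔄.A.Sec) :
    𝔄.component E i m (σ.kOp ξ) v = (-1 : ℝ) ^ i • σ.k n m (𝔄.component E i n ξ v) := by
  rw [kOp, component_fibOp (show n + -1 = m by omega)]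
  rfl

theorem component_delOp_apply (i : ℕ) {m n : ℤ} (h : m + 1 = n) (ξ : 𝔄.GForm E) (v : Fin i → 𝔄.A.Sec) :
    𝔄.component E i n (R.delOp ξ) v = (-1 : ℝ) ^ i • R.del m n (𝔄.component E i m ξ v) := by
  rw [delOp, component_fibOp h]
  rfl

theorem pOp_iOp (ξ : 𝔄.GForm H) : σ.pOp (σ.iOp ξ) = ξ := by
  refine gform_ext fun i n => ?_
  rw [component_pOp, component_iOp]
  ext1 v
  exact σ.p_i n _

theorem pOp_kOp (ξ : 𝔄.GForm E) : σ.pOp (σ.kOp ξ) = 0 := by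
  refine gform_ext fun i n => ?_
  rw [component_pOp, map_zero]
  ext1 v
  change σ.p n (𝔄.component E i n (σ.kOp ξ) v) = 0
  rw [σ.component_kOp_apply i rfl, LinearMap.map_smul_of_tower, σ.p_k rfl, smul_zero]

theorem kOp_iOp (ξ : 𝔄.GForm H) : σ.kOp (σ.iOp ξ) = 0 := by
  refine gform_ext fun i n => ?_
  rw [map_zero]
  ext1 v
  rw [σ.component_kOp_apply i rfl, component_iOp]
  change (-1 : ℝ) ^ i • σ.k (n + 1) n (σ.i (n + 1) _) = 0
  rw [σ.k_i rfl, smul_zero]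

theorem delOp_iOp (ξ : 𝔄.GForm H) : R.delOp (σ.iOp ξ) = 0 := by
  refine gform_ext fun i n => ?_
  rw [map_zero]
  ext1 v
  rw [component_delOp_apply i (sub_add_cancel n 1), component_iOp]
  change (-1 : ℝ) ^ i • R.del (n - 1) n (σ.i (n - 1) _) = 0
  rw [σ.del_i (sub_add_cancel n 1), smul_zero]

theorem kOp_kOp (ξ : 𝔄.GForm E) : σ.kOp (σ.kOp ξ) = 0 := by
  refine gform_ext fun i n => ?_
  rw [map_zero]
  ext1 v
  rw [σ.component_kOp_apply i rfl, σ.component_kOp_apply i rfl, LinearMap.map_smul_of_tower,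
    σ.k_k rfl rfl, smul_zero, smul_zero]
  rfl

theorem delOp_kOp (ξ : 𝔄.GForm E) :
    R.delOp (σ.kOp ξ) + σ.kOp (R.delOp ξ) + σ.iOp (σ.pOp ξ) = ξ := by
  refine gform_ext fun i n => ?_
  rw [map_add, map_add, component_iOp, component_pOp]
  ext1 v
  change 𝔄.component E i n (R.delOp (σ.kOp ξ)) v + 𝔄.component E i n (σ.kOp (R.delOp ξ)) v +
    σ.i n (σ.p n (𝔄.component E i n ξ v)) = 𝔄.component E i n ξ v
  have hs : (-1 : ℝ) ^ i * (-1 : ℝ) ^ i = 1 := by rw [← mul_pow]; simp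
  rw [component_delOp_apply i (sub_add_cancel n 1), σ.component_kOp_apply i (sub_add_cancel n 1),
    σ.component_kOp_apply i rfl, component_delOp_apply i rfl, map_smul, LinearMap.map_smul_of_tower,
    smul_smul, smul_smul, hs, one_smul, one_smul, σ.i_p, σ.proj_apply (sub_add_cancel n 1) rfl]
  abel

theorem kOp_mul {k : ℕ} (ψ : 𝔄.ScalarForm k) (ξ : 𝔄.GForm E) :
    σ.kOp (𝔄.mul ψ ξ) = (-1 : ℝ) ^ k • 𝔄.mul ψ (σ.kOp ξ) := fibOp_mul ψ ξ

theorem pOp_mul {k : ℕ} (ψ : 𝔄.ScalarForm k) (ξ : 𝔄.GForm E) :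
    σ.pOp (𝔄.mul ψ ξ) = 𝔄.mul ψ (σ.pOp ξ) := by
  rw [pOp, fibOp_mul, one_pow, one_smul]

theorem iOp_mul {k : ℕ} (ψ : 𝔄.ScalarForm k) (ξ : 𝔄.GForm H) :
    σ.iOp (𝔄.mul ψ ξ) = 𝔄.mul ψ (σ.iOp ξ) := by
  rw [iOp, fibOp_mul, one_pow, one_smul]

/-- The difference `1 - (D k + k D + i p)`, which raises the form degree. -/
noncomputable def defect : Module.End ℝ (𝔄.GForm E) :=
  1 - (R.D ∘ₗ σ.kOp + σ.kOp ∘ₗ R.D + σ.iOp ∘ₗ σ.pOp)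

theorem defect_apply (ξ : 𝔄.GForm E) :
    σ.defect ξ = ξ - (R.D (σ.kOp ξ) + σ.kOp (R.D ξ) + σ.iOp (σ.pOp ξ)) := rfl

/-- In `Dk + kD` the signs of the two odd operators cancel, and the two terms with `d_A(ψ)` cancel
each other. Hence the transfer is `Ω(A)`-linear. -/
theorem defect_mul {k : ℕ} (ψ : 𝔄.ScalarForm k) (ξ : 𝔄.GForm E) :
    σ.defect (𝔄.mul ψ ξ) = 𝔄.mul ψ (σ.defect ξ) := by
  have hs : (-1 : ℝ) ^ k * (-1 : ℝ) ^ k = 1 := by rw [← mul_pow]; simp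
  simp only [defect_apply, kOp_mul, pOp_mul, iOp_mul, R.derivation, map_add, map_sub, map_smul,
    smul_add, smul_smul, hs, one_smul, pow_succ, mul_neg, mul_one, neg_smul]
  abel

/-- Replacing `1` by `∂k + k∂ + ip` leaves `-(D - ∂)k - k(D - ∂)`, and `D - ∂` raises the form
degree. -/
theorem defect_mem_formFiltration {p : ℤ} {ξ : 𝔄.GForm E} (h : ξ ∈ 𝔄.formFiltration E p) :
    σ.defect ξ ∈ 𝔄.formFiltration E (p + 1) := by
  have h1 : σ.defect ξ = -(R.D (σ.kOp ξ) - R.delOp (σ.kOp ξ)) - σ.kOp (R.D ξ - R.delOp ξ) := by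
    conv_lhs => rw [defect_apply]; enter [1]; rw [← σ.delOp_kOp ξ]
    rw [map_sub]
    abel
  rw [h1]
  exact Submodule.sub_mem _ (Submodule.neg_mem _ (R.D_sub_delOp_mem (fibOp_mem_formFiltration h)))
    (fibOp_mem_formFiltration (R.D_sub_delOp_mem h))

theorem kOp_mem_totalDegree {m n : ℤ} (hn : m + 1 = n) {ξ : 𝔄.GForm E}
    (h : ξ ∈ 𝔄.totalDegree E n) : σ.kOp ξ ∈ 𝔄.totalDegree E m :=
  fibOp_mem_totalDegree (by omega) h

theorem pOp_mem_totalDegree {n : ℤ} {ξ : 𝔄.GForm E} (h : ξ ∈ 𝔄.totalDegree E n) :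
    σ.pOp ξ ∈ 𝔄.totalDegree H n :=
  fibOp_mem_totalDegree (add_zero n) h

theorem iOp_mem_totalDegree {n : ℤ} {ξ : 𝔄.GForm H} (h : ξ ∈ 𝔄.totalDegree H n) :
    σ.iOp ξ ∈ 𝔄.totalDegree E n :=
  fibOp_mem_totalDegree (add_zero n) h

theorem defect_mem_totalDegree {n : ℤ} {ξ : 𝔄.GForm E} (h : ξ ∈ 𝔄.totalDegree E n) :
    σ.defect ξ ∈ 𝔄.totalDegree E n := by
  refine Submodule.sub_mem _ h (Submodule.add_mem _ (Submodule.add_mem _ ?_ ?_) ?_)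
  · have := R.map_totalDegree (n - 1) _ (σ.kOp_mem_totalDegree (sub_add_cancel n 1) h)
    rwa [sub_add_cancel] at this
  · exact σ.kOp_mem_totalDegree rfl (R.map_totalDegree n _ h)
  · exact σ.iOp_mem_totalDegree (σ.pOp_mem_totalDegree h)

theorem defect_pow_mem_formFiltration {p : ℤ} {ξ : 𝔄.GForm E} (h : ξ ∈ 𝔄.formFiltration E p)
    (m : ℕ) : (σ.defect ^ m) ξ ∈ 𝔄.formFiltration E (p + m) := by
  induction m with
  | zero => simpa using h
  | succ m ih =>
    rw [pow_succ', Module.End.mul_apply]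
    have := σ.defect_mem_formFiltration ih
    rw [Nat.cast_succ, ← add_assoc]
    exact this

theorem defect_pow_eq_zero : σ.defect ^ (Module.finrank ℝ 𝔄.A.F + 1) = 0 := by
  refine LinearMap.ext fun ξ => ?_
  have h := σ.defect_pow_mem_formFiltration (p := 0) (ξ := ξ)
    (by rw [formFiltration_eq_top le_rfl]; trivial) (Module.finrank ℝ 𝔄.A.F + 1)
  rw [formFiltration_eq_bot (by push_cast; omega)] at h
  exact h

/-- The inverse of `D k + k D + i p`. -/
noncomputable def inv : Module.End ℝ (𝔄.GForm E) :=
  ∑ m ∈ Finset.range (Module.finrank ℝ 𝔄.A.F + 1), σ.defect ^ m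

theorem inv_apply (ξ : 𝔄.GForm E) :
    σ.inv ξ = ∑ m ∈ Finset.range (Module.finrank ℝ 𝔄.A.F + 1), (σ.defect ^ m) ξ :=
  LinearMap.sum_apply _ _ _

theorem inv_mul {k : ℕ} (ψ : 𝔄.ScalarForm k) (ξ : 𝔄.GForm E) :
    σ.inv (𝔄.mul ψ ξ) = 𝔄.mul ψ (σ.inv ξ) := by
  rw [inv_apply, inv_apply, map_sum]
  refine Finset.sum_congr rfl fun m hm => ?_
  clear hm
  induction m with
  | zero => rfl
  | succ m ih => rw [pow_succ', Module.End.mul_apply, Module.End.mul_apply, ih, defect_mul]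

theorem inv_mem_formFiltration {p : ℤ} {ξ : 𝔄.GForm E} (h : ξ ∈ 𝔄.formFiltration E p) :
    σ.inv ξ ∈ 𝔄.formFiltration E p := by
  rw [inv_apply]
  exact Submodule.sum_mem _ fun m _ =>
    formFiltration_antitone (by simp) (σ.defect_pow_mem_formFiltration h m)

theorem inv_sub_mem_formFiltration {p : ℤ} {ξ : 𝔄.GForm E} (h : ξ ∈ 𝔄.formFiltration E p) :
    σ.inv ξ - ξ ∈ 𝔄.formFiltration E (p + 1) := by
  rw [inv_apply, Finset.sum_range_succ', pow_zero, Module.End.one_apply, add_sub_cancel_right]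
  exact Submodule.sum_mem _ fun m _ =>
    formFiltration_antitone (by push_cast; omega) (σ.defect_pow_mem_formFiltration h (m + 1))

theorem inv_mem_totalDegree {n : ℤ} {ξ : 𝔄.GForm E} (h : ξ ∈ 𝔄.totalDegree E n) :
    σ.inv ξ ∈ 𝔄.totalDegree E n := by
  rw [inv_apply]
  refine Submodule.sum_mem _ fun m hm => ?_
  clear hm
  induction m with
  | zero => exact h
  | succ m ih =>
    rw [pow_succ', Module.End.mul_apply]
    exact σ.defect_mem_totalDegree ih

/-- The perturbation of the contraction by the higher components of `D`. -/
noncomputable def perturbation : PerturbationData (𝔄.GForm E) (𝔄.GForm H) where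
  D := R.D
  k := σ.kOp
  W := σ.inv
  p := σ.pOp
  i := σ.iOp
  D_D := R.sq_zero
  k_k := σ.kOp_kOp
  p_i := σ.pOp_iOp
  p_k := σ.pOp_kOp
  k_i := σ.kOp_iOp
  apply_W ξ := by
    have h := mul_neg_geom_sum σ.defect (Module.finrank ℝ 𝔄.A.F + 1)
    rw [σ.defect_pow_eq_zero, sub_zero] at h
    have h2 := LinearMap.congr_fun h ξ
    rw [defect, sub_sub_cancel] at h2
    exact h2
  W_apply ξ := by
    have h := geom_sum_mul_neg σ.defect (Module.finrank ℝ 𝔄.A.F + 1)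
    rw [σ.defect_pow_eq_zero, sub_zero] at h
    have h2 := LinearMap.congr_fun h ξ
    conv at h2 => enter [1, 1, 2]; rw [defect, sub_sub_cancel]
    exact h2

end Contraction

end RepUpToHomotopy

end Transfer

/-! ### The representation up to homotopy on the cohomology and its cohomology -/

section TransferredStructure

set_option linter.unusedSectionVars false

open Filter Topology LieAlgebroid

variable {E₀ : Type*} [NormedAddCommGroup E₀] [NormedSpace ℝ E₀] {M : Type u} [TopologicalSpace M]
  [ChartedSpace E₀ M] [FiniteDimensional ℝ E₀] [IsManifold 𝓘(ℝ, E₀) ∞ M] [T2Space M]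
  {𝔄 : LieAlgebroid.{v} E₀ M} {E H : ℤ → VBundle.{w} E₀ M}

namespace RepUpToHomotopy

namespace Contraction

variable {R : RepUpToHomotopy 𝔄 E} (σ : R.Contraction H)

theorem p'_mul {k : ℕ} (ψ : 𝔄.ScalarForm k) (ξ : 𝔄.GForm E) :
    σ.perturbation.p' (𝔄.mul ψ ξ) = 𝔄.mul ψ (σ.perturbation.p' ξ) := by
  change σ.pOp (σ.inv (𝔄.mul ψ ξ)) = 𝔄.mul ψ (σ.pOp (σ.inv ξ))
  rw [inv_mul, pOp_mul]

theorem p'_mem_formFiltration {p : ℤ} {ξ : 𝔄.GForm E} (h : ξ ∈ 𝔄.formFiltration E p) :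
    σ.perturbation.p' ξ ∈ 𝔄.formFiltration H p :=
  fibOp_mem_formFiltration (σ.inv_mem_formFiltration h)

theorem i'_mem_formFiltration {p : ℤ} {ξ : 𝔄.GForm H} (h : ξ ∈ 𝔄.formFiltration H p) :
    σ.perturbation.i' ξ ∈ 𝔄.formFiltration E p :=
  σ.inv_mem_formFiltration (fibOp_mem_formFiltration h)

theorem p'_mem_totalDegree {n : ℤ} {ξ : 𝔄.GForm E} (h : ξ ∈ 𝔄.totalDegree E n) :
    σ.perturbation.p' ξ ∈ 𝔄.totalDegree H n :=
  σ.pOp_mem_totalDegree (σ.inv_mem_totalDegree h)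

theorem i'_mem_totalDegree {n : ℤ} {ξ : 𝔄.GForm H} (h : ξ ∈ 𝔄.totalDegree H n) :
    σ.perturbation.i' ξ ∈ 𝔄.totalDegree E n :=
  σ.inv_mem_totalDegree (σ.iOp_mem_totalDegree h)

theorem h'_mem_totalDegree {m n : ℤ} (hn : m + 1 = n) {ξ : 𝔄.GForm E} (h : ξ ∈ 𝔄.totalDegree E n) :
    σ.perturbation.h' ξ ∈ 𝔄.totalDegree E m :=
  σ.kOp_mem_totalDegree hn (σ.inv_mem_totalDegree h)

theorem p'_sub_pOp_mem_formFiltration {p : ℤ} {ξ : 𝔄.GForm E} (h : ξ ∈ 𝔄.formFiltration E p) :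
    σ.perturbation.p' ξ - σ.pOp ξ ∈ 𝔄.formFiltration H (p + 1) := by
  change σ.pOp (σ.inv ξ) - σ.pOp ξ ∈ _
  rw [← map_sub]
  exact fibOp_mem_formFiltration (σ.inv_sub_mem_formFiltration h)

/-- The representation up to homotopy transferred to `H`. -/
noncomputable def transfer : RepUpToHomotopy 𝔄 H where
  D := σ.perturbation.D'
  map_totalDegree n _ h :=
    σ.p'_mem_totalDegree (R.map_totalDegree n _ (σ.iOp_mem_totalDegree h))
  sq_zero := σ.perturbation.D'_D'
  derivation ψ ξ := by
    have h : ∀ ζ, σ.perturbation.D' ζ = σ.perturbation.p' (R.D (σ.iOp ζ)) := fun _ => rfl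
    rw [h, h, iOp_mul, R.derivation, map_add, map_smul, p'_mul, p'_mul]
    congr 2
    -- The term with `d_A(ψ)` becomes `d_A(ψ) p'(i ξ)`, so the derivation rule needs exactly `p' i =
    -- 1`.
    exact σ.perturbation.p'_i ξ

/-- The part `∂` of `D` vanishes on the image of `i`. -/
theorem D_iOp_mem_formFiltration {p : ℤ} {ξ : 𝔄.GForm H} (h : ξ ∈ 𝔄.formFiltration H p) :
    R.D (σ.iOp ξ) ∈ 𝔄.formFiltration E (p + 1) := by
  have h1 := R.D_sub_delOp_mem (ξ := σ.iOp ξ) (fibOp_mem_formFiltration h)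
  rwa [σ.delOp_iOp, sub_zero] at h1

theorem transfer_del (m n : ℤ) (t : (H m).Sec) : σ.transfer.del m n t = 0 := by
  have h : σ.transfer.D (𝔄.ofSec m t) ∈ 𝔄.formFiltration H (0 + 1) :=
    σ.p'_mem_formFiltration (σ.D_iOp_mem_formFiltration (by rw [formFiltration_eq_top le_rfl]; trivial))
  change 𝔄.component H 0 n (σ.transfer.D (𝔄.ofSec m t)) Fin.elim0 = 0
  rw [mem_formFiltration.mp h 0 n (by simp)]
  rfl

theorem iOp_ofSec (n : ℤ) (t : (H n).Sec) : σ.iOp (𝔄.ofSec n t) = 𝔄.ofSec n (σ.i n t) := by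
  rw [iOp, fibOp_ofSec (add_zero n), diagonalFamily_self]

theorem pOp_ofSec (n : ℤ) (s : (E n).Sec) : σ.pOp (𝔄.ofSec n s) = 𝔄.ofSec n (σ.p n s) := by
  rw [pOp, fibOp_ofSec (add_zero n), diagonalFamily_self]

/-- `D i` of a section starts in form degree one, and `p'` agrees with `p` up to higher form degree;
so only `p ∇ i` is left in degree one. -/
theorem transfer_nabla (n : ℤ) (α : 𝔄.A.Sec) (t : (H n).Sec) :
    σ.transfer.nabla n α t = σ.p n (R.nabla n α (σ.i n t)) := by
  have h1 := σ.D_iOp_mem_formFiltration (p := 0) (ξ := 𝔄.ofSec n t)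
    (by rw [formFiltration_eq_top le_rfl]; trivial)
  have h2 := mem_formFiltration.mp (σ.p'_sub_pOp_mem_formFiltration h1) 1 n (by norm_num)
  rw [map_sub, sub_eq_zero, component_pOp, iOp_ofSec] at h2
  change 𝔄.component H 1 n (σ.perturbation.p' (R.D (σ.iOp (𝔄.ofSec n t)))) (fun _ => α) = _
  rw [iOp_ofSec, h2]
  rfl

/-- For `∂s = 0`, `i p s` differs from `s` by `∂ks`. As `∇` commutes with `∂` and `p∂ = 0`, the
difference disappears in the class. -/
theorem transfer_nabla_p (n : ℤ) (α : 𝔄.A.Sec) {s : (E n).Sec} (hs : R.del n (n + 1) s = 0) :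
    σ.transfer.nabla n α (σ.p n s) = σ.p n (R.nabla n α s) := by
  have h : R.nabla n α (σ.i n (σ.p n s)) =
      R.nabla n α s - R.del (n - 1) n (R.nabla (n - 1) α (σ.k n (n - 1) s)) := by
    rw [σ.i_p, σ.proj_apply (sub_add_cancel n 1) rfl, hs, map_zero, sub_zero, R.del_nabla
      (sub_add_cancel n 1), ← conn_nabla, map_sub]
    rfl
  rw [transfer_nabla, h, map_sub, σ.p_del (sub_add_cancel n 1), sub_zero]

/-- The projection as a morphism to the transferred representation up to homotopy. -/
noncomputable def toTransfer : RepMorphism R σ.transfer where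
  Φ := σ.perturbation.p'
  map_totalDegree _ _ h := σ.p'_mem_totalDegree h
  map_mul := σ.p'_mul
  comm := σ.perturbation.p'_D

theorem toTransfer_comp₀ (n : ℤ) (s : (E n).Sec) : σ.toTransfer.comp₀ n s = σ.p n s := by
  have h := mem_formFiltration.mp (σ.p'_sub_pOp_mem_formFiltration (p := 0) (ξ := 𝔄.ofSec n s)
    (by rw [formFiltration_eq_top le_rfl]; trivial)) 0 n (by simp)
  rw [map_sub, sub_eq_zero, pOp_ofSec] at h
  change 𝔄.component H 0 n (σ.perturbation.p' (𝔄.ofSec n s)) Fin.elim0 = _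
  rw [h]
  exact toSec_ofSec_self n _

/-- The target has zero differential. If `p s` vanishes at `x`, so does `proj s = i p s`, and a
vector of `Ker ∂` killed by `proj` lies in `Im ∂`; surjectivity is `p i = 1`. -/
theorem toTransfer_isQuasiIso : σ.toTransfer.IsQuasiIso := by
  refine fun n x => ⟨fun s hs hp => ?_, fun t _ => ⟨σ.i n t, ?_, ?_⟩⟩
  · obtain ⟨t, ht⟩ := (mem_imAt _).mp hp
    rw [σ.transfer_del, toTransfer_comp₀] at ht
    have h1 : σ.proj n s x = 0 := by
      rw [← σ.i_p]
      exact VBundle.apply_eq_zero _ ht.symm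
    have h2 := σ.sub_proj_apply_mem ((R.apply_mem_kerAt_iff s x).mp hs)
    rwa [h1, sub_zero] at h2
  · exact R.mem_kerAt (σ.del_i rfl t) x
  · rw [toTransfer_comp₀, σ.p_i, sub_self]
    exact Submodule.zero_mem _

end Contraction

/-- The complex of `R`, filtered by the form degree. -/
noncomputable def filteredComplex (R : RepUpToHomotopy 𝔄 E) : FilteredComplex (𝔄.GForm E) where
  D := R.D
  T := 𝔄.totalDegree E
  F := 𝔄.formFiltration E
  D_D := R.sq_zero
  D_T := R.map_totalDegree
  antitone_F := formFiltration_antitone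

theorem filteredComplex_converges (R : RepUpToHomotopy 𝔄 E) :
    SpectralConverges R.filteredComplex.spectralSequence R.Cohomology R.cohomologyFiltration :=
  R.filteredComplex.converges (a := 0) (b := Module.finrank ℝ 𝔄.A.F + 1)
    (formFiltration_eq_top le_rfl) (formFiltration_eq_bot (by omega))

theorem mkQ_mem_cohomologyFiltration (R : RepUpToHomotopy 𝔄 E) {p n : ℤ} {z : R.cocycles n} :
    Submodule.mkQ _ z ∈ R.cohomologyFiltration p n ↔
      ∃ y ∈ 𝔄.totalDegree E (n - 1), (z : 𝔄.GForm E) - R.D y ∈ 𝔄.formFiltration E p :=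
  FilteredComplex.mem_Fil (K := R.filteredComplex)

namespace Contraction

variable {R : RepUpToHomotopy 𝔄 E} (σ : R.Contraction H)

/-- The map to the cohomology of the transferred representation, on cocycles. -/
noncomputable def cocyclesMap (n : ℤ) : R.cocycles n →ₗ[ℝ] σ.transfer.cocycles n :=
  σ.perturbation.p'.restrict fun z hz => ⟨by
    have h1 : R.D z = 0 := hz.1
    change σ.perturbation.D' (σ.perturbation.p' z) = 0
    rw [← PerturbationData.p'_D]
    change σ.perturbation.p' (R.D z) = 0
    rw [h1, map_zero], σ.p'_mem_totalDegree hz.2⟩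

theorem eq_add_D {n : ℤ} (z : R.cocycles n) :
    (z : 𝔄.GForm E) = σ.perturbation.i' (σ.perturbation.p' z) + R.D (σ.perturbation.h' z) := by
  have h := σ.perturbation.homotopy z
  have h1 : σ.perturbation.D z = 0 := z.2.1
  rw [h1, map_zero, add_zero] at h
  rw [show R.D (σ.perturbation.h' z) = _ from h]
  abel

/-- The isomorphism from the cohomology of `R` to the cohomology of the transferred
representation. -/
noncomputable def cohomologyEquiv (n : ℤ) : R.Cohomology n ≃ₗ[ℝ] σ.transfer.Cohomology n :=
  quotEquivOfSurjective (Submodule.mkQ _ ∘ₗ σ.cocyclesMap n) (by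
    intro x
    obtain ⟨⟨y, hy⟩, rfl⟩ := Submodule.mkQ_surjective _ x
    have hy' : σ.perturbation.D' y = 0 := hy.1
    refine ⟨⟨σ.perturbation.i' y, ?_, σ.i'_mem_totalDegree hy.2⟩, ?_⟩
    · change σ.perturbation.D (σ.perturbation.i' y) = 0
      rw [PerturbationData.D_i', hy', map_zero]
    · refine congrArg (Submodule.mkQ _) (Subtype.ext ?_)
      exact σ.perturbation.p'_i' y) _ (by
    intro z
    refine (Submodule.Quotient.mk_eq_zero _).trans ?_
    constructor
    · rintro ⟨y, hy, h⟩
      have h' : σ.perturbation.D' y = σ.perturbation.p' z := h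
      -- If `p' z = D' y`, the homotopy writes `z` as `i' D' y + D h' z = D (i' y + h' z)`.
      refine ⟨σ.perturbation.i' y + σ.perturbation.h' z, Submodule.add_mem _
        (σ.i'_mem_totalDegree hy) (σ.h'_mem_totalDegree (sub_add_cancel n 1) z.2.2), ?_⟩
      have h1 := σ.eq_add_D z
      rw [← h', ← PerturbationData.D_i'] at h1
      exact (map_add R.D _ _).trans h1.symm
    · rintro ⟨y, hy, h⟩
      have h' : R.D y = z := h
      refine ⟨σ.perturbation.p' y, σ.p'_mem_totalDegree hy, ?_⟩
      change σ.perturbation.D' (σ.perturbation.p' y) = σ.perturbation.p' z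
      rw [← PerturbationData.p'_D, ← h']
      rfl)

/-- `p'` and `i'` preserve the form filtration, which gives the two inclusions. The homotopy changes
a cocycle by a coboundary only, so no filtration estimate for `h'` is needed. -/
theorem cohomologyFiltration_eq_comap (p n : ℤ) : R.cohomologyFiltration p n =
    (σ.transfer.cohomologyFiltration p n).comap (σ.cohomologyEquiv n).toLinearMap := by
  ext x
  obtain ⟨z, rfl⟩ := Submodule.mkQ_surjective _ x
  rw [Submodule.mem_comap]
  change _ ↔ Submodule.mkQ _ (σ.cocyclesMap n z) ∈ _
  rw [mkQ_mem_cohomologyFiltration, mkQ_mem_cohomologyFiltration]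
  constructor
  · rintro ⟨y, hy, h⟩
    refine ⟨σ.perturbation.p' y, σ.p'_mem_totalDegree hy, ?_⟩
    have h1 : σ.transfer.D (σ.perturbation.p' y) = σ.perturbation.p' (R.D y) :=
      (σ.perturbation.p'_D y).symm
    change σ.perturbation.p' z - _ ∈ _
    rw [h1, ← map_sub]
    exact σ.p'_mem_formFiltration h
  · rintro ⟨y, hy, h⟩
    refine ⟨σ.perturbation.i' y + σ.perturbation.h' z, Submodule.add_mem _
        (σ.i'_mem_totalDegree hy) (σ.h'_mem_totalDegree (sub_add_cancel n 1) z.2.2), ?_⟩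
    have h1 : R.D (σ.perturbation.i' y) = σ.perturbation.i' (σ.transfer.D y) :=
      σ.perturbation.D_i' y
    have h2 : (z : 𝔄.GForm E) - R.D (σ.perturbation.i' y + σ.perturbation.h' z) =
        σ.perturbation.i' (σ.cocyclesMap n z - σ.transfer.D y) := by
      rw [map_add, h1, map_sub]
      change _ = σ.perturbation.i' (σ.perturbation.p' z) - _
      conv_lhs => enter [1]; rw [σ.eq_add_D z]
      abel
    rw [h2]
    exact σ.i'_mem_formFiltration h

theorem spectralConverges : SpectralConverges σ.transfer.filteredComplex.spectralSequence
    R.Cohomology R.cohomologyFiltration :=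
  σ.transfer.filteredComplex_converges.congr σ.cohomologyEquiv σ.cohomologyFiltration_eq_comap

end Contraction

end RepUpToHomotopy

end TransferredStructure

/-! ### The second page when `∂ = 0` -/

section SecondPage

set_option linter.unusedSectionVars false

open Filter Topology LieAlgebroid CategoryTheory

variable {E₀ : Type*} [NormedAddCommGroup E₀] [NormedSpace ℝ E₀] {M : Type u} [TopologicalSpace M]
  [ChartedSpace E₀ M] [FiniteDimensional ℝ E₀] [IsManifold 𝓘(ℝ, E₀) ∞ M] [T2Space M]
  {𝔄 : LieAlgebroid.{v} E₀ M} {E : ℤ → VBundle.{w} E₀ M}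

/-- In total degree `p + q` the only component of form degree `p` is the one in bidegree `(p, q)`.
-/
theorem LieAlgebroid.mem_formFiltration_succ {p : ℕ} {q p' : ℤ} (hp' : p' = p + 1)
    {z : 𝔄.GForm E} (hF : z ∈ 𝔄.formFiltration E p)
    (hT : z ∈ 𝔄.totalDegree E (p + q)) (h0 : 𝔄.component E p q z = 0) :
    z ∈ 𝔄.formFiltration E p' := by
  refine mem_formFiltration.mpr fun i j hi => ?_
  by_cases hip : (i : ℤ) < p
  · exact mem_formFiltration.mp hF i j hip
  · obtain rfl : i = p := by omega
    by_cases hj : j = q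
    · rw [hj, h0]
    · exact mem_totalDegree.mp hT i j (by omega)

namespace RepUpToHomotopy

variable (R : RepUpToHomotopy 𝔄 E)

/-- For `p < 0` both `F p` and `F (p + 1)` are everything, so each element already lies in the
submodule divided out. -/
theorem isZero_page_two_of_neg {p q : ℤ} (hp : p < 0) :
    Limits.IsZero ((R.filteredComplex.page 2).X (p, q)) := by
  have : Subsingleton (R.filteredComplex.PageX 2 (p, q)) := by
    refine subsingleton_of_forall_eq 0 fun x => ?_
    obtain ⟨z, rfl⟩ := FilteredComplex.pageMk_surjective 2 (p, q) x
    refine (FilteredComplex.pageMk_eq_zero z).mpr (FilteredComplex.mem_Bs.mpr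
      ⟨z, ⟨⟨?_, z.2.1.2⟩, ?_⟩, 0, Submodule.zero_mem _, by simp⟩)
    · change (z : 𝔄.GForm E) ∈ 𝔄.formFiltration E (p + 1)
      rw [formFiltration_eq_top (by omega)]
      trivial
    · have h := z.2.2
      rwa [show p + 2 = p + 1 + (2 - 1) by ring] at h
  exact @ModuleCat.isZero_of_subsingleton _ _ _ this

variable {R}

theorem component_succ_D (h0 : ∀ m n s, R.del m n s = 0) {p : ℕ} (q : ℤ) {z : 𝔄.GForm E}
    (hz : z ∈ 𝔄.formFiltration E p) :
    𝔄.component E (p + 1) q (R.D z) = (R.conn q).d p (𝔄.component E p q z) := by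
  rw [R.component_succ_D_of_mem (sub_add_cancel q 1) hz]
  have h : (R.delLin (q - 1) q).compAlternatingMap (𝔄.component E (p + 1) (q - 1) z) = 0 := by
    ext1 v
    exact h0 _ _ _
  rw [h, smul_zero, add_zero]

theorem D_mem_formFiltration_succ (h0 : ∀ m n s, R.del m n s = 0) {p p' : ℤ} (hp' : p' = p + 1)
    {z : 𝔄.GForm E} (hz : z ∈ 𝔄.formFiltration E p) : R.D z ∈ 𝔄.formFiltration E p' := by
  subst hp'
  have h := R.D_sub_delOp_mem hz
  have h1 : R.delOp z = 0 := by
    refine gform_ext fun i n => ?_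
    rw [map_zero, delOp, component_fibOp (sub_add_cancel n 1)]
    ext1 v
    change (-1 : ℝ) ^ i • R.del (n - 1) n _ = 0
    rw [h0, smul_zero]
  rwa [h1, sub_zero] at h

/-- With `∂ = 0`, the leading term of `D z` is `d_∇` of the leading component of `z`; if it
vanishes, `D z` lies one step deeper. -/
theorem D_mem_of_component (h0 : ∀ m n s, R.del m n s = 0) {p : ℕ} {q : ℤ} {z : 𝔄.GForm E}
    (hF : z ∈ 𝔄.formFiltration E p) (hT : z ∈ 𝔄.totalDegree E (p + q))
    (hd : (R.conn q).d p (𝔄.component E p q z) = 0) : R.D z ∈ 𝔄.formFiltration E (p + 2) := by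
  refine LieAlgebroid.mem_formFiltration_succ (p := p + 1) (q := q) (by push_cast; ring)
    (D_mem_formFiltration_succ h0 (by push_cast; ring) hF) ?_ ?_
  · have h := R.map_totalDegree _ _ hT
    rwa [show (p : ℤ) + q + 1 = ((p + 1 : ℕ) : ℤ) + q by push_cast; ring] at h
  · rw [component_succ_D h0 q hF, hd]

/-- The leading component of an element of the second page. -/
noncomputable def leadingComponent (h0 : ∀ m n s, R.del m n s = 0) (p : ℕ) (q : ℤ) :
    R.filteredComplex.Zs 2 p (p + q) →ₗ[ℝ] LinearMap.ker ((R.conn q).d p) :=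
  LinearMap.codRestrict _ (𝔄.component E p q ∘ₗ (R.filteredComplex.Zs 2 p (p + q)).subtype)
    fun z => by
      have h2 : R.D z ∈ 𝔄.formFiltration E (p + 2) := z.2.2
      change (R.conn q).d p (𝔄.component E p q z) = 0
      rw [← component_succ_D h0 q z.2.1.1]
      exact mem_formFiltration.mp h2 _ _ (by push_cast; omega)

theorem leadingComponent_surjective (h0 : ∀ m n s, R.del m n s = 0) (p : ℕ) (q : ℤ) :
    Function.Surjective (leadingComponent h0 p q) := by
  rintro ⟨η, hη⟩
  have hF : 𝔄.inclusion E p q η ∈ 𝔄.formFiltration E p := inclusion_mem_formFiltration le_rfl q η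
  refine ⟨⟨𝔄.inclusion E p q η, ⟨hF, inclusion_mem_totalDegree p q η⟩,
    D_mem_of_component h0 hF (inclusion_mem_totalDegree p q η) ?_⟩,
    Subtype.ext (component_inclusion_self p q η)⟩
  rw [component_inclusion_self]
  exact hη

theorem leadingComponent_mem_coboundaries (h0 : ∀ m n s, R.del m n s = 0) (p : ℕ) (q : ℤ)
    (z : R.filteredComplex.Zs 2 p (p + q)) :
    (leadingComponent h0 p q z : 𝔄.Form (E q) p) ∈ (R.conn q).coboundaries p ↔
      (z : 𝔄.GForm E) ∈ R.filteredComplex.Bs 2 p (p + q) := by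
  change 𝔄.component E p q z ∈ _ ↔ _
  rw [FilteredComplex.mem_Bs]
  have hzF : (z : 𝔄.GForm E) ∈ 𝔄.formFiltration E p := z.2.1.1
  have hzT : (z : 𝔄.GForm E) ∈ 𝔄.totalDegree E (p + q) := z.2.1.2
  have hzD : R.D z ∈ 𝔄.formFiltration E (p + 2) := z.2.2
  constructor
  · intro h
    -- A primitive `θ` of the leading component, taken as an element of form degree `p - 1`, serves
    -- as `y`; then `z - D y` has no component of form degree `p`. For `p = 0` the coboundaries are
    -- zero and `y = 0` works.
    have key : ∃ y ∈ R.filteredComplex.Zs (2 - 1) (p - 2 + 1) (p + q - 1),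
        𝔄.component E p q z = 𝔄.component E p q (R.D y) := by
      cases p with
      | zero => exact ⟨0, Submodule.zero_mem _, by
          rw [map_zero, map_zero]; exact (Submodule.mem_bot ℝ).mp h⟩
      | succ p =>
        obtain ⟨θ, hθ⟩ := h
        have hF : 𝔄.inclusion E p q θ ∈ 𝔄.formFiltration E p :=
          inclusion_mem_formFiltration le_rfl q θ
        refine ⟨𝔄.inclusion E p q θ, ⟨⟨?_, ?_⟩, ?_⟩, ?_⟩
        · exact inclusion_mem_formFiltration (by push_cast; omega) q θ
        · exact inclusion_mem_totalDegree' (by push_cast; ring) θ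
        · exact D_mem_formFiltration_succ h0 (by push_cast; ring) hF
        · rw [component_succ_D h0 q hF, component_inclusion_self, hθ]
    obtain ⟨y, hy, hyz⟩ := key
    have hyT : R.D y ∈ 𝔄.totalDegree E (p + q) := by
      have := R.map_totalDegree _ _ hy.1.2
      rwa [sub_add_cancel] at this
    have hyF : R.D y ∈ 𝔄.formFiltration E p := by
      have h3 : R.D y ∈ 𝔄.formFiltration E (p - 2 + 1 + (2 - 1)) := hy.2
      rwa [show (p : ℤ) - 2 + 1 + (2 - 1) = p by ring] at h3
    refine ⟨z - R.D y, ⟨⟨?_, Submodule.sub_mem _ hzT hyT⟩, ?_⟩, y, hy, sub_add_cancel _ _⟩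
    · refine LieAlgebroid.mem_formFiltration_succ (p := p) (q := q) rfl
        (Submodule.sub_mem _ hzF hyF) (Submodule.sub_mem _ hzT hyT) ?_
      rw [map_sub, hyz, sub_self]
    · change R.D (z - R.D y) ∈ 𝔄.formFiltration E (p + 1 + (2 - 1))
      rw [map_sub, R.sq_zero, sub_zero, show (p : ℤ) + 1 + (2 - 1) = p + 2 by ring]
      exact hzD
  · rintro ⟨b, hb, y, hy, h⟩
    have hbF : b ∈ 𝔄.formFiltration E (p + 1) := hb.1.1
    have hyF : y ∈ 𝔄.formFiltration E (p - 2 + 1) := hy.1.1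
    have h1 : b + R.D y = z := h
    rw [← h1, map_add, mem_formFiltration.mp hbF p q (by omega), zero_add]
    cases p with
    | zero =>
      have h2 : R.D y ∈ 𝔄.formFiltration E (0 + 1) :=
        D_mem_formFiltration_succ h0 rfl (by rw [formFiltration_eq_top le_rfl]; trivial)
      rw [mem_formFiltration.mp h2 0 q (by simp)]
      exact Submodule.zero_mem _
    | succ p =>
      have hyF' : y ∈ 𝔄.formFiltration E p := by
        rwa [show ((p + 1 : ℕ) : ℤ) - 2 + 1 = p by push_cast; ring] at hyF
      rw [component_succ_D h0 q hyF']
      exact ⟨_, rfl⟩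

/-- The second page, if the underlying complex has zero differential. -/
noncomputable def pageTwoEquiv (h0 : ∀ m n s, R.del m n s = 0) (p : ℕ) (q : ℤ) :
    R.filteredComplex.PageX 2 (p, q) ≃ₗ[ℝ] (R.conn q).Cohomology p :=
  quotEquivOfSurjective (Submodule.mkQ _ ∘ₗ leadingComponent h0 p q)
    ((Submodule.mkQ_surjective _).comp (leadingComponent_surjective h0 p q)) _ fun z =>
      (Submodule.Quotient.mk_eq_zero _).trans (leadingComponent_mem_coboundaries h0 p q z)

end RepUpToHomotopy

end SecondPage

/-! ### The theorem -/

theorem mainTheorem2 {E₀ : Type*} [NormedAddCommGroup E₀] [NormedSpace ℝ E₀]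
    [FiniteDimensional ℝ E₀] {M : Type u} [TopologicalSpace M] [ChartedSpace E₀ M]
    [IsManifold 𝓘(ℝ, E₀) ∞ M] [T2Space M] [SecondCountableTopology M]
    (𝔄 : LieAlgebroid.{v} E₀ M) (E : ℤ → VBundle.{w} E₀ M) (R : RepUpToHomotopy 𝔄 E)
    (hR : R.IsRegular) :
    Nonempty R.CohomologyBundle ∧
    ∀ C : R.CohomologyBundle,
      (∀ (n : ℤ) (T : (C.H n).Sec),
        ∃ (S : (E n).Sec) (hS : R.del n (n + 1) S = 0), C.cls S hS = T) ∧
      ∃ c : ∀ n : ℤ, AConnection 𝔄 (C.H n),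
        (∀ n : ℤ, (c n).IsFlat) ∧
        (∀ (n : ℤ) (α : 𝔄.A.Sec) (S : (E n).Sec) (hS : R.del n (n + 1) S = 0),
          ∃ h : R.del n (n + 1) (R.nabla n α S) = 0,
            (c n).nabla α (C.cls S hS) = C.cls (R.nabla n α S) h) ∧
        (∃ R' : RepUpToHomotopy 𝔄 C.H,
          (∀ n : ℤ, R'.del n (n + 1) = 0) ∧
          (∀ (n : ℤ) (α : 𝔄.A.Sec) (T : (C.H n).Sec), R'.nabla n α T = (c n).nabla α T) ∧
          ∃ Φ : RepMorphism R R', Φ.IsQuasiIso) ∧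
        ∃ S : CategoryTheory.E₂CohomologicalSpectralSequence (ModuleCat.{max u v w} ℝ),
          (∀ (p : ℕ) (q : ℤ),
            Nonempty ((S.page 2 le_rfl).X ((p : ℤ), q) ≅ ModuleCat.of ℝ ((c q).Cohomology p))) ∧
          (∀ p q : ℤ, p < 0 → CategoryTheory.Limits.IsZero ((S.page 2 le_rfl).X (p, q))) ∧
          SpectralConverges S R.Cohomology R.cohomologyFiltration := by
  obtain ⟨τ⟩ := hR.exists_splitting
  refine ⟨τ.nonempty_cohomologyBundle hR, fun C => ?_⟩
  -- The contraction is adapted to the given `C`, with `[S] = p S` on `Ker ∂`. All remaining data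
  -- come from the one transferred structure `σ.transfer`.
  obtain ⟨σ, hσ⟩ := τ.exists_contraction C
  refine ⟨C.exists_cls_eq σ hσ, σ.transfer.conn, fun n => ?_, fun n α S hS => ?_,
    ⟨σ.transfer, fun n => LinearMap.ext fun t => σ.transfer_del n (n + 1) t, fun _ _ _ => rfl,
      σ.toTransfer, σ.toTransfer_isQuasiIso⟩,
    σ.transfer.filteredComplex.spectralSequence, fun p q => ?_,
    fun p q hp => σ.transfer.isZero_page_two_of_neg hp, σ.spectralConverges⟩
  · exact σ.transfer.conn_isFlat (fun m => LinearMap.ext fun t => σ.transfer_del m n t)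
      fun m => LinearMap.ext fun t => σ.transfer_del n m t
  · have h : R.del n (n + 1) (R.nabla n α S) = 0 := by
      rw [R.del_nabla rfl, hS, ← RepUpToHomotopy.conn_nabla, map_zero]
    refine ⟨h, ?_⟩
    rw [RepUpToHomotopy.conn_nabla, hσ, hσ, σ.transfer_nabla_p n α hS]
  · exact ⟨(RepUpToHomotopy.pageTwoEquiv σ.transfer_del p q).toModuleIso⟩
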